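/- Let $d\ge 2$, $k\ge 1$, and let $\Omega\subset\mathbb R^d$ be a bounded connected open set with $\Omega=\operatorname{int}\overline\Omega$ (for instance a bounded Lipschitz polytope). Let $\mathcal T$ be a conforming simplicial mesh of $\Omega$: a finite set of closed $d$-simplices with $\bigcup_{K\in\mathcal T}K=\overline\Omega$ whose faces form a simplicial complex $\mathcal S$. Let $\mathcal S_\ell$ be the set of $\ell$-dimensional faces, $\mathcal F=\mathcal S_{d-1}$ the set of facets, $\mathcal V(\tau)$ the vertex set of a face $\tau$, and let $\mathcal S_{\ell,\Omega}$, $\mathcal F_\Omega$ be the subsets of inner faces and facets, i.e. those not contained in $\partial\Omega$. Functions on the mesh may be discontinuous across element boundaries and are regarded as families $(v|_K)_{K\in\mathcal T}$ of functions on the closed elements. Spaces. $S_k(\mathcal T)$ is the space of continuous functions on $\overline\Omega$ that are polynomials of degree at most $k$ on each $K\in\mathcal T$, and $S_{k,0}(\mathcal T)=S_k(\mathcal T)\cap H^1_0(\Omega)$. With the Jacobi polynomials $P_n^{(a,b)}$, normalized by $P_n^{(a,b)}(1)=\binom{n+a}{n}$, and the barycentric coordinates $\lambda_{K,\mathbf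 z}$ of $K$, set $$B_k^{\mathrm{CR},K}=\frac1d\Bigl(-1+\sum_{\mathbf z\in\mathcal V(K)}P_k^{(0,d-2)}(1-2\lambda_{K,\mathbf z})\Bigr)\ \text{on }K,\qquad 0\ \text{on the other elements},$$ $$B_k^{\mathrm{CR},F}=P_k^{(0,d-2)}(1-2\lambda_{K,F})-B_k^{\mathrm{CR},K}\ \text{on each }K\supset F,\qquad 0\ \text{on the other elements},$$ where $\lambda_{K,F}$ is the barycentric coordinate of the vertex of $K$ opposite to $F$. For odd $k$ let $$\mathrm{CR}_k(\mathcal T)=S_k(\mathcal T)+\operatorname{span}\{B_k^{\mathrm{CR},F}:F\in\mathcal F\},\qquad \mathrm{CR}_{k,0}(\mathcal T)=S_{k,0}(\mathcal T)+\operatorname{span}\{B_k^{\mathrm{CR},F}:F\in\mathcal F_\Omega\},$$ and for even $k$ let $$\mathrm{CR}_k(\mathcal T)=S_k(\mathcal T)+\operatorname{span}\{B_k^{\mathrm{CR},K}:K\in\mathcal T\},\qquad \mathrm{CR}_{k,0}(\mathcal T)=S_{k,0}(\mathcal T)+\operatorname{span}\{B_k^{\mathrm{CR},K}:K\in\mathcal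 T\}.$$ Conforming functions. Let $\varphi_{\mathbf z}$ be the continuous, piecewise affine hat function of the vertex $\mathbf z$, and let $W_\tau=\prod_{\mathbf z\in\mathcal V(\tau)}\varphi_{\mathbf z}$ be the bubble of a face $\tau$. For each $\tau\in\mathcal S_\ell$ fix any numbering $\mathbf A_0(\tau),\dots,\mathbf A_\ell(\tau)$ of its vertices. For $\alpha\in\mathbb N_0^\ell$ with $|\alpha|\le k-(\ell+1)$ put $B_{\tau,\alpha}=W_\tau\,P^{\mathrm{bary}}_\alpha(\varphi_{\mathbf A_0(\tau)},\dots,\varphi_{\mathbf A_\ell(\tau)})$ on the elements $K\supset\tau$ and $B_{\tau,\alpha}=0$ on all other elements, where $$P^{\mathrm{bary}}_\alpha(\mathbf y)=\prod_{j=1}^{\ell}\Bigl(y_0+\sum_{m=j}^{\ell}y_m\Bigr)^{\alpha_j}P^{(s_j,1)}_{\alpha_j}\Bigl(\frac{2y_j}{y_0+\sum_{m=j}^{\ell}y_m}-1\Bigr),\qquad s_j=2\sum_{m=j+1}^{\ell}\alpha_m+2(\ell-j)+1,$$ which is a polynomial in $\mathbf y$. For $\ell=0$ this gives $B_{\mathbf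 z,0}=\varphi_{\mathbf z}$. Let $\mathcal B_\ell(\mathcal T)$ be the family of all $B_{\tau,\alpha}$ with $\tau\in\mathcal S_\ell$, $|\alpha|\le k-(\ell+1)$, and $\mathcal B_{\ell,0}(\mathcal T)$ the subfamily with $\tau\in\mathcal S_{\ell,\Omega}$. Claim. 1. If $k$ is odd, then $\bigcup_{\ell=1}^{\min\{k-1,d\}}\mathcal B_\ell(\mathcal T)\cup\{B_k^{\mathrm{CR},F}:F\in\mathcal F\}$ is a basis of $\mathrm{CR}_k(\mathcal T)$, and $\bigcup_{\ell=1}^{\min\{k-1,d\}}\mathcal B_{\ell,0}(\mathcal T)\cup\{B_k^{\mathrm{CR},F}:F\in\mathcal F_\Omega\}$ is a basis of $\mathrm{CR}_{k,0}(\mathcal T)$. 2. If $k$ is even, then for every $K_0\in\mathcal T$ the family $\bigcup_{\ell=0}^{\min\{k-1,d\}}\mathcal B_\ell(\mathcal T)\cup\{B_k^{\mathrm{CR},K}:K\in\mathcal T\setminus\{K_0\}\}$ is a basis of $\mathrm{CR}_k(\mathcal T)$, and $\bigcup_{\ell=0}^{\min\{k-1,d\}}\mathcal B_{\ell,0}(\mathcal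 T)\cup\{B_k^{\mathrm{CR},K}:K\in\mathcal T\}$ is a basis of $\mathrm{CR}_{k,0}(\mathcal T)$. -/

import Mathlib

open scoped ENNReal ContDiff Topology

noncomputable section

namespace CrouzeixRaviart

/-! ### Jacobi polynomials and orthogonal polynomials on the reference simplex -/

/-- The Jacobi polynomial `P_n^{(a,b)}` (natural parameters, standard normalization
`P_n^{(a,b)}(1) = (a+1)_n / n!`), by the classical formula
`2⁻ⁿ ∑ᵢ binom(n+a, i) binom(n+b, n-i) (x-1)^(n-i) (x+1)^i`. -/
def jacobi (n a b : ℕ) : Polynomial ℝ :=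
  ∑ i ∈ Finset.range (n + 1),
    Polynomial.C ((((n + a).choose i * (n + b).choose (n - i) : ℕ) : ℝ) / 2 ^ n) *
      (Polynomial.X - 1) ^ (n - i) * (Polynomial.X + 1) ^ i

theorem jacobi_eval_one (n a b : ℕ) : (jacobi n a b).eval 1 = (n + a).choose n := by
  simp only [jacobi, Polynomial.eval_finsetSum, Polynomial.eval_mul, Polynomial.eval_C,
    Polynomial.eval_pow, Polynomial.eval_sub, Polynomial.eval_add, Polynomial.eval_X,
    Polynomial.eval_one]
  rw [Finset.sum_eq_single n]
  · norm_num
  · intro i hi hne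
    have : n - i ≠ 0 := by
      have := Finset.mem_range.1 hi
      omega
    simp [zero_pow this]
  · simp

/-- The sum `y₀ + ∑_{m ≥ j} y_m`, where `j = 1, …, ℓ` is encoded by `j : Fin ℓ`
and `y_j` by `y j.succ`. -/
def tailSum {ℓ : ℕ} (y : Fin (ℓ + 1) → ℝ) (j : Fin ℓ) : ℝ :=
  y 0 + ∑ m ∈ Finset.Ici j, y m.succ

/-- `s_j = 2 ∑_{m > j} α_m + 2 (ℓ - j) + 1`; the index `j = 1, …, ℓ` is encoded by `j : Fin ℓ`,
hence the shift by one. -/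
def orthParam {ℓ : ℕ} (α : Fin ℓ → ℕ) (j : Fin ℓ) : ℕ :=
  2 * ∑ m ∈ Finset.Ioi j, α m + 2 * (ℓ - (j.val + 1)) + 1

/-- `P_α^bary(y) = ∏_j (y₀ + ∑_{m≥j} y_m)^{α_j} P_{α_j}^{(s_j,1)}(2 y_j / (y₀ + ∑_{m≥j} y_m) - 1)`.
It is only evaluated at `y ≥ 0`, where a vanishing denominator forces `y_j = 0`; the
corresponding factor is then `0` for `α_j ≥ 1` and `1` for `α_j = 0`, which is the value of the
homogeneous polynomial denoted by this expression. -/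
def orthBary {ℓ : ℕ} (α : Fin ℓ → ℕ) (y : Fin (ℓ + 1) → ℝ) : ℝ :=
  ∏ j : Fin ℓ, tailSum y j ^ α j *
    (jacobi (α j) (orthParam α j) 1).eval (2 * y j.succ / tailSum y j - 1)

/-! ### The Sobolev space `H¹₀` -/

/-- The partial derivative `∂ᵢ φ`. -/
def partialDeriv {d : ℕ} (i : Fin d) (φ : EuclideanSpace ℝ (Fin d) → ℝ)
    (x : EuclideanSpace ℝ (Fin d)) : ℝ :=
  fderiv ℝ φ x (EuclideanSpace.single i 1)

/-- `u ∈ H¹₀(Ω)`: `u` is a limit in `H¹(Ω)` of smooth functions with compact support in `Ω`,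
i.e. these converge to `u` in `L²(Ω)` and their partial derivatives converge in `L²(Ω)`
(to the weak partial derivatives `g i` of `u`). -/
def MemH10 {d : ℕ} (Ω : Set (EuclideanSpace ℝ (Fin d))) (u : EuclideanSpace ℝ (Fin d) → ℝ) :
    Prop :=
  MeasureTheory.MemLp u 2 (MeasureTheory.volume.restrict Ω) ∧
  ∃ g : Fin d → EuclideanSpace ℝ (Fin d) → ℝ,
    (∀ i, MeasureTheory.MemLp (g i) 2 (MeasureTheory.volume.restrict Ω)) ∧
    ∃ φ : ℕ → EuclideanSpace ℝ (Fin d) → ℝ,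
      (∀ n, ContDiff ℝ ∞ (φ n) ∧ HasCompactSupport (φ n) ∧ tsupport (φ n) ⊆ Ω) ∧
      Filter.Tendsto (fun n => MeasureTheory.eLpNorm (fun x => φ n x - u x) 2
        (MeasureTheory.volume.restrict Ω)) Filter.atTop (𝓝 0) ∧
      ∀ i, Filter.Tendsto (fun n => MeasureTheory.eLpNorm
        (fun x => partialDeriv i (φ n) x - g i x) 2
        (MeasureTheory.volume.restrict Ω)) Filter.atTop (𝓝 0)

theorem memH10_zero {d : ℕ} (Ω : Set (EuclideanSpace ℝ (Fin d))) :
    MemH10 Ω (fun _ => 0) := by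
  refine ⟨MeasureTheory.MemLp.zero', fun _ _ => 0, fun _ => MeasureTheory.MemLp.zero',
    fun _ _ => 0, fun n => ⟨contDiff_const, ?_, ?_⟩, ?_, fun i => ?_⟩
  · exact HasCompactSupport.zero
  · have : tsupport (fun _ : EuclideanSpace ℝ (Fin d) => (0 : ℝ)) = ∅ :=
      tsupport_eq_empty_iff.2 rfl
    rw [this]
    exact Set.empty_subset _
  · simp
  · simp [partialDeriv]

theorem continuous_partialDeriv {d : ℕ} (i : Fin d) {φ : EuclideanSpace ℝ (Fin d) → ℝ}
    (h : ContDiff ℝ ∞ φ) : Continuous (partialDeriv i φ) :=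
  (h.continuous_fderiv (by simp)).clm_apply continuous_const

theorem tendsto_eLpNorm_add_sub {X : Type*} [MeasurableSpace X] {μ : MeasureTheory.Measure X}
    {f f' : ℕ → X → ℝ} {u u' : X → ℝ}
    (hf : ∀ n, MeasureTheory.AEStronglyMeasurable (f n) μ)
    (hf' : ∀ n, MeasureTheory.AEStronglyMeasurable (f' n) μ)
    (hu : MeasureTheory.AEStronglyMeasurable u μ)
    (hu' : MeasureTheory.AEStronglyMeasurable u' μ)
    (h : Filter.Tendsto (fun n => MeasureTheory.eLpNorm (fun x => f n x - u x) 2 μ)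
      Filter.atTop (𝓝 0))
    (h' : Filter.Tendsto (fun n => MeasureTheory.eLpNorm (fun x => f' n x - u' x) 2 μ)
      Filter.atTop (𝓝 0)) :
    Filter.Tendsto (fun n => MeasureTheory.eLpNorm
      (fun x => (f n x + f' n x) - (u x + u' x)) 2 μ) Filter.atTop (𝓝 0) := by
  refine tendsto_of_tendsto_of_tendsto_of_le_of_le tendsto_const_nhds
    (by simpa using h.add h') (fun n => zero_le) (fun n => ?_)
  have := MeasureTheory.eLpNorm_add_le (p := 2) ((hf n).sub hu) ((hf' n).sub hu') (by norm_num)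
  refine le_trans (le_of_eq ?_) this
  congr 1
  funext x
  simp only [Pi.add_apply, Pi.sub_apply]
  ring

theorem tendsto_eLpNorm_mul_sub {X : Type*} [MeasurableSpace X] {μ : MeasureTheory.Measure X}
    {f : ℕ → X → ℝ} {u : X → ℝ} (c : ℝ)
    (h : Filter.Tendsto (fun n => MeasureTheory.eLpNorm (fun x => f n x - u x) 2 μ)
      Filter.atTop (𝓝 0)) :
    Filter.Tendsto (fun n => MeasureTheory.eLpNorm (fun x => c * f n x - c * u x) 2 μ)
      Filter.atTop (𝓝 0) := by
  have e : ∀ n, (fun x => c * f n x - c * u x) = c • (fun x => f n x - u x) := by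
    intro n; funext x; simp [mul_sub]
  simp only [e, MeasureTheory.eLpNorm_const_smul]
  simpa using ENNReal.Tendsto.const_mul h (Or.inr (enorm_ne_top (x := c)))

theorem MemH10.add {d : ℕ} {Ω : Set (EuclideanSpace ℝ (Fin d))}
    {u v : EuclideanSpace ℝ (Fin d) → ℝ} (hu : MemH10 Ω u) (hv : MemH10 Ω v) :
    MemH10 Ω (fun x => u x + v x) := by
  obtain ⟨hu2, g, hg, φ, hφ, h1, h2⟩ := hu
  obtain ⟨hv2, g', hg', ψ, hψ, h1', h2'⟩ := hv
  refine ⟨hu2.add hv2, fun i x => g i x + g' i x, fun i => (hg i).add (hg' i),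
    fun n x => φ n x + ψ n x, fun n => ⟨(hφ n).1.add (hψ n).1, (hφ n).2.1.add (hψ n).2.1,
      (tsupport_add (φ n) (ψ n)).trans (Set.union_subset (hφ n).2.2 (hψ n).2.2)⟩, ?_, fun i => ?_⟩
  · exact tendsto_eLpNorm_add_sub (fun n => (hφ n).1.continuous.aestronglyMeasurable)
      (fun n => (hψ n).1.continuous.aestronglyMeasurable) hu2.1 hv2.1 h1 h1'
  · have e : ∀ n x, partialDeriv i (fun x => φ n x + ψ n x) x =
        partialDeriv i (φ n) x + partialDeriv i (ψ n) x := by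
      intro n x
      simp only [partialDeriv]
      rw [fderiv_fun_add ((hφ n).1.differentiable (by simp) x)
        ((hψ n).1.differentiable (by simp) x)]
      rfl
    simp only [e]
    exact tendsto_eLpNorm_add_sub
      (fun n => (continuous_partialDeriv i (hφ n).1).aestronglyMeasurable)
      (fun n => (continuous_partialDeriv i (hψ n).1).aestronglyMeasurable)
      (hg i).1 (hg' i).1 (h2 i) (h2' i)

theorem MemH10.smul {d : ℕ} {Ω : Set (EuclideanSpace ℝ (Fin d))}
    {u : EuclideanSpace ℝ (Fin d) → ℝ} (c : ℝ) (hu : MemH10 Ω u) :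
    MemH10 Ω (fun x => c * u x) := by
  obtain ⟨hu2, g, hg, φ, hφ, h1, h2⟩ := hu
  refine ⟨hu2.const_mul c, fun i x => c * g i x, fun i => (hg i).const_mul c,
    fun n x => c * φ n x, fun n => ⟨contDiff_const.mul (hφ n).1, (hφ n).2.1.mul_left,
      (tsupport_mul_subset_right (f := fun _ => c) (g := φ n)).trans (hφ n).2.2⟩,
    tendsto_eLpNorm_mul_sub c h1, fun i => ?_⟩
  have e : ∀ n x, partialDeriv i (fun x => c * φ n x) x = c * partialDeriv i (φ n) x := by
    intro n x
    simp only [partialDeriv]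
    rw [fderiv_const_mul ((hφ n).1.differentiable (by simp) x) c]
    rfl
  simp only [e]
  exact tendsto_eLpNorm_mul_sub c (h2 i)

/-! ### Conforming simplicial meshes -/

/-- A conforming simplicial mesh of `Ω ⊆ ℝᵈ`, given by its (finite) simplicial complex. A simplex
is encoded by its finite vertex set `τ`; the closed simplex is `convexHull ℝ τ`. The elements of
the mesh are the `d`-simplices of the complex; every simplex is a face of an element, and the
elements cover the closure of `Ω`. -/
structure Mesh (d : ℕ) (Ω : Set (EuclideanSpace ℝ (Fin d))) extends
    Geometry.SimplicialComplex ℝ (EuclideanSpace ℝ (Fin d)) where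
  finite_faces : faces.Finite
  exists_cell : ∀ τ ∈ faces, ∃ K ∈ faces, K.card = d + 1 ∧ τ ⊆ K
  space_eq : toSimplicialComplex.space = closure Ω

variable {d : ℕ} {Ω : Set (EuclideanSpace ℝ (Fin d))}

namespace Mesh

/-- The elements `K ∈ 𝒯`. -/
def Cell (M : Mesh d Ω) : Type :=
  {K : Finset (EuclideanSpace ℝ (Fin d)) // K ∈ M.faces ∧ K.card = d + 1}

/-- The closed simplex `K`. -/
def Cell.carrier {M : Mesh d Ω} (K : M.Cell) : Set (EuclideanSpace ℝ (Fin d)) :=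
  convexHull ℝ (K.1 : Set (EuclideanSpace ℝ (Fin d)))

theorem Cell.carrier_subset {M : Mesh d Ω} (K : M.Cell) : K.carrier ⊆ closure Ω := by
  rw [← M.space_eq]
  exact M.toSimplicialComplex.convexHull_subset_space K.2.1

/-- All simplices (faces) of the complex. -/
def allFaces (M : Mesh d Ω) : Set (Finset (EuclideanSpace ℝ (Fin d))) := M.faces

/-- The inner faces: those which are not contained in `∂Ω`. -/
def innerFaces (M : Mesh d Ω) : Set (Finset (EuclideanSpace ℝ (Fin d))) :=
  {τ ∈ M.faces | ¬ convexHull ℝ (τ : Set (EuclideanSpace ℝ (Fin d))) ⊆ frontier Ω}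

/-- The facets, i.e. `(d-1)`-simplices, among a set `𝒮` of faces. -/
def facetsIn (_M : Mesh d Ω) (𝒮 : Set (Finset (EuclideanSpace ℝ (Fin d)))) :
    Set (Finset (EuclideanSpace ℝ (Fin d))) :=
  {F ∈ 𝒮 | F.card = d}

/-- The vertices of an element as an affine basis of `ℝᵈ`. -/
def Cell.basis {M : Mesh d Ω} (K : M.Cell) : AffineBasis K.1 ℝ (EuclideanSpace ℝ (Fin d)) where
  toFun := (↑)
  ind' := M.indep K.2.1
  tot' := by
    refine (M.indep K.2.1).affineSpan_eq_top_iff_card_eq_finrank_add_one.2 ?_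
    simp [K.2.2]

open Classical in
/-- For a vertex `z` of `K` this is the barycentric coordinate `λ_{K,z}`; it is `0` if `z` is not
a vertex of `K`. Hence `K ↦ bary K z` on `K` is the hat function of the mesh vertex `z`. -/
def Cell.bary {M : Mesh d Ω} (K : M.Cell) (z x : EuclideanSpace ℝ (Fin d)) : ℝ :=
  if h : z ∈ K.1 then K.basis.coord ⟨z, h⟩ x else 0

/-! ### Function spaces -/

/-- Functions on the mesh which may be discontinuous across element boundaries: a family of
functions `v|_K : K → ℝ` on the closed elements. -/
abbrev Broken (M : Mesh d Ω) : Type :=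
  (K : M.Cell) → K.carrier → ℝ

/-- Restriction of functions on the closure of `Ω` to the elements. -/
def restrict (M : Mesh d Ω) : C(closure Ω, ℝ) →ₗ[ℝ] M.Broken where
  toFun f := fun K x => f ⟨x.1, K.carrier_subset x.2⟩
  map_add' _ _ := rfl
  map_smul' _ _ := rfl

/-- `S_k(𝒯)`: continuous functions on the closure of `Ω` which are polynomials of total degree at
most `k` on each element. -/
def S (M : Mesh d Ω) (k : ℕ) : Submodule ℝ C(closure Ω, ℝ) where
  carrier := {f | ∀ K : M.Cell, ∃ p : MvPolynomial (Fin d) ℝ, p.totalDegree ≤ k ∧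
    ∀ x : K.carrier, f ⟨x.1, K.carrier_subset x.2⟩ = MvPolynomial.eval (fun i => x.1 i) p}
  zero_mem' := fun _ => ⟨0, by simp, by simp⟩
  add_mem' := by
    intro f g hf hg K
    obtain ⟨p, hp, hp'⟩ := hf K
    obtain ⟨q, hq, hq'⟩ := hg K
    refine ⟨p + q, (MvPolynomial.totalDegree_add p q).trans (max_le hp hq), fun x => ?_⟩
    simp [hp' x, hq' x]
  smul_mem' := by
    intro c f hf K
    obtain ⟨p, hp, hp'⟩ := hf K
    refine ⟨c • p, (MvPolynomial.totalDegree_smul_le c p).trans hp, fun x => ?_⟩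
    simp [hp' x]

open Classical in
/-- Extension by zero from the closure of `Ω`; only the values on `Ω` matter for `H¹₀(Ω)`. -/
def extendZero (f : C(closure Ω, ℝ)) (x : EuclideanSpace ℝ (Fin d)) : ℝ :=
  if h : x ∈ closure Ω then f ⟨x, h⟩ else 0

/-- `S_{k,0}(𝒯) = S_k(𝒯) ∩ H¹₀(Ω)`. -/
def S0 (M : Mesh d Ω) (k : ℕ) : Submodule ℝ C(closure Ω, ℝ) where
  carrier := {f | f ∈ M.S k ∧ MemH10 Ω (extendZero f)}
  zero_mem' := by
    refine ⟨zero_mem _, ?_⟩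
    convert! memH10_zero Ω using 2
    simp [extendZero]
  add_mem' := by
    intro f g hf hg
    refine ⟨add_mem hf.1 hg.1, ?_⟩
    convert! hf.2.add hg.2 using 2 with x
    by_cases h : x ∈ closure Ω <;> simp [extendZero, h]
  smul_mem' := by
    intro c f hf
    refine ⟨Submodule.smul_mem _ c hf.1, ?_⟩
    convert! hf.2.smul c using 2 with x
    by_cases h : x ∈ closure Ω <;> simp [extendZero, h]

/-! ### The non-conforming functions and the Crouzeix-Raviart spaces -/

/-- `1/d (-1 + ∑_{z ∈ 𝒱(K)} P_k^{(0,d-2)}(1 - 2 λ_{K,z}))`. -/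
def Cell.crValue {M : Mesh d Ω} (K : M.Cell) (k : ℕ) (x : EuclideanSpace ℝ (Fin d)) : ℝ :=
  1 / (d : ℝ) * (-1 + ∑ z ∈ K.1, (jacobi k 0 (d - 2)).eval (1 - 2 * K.bary z x))

open Classical in
/-- The simplex function `B_k^{CR,K}`. -/
def crCell (M : Mesh d Ω) (k : ℕ) (K : M.Cell) : M.Broken :=
  fun L x => if L = K then K.crValue k x.1 else 0

open Classical in
/-- The facet function `B_k^{CR,F}`. For a facet `F` of `K` the set `K.1 \ F` consists of the
single vertex of `K` opposite to `F`, so that the inner sum is `λ_{K,F}`. -/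
def crFacet (M : Mesh d Ω) (k : ℕ) (F : Finset (EuclideanSpace ℝ (Fin d))) : M.Broken :=
  fun K x => if F ⊆ K.1 then
    (jacobi k 0 (d - 2)).eval (1 - 2 * ∑ z ∈ K.1 \ F, K.bary z x.1) - K.crValue k x.1
  else 0

/-- `CR_k(𝒯)`. -/
def CR (M : Mesh d Ω) (k : ℕ) : Submodule ℝ M.Broken :=
  if Even k then
    (M.S k).map M.restrict ⊔ Submodule.span ℝ (Set.range (M.crCell k))
  else
    (M.S k).map M.restrict ⊔ Submodule.span ℝ (M.crFacet k '' M.facetsIn M.allFaces)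

/-- `CR_{k,0}(𝒯)`. -/
def CR0 (M : Mesh d Ω) (k : ℕ) : Submodule ℝ M.Broken :=
  if Even k then
    (M.S0 k).map M.restrict ⊔ Submodule.span ℝ (Set.range (M.crCell k))
  else
    (M.S0 k).map M.restrict ⊔ Submodule.span ℝ (M.crFacet k '' M.facetsIn M.innerFaces)

/-! ### The conforming basis functions -/

/-- The dimension of a (nonempty) simplex. -/
def dim (τ : Finset (EuclideanSpace ℝ (Fin d))) : ℕ := τ.card - 1

/-- A numbering `A_0(τ), …, A_ℓ(τ)` of the vertices of each face `τ`, `ℓ = dim τ`. -/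
structure Numbering (M : Mesh d Ω) where
  vertex : (τ : Finset (EuclideanSpace ℝ (Fin d))) → Fin (dim τ + 1) → EuclideanSpace ℝ (Fin d)
  injective : ∀ τ ∈ M.faces, Function.Injective (vertex τ)
  range_eq : ∀ τ ∈ M.faces, Set.range (vertex τ) = (τ : Set (EuclideanSpace ℝ (Fin d)))

/-- The face bubble `W_τ`, the product of the hat functions of the vertices of `τ`. -/
def bubble (M : Mesh d Ω) (τ : Finset (EuclideanSpace ℝ (Fin d))) : M.Broken :=
  fun K x => ∏ z ∈ τ, K.bary z x.1

open Classical in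
/-- The conforming basis function `B_{τ,α}`: on the elements `K ⊇ τ` it is
`W_τ P_α^bary(φ_{A_0(τ)}, …, φ_{A_ℓ(τ)})` with the hat functions `φ`, and it is zero on all other
elements. For `ℓ = 0` it is the hat function of the vertex. -/
def confBasis (M : Mesh d Ω) (A : M.Numbering)
    (i : (τ : Finset (EuclideanSpace ℝ (Fin d))) × (Fin (dim τ) → ℕ)) : M.Broken :=
  fun K x => if i.1 ⊆ K.1 then
    M.bubble i.1 K x * orthBary i.2 (fun j => K.bary (A.vertex i.1 j) x.1)
  else 0

/-- The pairs `(τ, α)` with `τ` a face in `𝒮` of dimension `ℓ ≤ min (k-1) d`, `ℓ ≥ 1` if `k` is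
odd, and a multi-index `α` with `|α| ≤ k - (ℓ + 1)`. -/
def confIndex (_M : Mesh d Ω) (k : ℕ) (𝒮 : Set (Finset (EuclideanSpace ℝ (Fin d)))) :
    Set ((τ : Finset (EuclideanSpace ℝ (Fin d))) × (Fin (dim τ) → ℕ)) :=
  {i | i.1 ∈ 𝒮 ∧ (Odd k → 1 ≤ dim i.1) ∧ dim i.1 ≤ min (k - 1) d ∧
    ∑ j, i.2 j ≤ k - (dim i.1 + 1)}

/-- The functions `B_{τ,α}` together with the facet functions, for faces and facets in `𝒮`. -/
def familyFacet (M : Mesh d Ω) (k : ℕ) (A : M.Numbering)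
    (𝒮 : Set (Finset (EuclideanSpace ℝ (Fin d)))) :
    M.confIndex k 𝒮 ⊕ M.facetsIn 𝒮 → M.Broken :=
  Sum.elim (fun i => M.confBasis A i.1) (fun F => M.crFacet k F.1)

/-- The functions `B_{τ,α}` for faces in `𝒮`, together with the simplex functions of the elements
in `𝒯'`. -/
def familyCell (M : Mesh d Ω) (k : ℕ) (A : M.Numbering)
    (𝒮 : Set (Finset (EuclideanSpace ℝ (Fin d)))) (𝒯' : Set M.Cell) :
    M.confIndex k 𝒮 ⊕ 𝒯' → M.Broken :=
  Sum.elim (fun i => M.confBasis A i.1) (fun K => M.crCell k K.1)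

end Mesh

/-- The family `v` is a basis of the subspace `V`. -/
def IsBasisOf {ι E : Type*} [AddCommGroup E] [Module ℝ E] (v : ι → E) (V : Submodule ℝ E) :
    Prop :=
  LinearIndependent ℝ v ∧ Submodule.span ℝ (Set.range v) = V

end CrouzeixRaviart

end

noncomputable section

namespace CrouzeixRaviart

open MvPolynomial
open scoped MonomialOrder

/-! ### Polynomials in several variables -/

/-! The conforming and the nonconforming functions are treated separately and then linked by two
explicit identities at the vertices.

Conforming part. A function `B_{τ,α}` vanishes on every face that does not contain `τ`, so the
family is triangular with respect to inclusion of faces. In the relative interior of `τ`, once the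
contributions of proper subfaces are known to vanish, only the bubble times a combination of the
`P_α^bary` is left; the bubble is positive there and the `P_α^bary` are independent
(`linearIndepOn_confFun`). Orthogonality plays no role: after eliminating `y₀`, the lexicographic
leading exponent of `P_α^bary` is `α` up to the order of the variables, which gives independence,
and counting dimensions shows that they span the polynomials of degree at most `n`
(`span_orthAffine`). Conversely, a function in `S_k` is corrected skeleton by skeleton: a remainder
that vanishes on the proper faces of `τ` is, on `τ`, a homogeneous polynomial in the barycentric
coordinates divisible by their product (`mem_span_confFun`).

Boundary conditions. `S_{k,0}` consists of the functions in `S_k` that vanish on the frontier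
(`Mesh.mem_S0_iff`). A nonzero value at a frontier point would be a jump of the zero extension,
contradicting the `L²` translation estimate for `H¹₀`. In the other direction, the zero extension is
Lipschitz and is approximated by truncation and mollification. A face that meets `Ω` has its
relative interior in `Ω`, so the bubbles of inner faces vanish on the frontier.

Nonconforming part. Let `p(t) = P_k^{(0,d-2)}(1 - 2t)`; then `p(0) = 1` and the sign of `p(1)` is
`(-1)^k`. For odd `k`, the facet functions of all facets through a vertex `z` add up to `1 - p(φ_z)`
(`sum_crFacet_vertex`). This is conforming, is zero at the other vertices and nonzero at `z`, so it
replaces the missing vertex functions. A combination of facet functions that vanishes at all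
vertices has zero coefficients, by a small linear system on each element. For even `k`, every
simplex function has the same positive value at all vertices of its element. Hence in a conforming
combination the coefficients of touching elements agree, and by connectedness all coefficients
agree. The sum of all simplex functions is indeed conforming (`sum_crCell`), so exactly one function
is redundant; with zero boundary values a vertex on the frontier excludes this relation too. -/

theorem totalDegree_aeval_le_of_le_one {σ τ : Type*} (p : MvPolynomial σ ℝ)
    (g : σ → MvPolynomial τ ℝ) (hg : ∀ i, (g i).totalDegree ≤ 1) :
    (aeval g p).totalDegree ≤ p.totalDegree := by
  rw [aeval_def, eval₂_eq]
  refine totalDegree_finsetSum_le fun s hs => ?_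
  refine (totalDegree_mul _ _).trans ?_
  rw [algebraMap_eq, totalDegree_C, zero_add]
  refine (totalDegree_finsetProd _ _).trans ?_
  refine le_trans (Finset.sum_le_sum fun i _ => ?_) (le_totalDegree hs)
  exact (totalDegree_pow _ _).trans (by simpa using Nat.mul_le_mul_left (s i) (hg i))

/-- Among the terms with nonzero coefficient, the largest leading monomial occurs only once and
cannot cancel. -/
theorem linearIndependent_of_monomialOrder_degree_injective {σ ι : Type*} (m : MonomialOrder σ)
    (v : ι → MvPolynomial σ ℝ) (hv : ∀ i, v i ≠ 0)
    (hinj : Function.Injective fun i => m.degree (v i)) : LinearIndependent ℝ v := by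
  classical
  rw [linearIndependent_iff']
  intro s c hc
  by_contra! hne
  obtain ⟨i₀, hi₀, hci₀⟩ := hne
  obtain ⟨i, hi, hmax⟩ := (s.filter fun i => c i ≠ 0).exists_max_image
    (fun i => m.toSyn (m.degree (v i))) ⟨i₀, by simp [hi₀, hci₀]⟩
  simp only [Finset.mem_filter] at hi hmax
  have h := congrArg (coeff (m.degree (v i))) hc
  rw [coeff_sum, Finset.sum_eq_single i] at h
  · rw [coeff_smul, coeff_zero, smul_eq_mul, mul_eq_zero] at h
    rcases h with h | h
    · exact hi.2 h
    · exact (m.coeff_degree_ne_zero_iff.2 (hv i)) h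
  · intro j hj hji
    by_cases hcj : c j = 0
    · simp [hcj]
    · rw [coeff_smul, m.coeff_eq_zero_of_lt, smul_zero]
      refine lt_of_le_of_ne (hmax j ⟨hj, hcj⟩) fun h => hji (hinj (m.toSyn.injective h))
  · intro h
    exact absurd hi.1 h

/-! ### Jacobi polynomials -/

theorem jacobi_eval_neg_one (n a b : ℕ) :
    (jacobi n a b).eval (-1) = (-1) ^ n * (n + b).choose n := by
  simp only [jacobi, Polynomial.eval_finsetSum, Polynomial.eval_mul, Polynomial.eval_C,
    Polynomial.eval_pow, Polynomial.eval_sub, Polynomial.eval_add, Polynomial.eval_X,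
    Polynomial.eval_one]
  rw [Finset.sum_eq_single 0]
  · have : (-1 - 1 : ℝ) ^ n = (-1) ^ n * 2 ^ n := by rw [← mul_pow]; norm_num
    simp [this]
    field_simp
  · intro i _ hne
    simp [hne]
  · simp

theorem natDegree_jacobi_le (n a b : ℕ) : (jacobi n a b).natDegree ≤ n := by
  refine Polynomial.natDegree_sum_le_of_forall_le _ _ fun i hi => ?_
  have hi := Finset.mem_range.1 hi
  have h1 : ((Polynomial.X - 1 : Polynomial ℝ) ^ (n - i)).natDegree ≤ n - i := by
    simpa using Polynomial.natDegree_pow_le_of_le (n - i)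
      (Polynomial.natDegree_X_sub_C (1 : ℝ)).le
  have h2 : ((Polynomial.X + 1 : Polynomial ℝ) ^ i).natDegree ≤ i := by
    simpa using Polynomial.natDegree_pow_le_of_le i (Polynomial.natDegree_X_add_C (1 : ℝ)).le
  refine (Polynomial.natDegree_mul_le_of_le
    (Polynomial.natDegree_mul_le_of_le (Polynomial.natDegree_C _).le h1) h2).trans ?_
  omega

/-- Every summand is a positive multiple of a monic polynomial of degree `n`, so the top
coefficients add up without cancellation. -/
theorem coeff_jacobi_pos (n a b : ℕ) : 0 < (jacobi n a b).coeff n := by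
  have key : ∀ i ∈ Finset.range (n + 1),
      ((Polynomial.X - 1 : Polynomial ℝ) ^ (n - i) * (Polynomial.X + 1) ^ i).coeff n = 1 := by
    intro i hi
    have hi := Finset.mem_range.1 hi
    have hm1 := (Polynomial.monic_X_sub_C (1 : ℝ)).pow (n - i)
    have hm2 := (Polynomial.monic_X_add_C (1 : ℝ)).pow i
    have hd := hm1.natDegree_mul hm2
    rw [(Polynomial.monic_X_sub_C (1 : ℝ)).natDegree_pow,
      (Polynomial.monic_X_add_C (1 : ℝ)).natDegree_pow, Polynomial.natDegree_X_sub_C,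
      Polynomial.natDegree_X_add_C, mul_one, mul_one, Nat.sub_add_cancel (by omega)] at hd
    have h := (hm1.mul hm2).coeff_natDegree
    rwa [hd, Polynomial.C_1] at h
  simp only [jacobi, Polynomial.finsetSum_coeff, mul_assoc, Polynomial.coeff_C_mul]
  refine Finset.sum_pos (fun i hi => ?_) ⟨0, by simp⟩
  rw [key i hi, mul_one]
  have hi := Finset.mem_range.1 hi
  have h1 : 0 < (n + a).choose i := Nat.choose_pos (by omega)
  have h2 : 0 < (n + b).choose (n - i) := Nat.choose_pos (by omega)
  positivity

/-- The Jacobi polynomial in the variable `t = (x + 1) / 2`. -/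
def shiftedJacobi (n a b : ℕ) : Polynomial ℝ :=
  (jacobi n a b).comp (Polynomial.C 2 * Polynomial.X - 1)

theorem natDegree_shiftedJacobi_le (n a b : ℕ) : (shiftedJacobi n a b).natDegree ≤ n := by
  refine Polynomial.natDegree_comp_le.trans ?_
  have h : (Polynomial.C 2 * Polynomial.X - 1 : Polynomial ℝ).natDegree ≤ 1 := by
    compute_degree
  exact (Nat.mul_le_mul (natDegree_jacobi_le n a b) h).trans (by simp)

theorem coeff_shiftedJacobi_ne_zero (n a b : ℕ) : (shiftedJacobi n a b).coeff n ≠ 0 := by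
  have hd : (jacobi n a b).natDegree = n :=
    le_antisymm (natDegree_jacobi_le n a b)
      (Polynomial.le_natDegree_of_ne_zero (coeff_jacobi_pos n a b).ne')
  have h1 : (Polynomial.C 2 * Polynomial.X - 1 : Polynomial ℝ).natDegree = 1 := by
    compute_degree!
  have h := Polynomial.coeff_comp_degree_mul_degree
    (p := jacobi n a b) (q := (Polynomial.C 2 * Polynomial.X - 1 : Polynomial ℝ)) (by simp [h1])
  have hl : (jacobi n a b).leadingCoeff ≠ 0 := by
    rw [Polynomial.leadingCoeff, hd]
    exact (coeff_jacobi_pos n a b).ne'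
  have h2 : (Polynomial.C 2 * Polynomial.X - 1 : Polynomial ℝ).leadingCoeff ≠ 0 := by
    rw [Polynomial.leadingCoeff_ne_zero]
    intro h0
    simp [h0] at h1
  rw [h1, hd, mul_one] at h
  rw [shiftedJacobi, h]
  positivity

/-! ### Orthogonal polynomials in barycentric coordinates -/

/-- The linear form `y₀ + ∑_{m ≥ j} y_m`. -/
def tailForm {ℓ : ℕ} (j : Fin ℓ) : MvPolynomial (Fin (ℓ + 1)) ℝ :=
  X 0 + ∑ m ∈ Finset.Ici j, X m.succ

/-- The homogeneous polynomial which underlies `orthBary`. -/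
def orthPoly {ℓ : ℕ} (α : Fin ℓ → ℕ) : MvPolynomial (Fin (ℓ + 1)) ℝ :=
  ∏ j : Fin ℓ, ∑ i ∈ Finset.range (α j + 1),
    C ((shiftedJacobi (α j) (orthParam α j) 1).coeff i) * (X j.succ ^ i * tailForm j ^ (α j - i))

theorem orthPoly_isHomogeneous {ℓ : ℕ} (α : Fin ℓ → ℕ) :
    (orthPoly α).IsHomogeneous (∑ j, α j) := by
  refine IsHomogeneous.prod _ _ _ fun j _ => IsHomogeneous.sum _ _ _ fun i hi => ?_
  refine IsHomogeneous.C_mul ?_ _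
  have hi := Finset.mem_range.1 hi
  have hT : (tailForm j : MvPolynomial (Fin (ℓ + 1)) ℝ).IsHomogeneous 1 :=
    (isHomogeneous_X ℝ _).add (IsHomogeneous.sum _ _ _ fun m _ => isHomogeneous_X ℝ _)
  have h := (isHomogeneous_X_pow (R := ℝ) j.succ i).mul (hT.pow (α j - i))
  convert h using 1
  omega

theorem eval_tailForm {ℓ : ℕ} (j : Fin ℓ) (y : Fin (ℓ + 1) → ℝ) :
    eval y (tailForm j) = tailSum y j := by
  simp [tailForm, tailSum]

theorem eval_orthPoly {ℓ : ℕ} (α : Fin ℓ → ℕ) (y : Fin (ℓ + 1) → ℝ) (hy : ∀ i, 0 ≤ y i) :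
    eval y (orthPoly α) = orthBary α y := by
  rw [orthPoly, orthBary, map_prod]
  refine Finset.prod_congr rfl fun j _ => ?_
  simp only [map_sum, map_mul, eval_C, map_pow, eval_X, eval_tailForm]
  set T := tailSum y j with hTdef
  set P := shiftedJacobi (α j) (orthParam α j) 1 with hP
  have hcomp : (jacobi (α j) (orthParam α j) 1).eval (2 * y j.succ / T - 1) =
      P.eval (y j.succ / T) := by
    simp [hP, shiftedJacobi, Polynomial.eval_comp, mul_div_assoc]
  rw [hcomp, Polynomial.eval_eq_sum_range' (Nat.lt_succ_of_le (natDegree_shiftedJacobi_le _ _ _)),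
    Finset.mul_sum]
  refine Finset.sum_congr rfl fun i hi => ?_
  have hi := Finset.mem_range.1 hi
  -- If `T = 0`, nonnegativity forces `y_j = 0`, and Lean's quotient `0 / 0` is `0`. The terms with
  -- `i ≥ 1` then vanish on both sides, and the term `i = 0` carries the factor `0 ^ α j` on both
  -- sides.
  by_cases hT : T = 0
  · have hyj : y j.succ = 0 := by
      have h0 : 0 ≤ ∑ m ∈ Finset.Ici j, y m.succ := Finset.sum_nonneg fun m _ => hy _
      have h1 : y j.succ ≤ ∑ m ∈ Finset.Ici j, y m.succ :=
        Finset.single_le_sum (f := fun m : Fin ℓ => y m.succ) (fun m _ => hy _) (by simp)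
      have h2 : y 0 + ∑ m ∈ Finset.Ici j, y m.succ = 0 := by rw [← hT, hTdef, tailSum]
      linarith [hy 0, hy j.succ]
    rw [hyj, hT]
    rcases Nat.eq_zero_or_pos i with rfl | hi0
    · simp [mul_comm, ← hP]
    · simp [hi0.ne']
  · rw [div_pow]
    have h : T ^ α j = T ^ i * T ^ (α j - i) := by
      rw [← pow_add]
      congr 1
      omega
    rw [h]
    field_simp
    rw [mul_comm]

/-- The coordinates `y_m`, with `y₀` eliminated through `∑ y_m = 1`. The order of the variables is
reversed. -/
def affineVars (ℓ : ℕ) : Fin (ℓ + 1) → MvPolynomial (Fin ℓ) ℝ :=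
  Fin.cons (1 - ∑ m, X m) (fun m => X m.rev)

theorem totalDegree_affineVars_le {ℓ : ℕ} (i : Fin (ℓ + 1)) :
    (affineVars ℓ i).totalDegree ≤ 1 := by
  refine Fin.cases ?_ (fun m => ?_) i
  · rw [affineVars, Fin.cons_zero]
    refine (totalDegree_sub _ _).trans (max_le (by simp) ?_)
    exact totalDegree_finsetSum_le fun m _ => (totalDegree_X m).le
  · rw [affineVars, Fin.cons_succ]
    exact (totalDegree_X _).le

theorem eval_aeval_affineVars {ℓ : ℕ} (y : Fin (ℓ + 1) → ℝ) (hy : ∑ i, y i = 1)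
    (p : MvPolynomial (Fin (ℓ + 1)) ℝ) :
    eval (fun m : Fin ℓ => y m.rev.succ) (aeval (affineVars ℓ) p) = eval y p := by
  have h : ((aeval (fun m : Fin ℓ => y m.rev.succ)).comp (aeval (affineVars ℓ)) :
      MvPolynomial (Fin (ℓ + 1)) ℝ →ₐ[ℝ] ℝ) = aeval y := by
    ext i
    refine Fin.cases ?_ (fun m => ?_) i
    · have : ∑ m : Fin ℓ, y m.rev.succ = ∑ m : Fin ℓ, y m.succ :=
        Equiv.sum_comp Fin.revPerm (fun m : Fin ℓ => y m.succ)
      rw [Fin.sum_univ_succ] at hy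
      simp [affineVars, this]
      linarith
    · simp [affineVars]
  have := DFunLike.congr_fun h p
  simpa [aeval_eq_eval] using this

/-- `orthPoly` with `y₀` eliminated. -/
def orthAffine {ℓ : ℕ} (α : Fin ℓ → ℕ) : MvPolynomial (Fin ℓ) ℝ :=
  aeval (affineVars ℓ) (orthPoly α)

theorem totalDegree_orthAffine_le {ℓ : ℕ} (α : Fin ℓ → ℕ) :
    (orthAffine α).totalDegree ≤ ∑ j, α j :=
  (totalDegree_aeval_le_of_le_one _ _ totalDegree_affineVars_le).trans
    (orthPoly_isHomogeneous α).totalDegree_le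

theorem aeval_tailForm {ℓ : ℕ} (j : Fin ℓ) :
    aeval (affineVars ℓ) (tailForm j) = 1 + ∑ m ∈ Finset.Iio j, -X m.rev := by
  have h1 : ∑ m : Fin ℓ, (X m : MvPolynomial (Fin ℓ) ℝ) = ∑ m : Fin ℓ, X m.rev :=
    (Equiv.sum_comp Fin.revPerm (fun m : Fin ℓ => (X m : MvPolynomial (Fin ℓ) ℝ))).symm
  have h2 : ∑ m : Fin ℓ, (X m.rev : MvPolynomial (Fin ℓ) ℝ) =
      ∑ m ∈ Finset.Iio j, X m.rev + ∑ m ∈ Finset.Ici j, X m.rev := by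
    rw [← Finset.sum_union]
    · refine Finset.sum_congr ?_ fun _ _ => rfl
      ext m
      simp [lt_or_ge]
    · refine Finset.disjoint_left.2 fun m hm hm' => ?_
      simp at hm hm'
      exact absurd hm (not_lt.2 hm')
  simp only [tailForm, affineVars, map_add, aeval_X, map_sum, Fin.cons_zero, Fin.cons_succ, h1, h2,
    Finset.sum_neg_distrib]
  ring

/-- This is why the variables are reversed: the tail form becomes `1` minus the coordinates with
index below `j`, and after reversal those variables are lexicographically smaller than `X j.rev`. -/
theorem lex_degree_aeval_tailForm_lt {ℓ : ℕ} (j : Fin ℓ) :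
    MonomialOrder.lex.degree (aeval (affineVars ℓ) (tailForm j)) ≺[MonomialOrder.lex]
      Finsupp.single j.rev 1 := by
  have h0 : (0 : Fin ℓ →₀ ℕ) ≺[MonomialOrder.lex] Finsupp.single j.rev 1 := by
    rw [map_zero, MonomialOrder.toSyn_lt_iff_ne_zero]
    simp
  rw [aeval_tailForm]
  refine lt_of_le_of_lt MonomialOrder.degree_add_le (max_lt ?_ ?_)
  · rw [MonomialOrder.degree_one]
    exact h0
  · refine lt_of_le_of_lt MonomialOrder.degree_sum_le ?_
    rw [Finset.sup_lt_iff (by simpa using h0)]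
    intro m hm
    rw [MonomialOrder.degree_neg]
    refine lt_of_le_of_lt MonomialOrder.degree_X_le_single ?_
    rw [MonomialOrder.lex_lt_iff, Finsupp.Lex.single_lt_iff]
    simpa using hm

/-- Each summand with `i < n` has a power of the tail form in place of a power of the larger
variable `X j.rev`, so the pure power `X j.rev ^ n` leads. -/
theorem lex_degree_aeval_factor {ℓ : ℕ} (j : Fin ℓ) (n : ℕ) (c : ℕ → ℝ) (hc : c n ≠ 0) :
    aeval (affineVars ℓ) (∑ i ∈ Finset.range (n + 1),
      C (c i) * (X j.succ ^ i * tailForm j ^ (n - i))) ≠ 0 ∧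
    MonomialOrder.lex.degree (aeval (affineVars ℓ) (∑ i ∈ Finset.range (n + 1),
      C (c i) * (X j.succ ^ i * tailForm j ^ (n - i)))) = Finsupp.single j.rev n := by
  classical
  have hlead : ∀ r : ℝ, r ≠ 0 → MonomialOrder.lex.degree
      (C r * X j.rev ^ n : MvPolynomial (Fin ℓ) ℝ) = Finsupp.single j.rev n := by
    intro r hr
    rw [C_mul_X_pow_eq_monomial, MonomialOrder.degree_monomial, if_neg hr]
  simp only [Finset.sum_range_succ, map_add, map_sum, map_mul, map_pow, aeval_X, Nat.sub_self,
    pow_zero, mul_one, algHom_C, algebraMap_eq]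
  have hX : affineVars ℓ j.succ = X j.rev := by simp [affineVars]
  rw [hX]
  rcases Nat.eq_zero_or_pos n with rfl | hn
  · simp only [Finset.range_zero, Finset.sum_empty, zero_add, pow_zero, mul_one]
    refine ⟨by simpa using hc, ?_⟩
    simp [MonomialOrder.degree_C]
  have hlt : MonomialOrder.lex.degree (∑ i ∈ Finset.range n, C (c i) * (X j.rev ^ i *
      aeval (affineVars ℓ) (tailForm j) ^ (n - i))) ≺[MonomialOrder.lex]
      MonomialOrder.lex.degree (C (c n) * X j.rev ^ n : MvPolynomial (Fin ℓ) ℝ) := by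
    rw [hlead _ hc]
    refine lt_of_le_of_lt MonomialOrder.degree_sum_le ?_
    rw [Finset.sup_lt_iff]
    · intro i hi
      have hi := Finset.mem_range.1 hi
      refine lt_of_le_of_lt (MonomialOrder.degree_mul_le) ?_
      rw [MonomialOrder.degree_C, zero_add]
      refine lt_of_le_of_lt (MonomialOrder.degree_mul_le) ?_
      have hT := lex_degree_aeval_tailForm_lt j
      rw [map_add, MonomialOrder.degree_pow, MonomialOrder.degree_pow, MonomialOrder.degree_X]
      have hs : Finsupp.single j.rev n = i • Finsupp.single j.rev 1 +
          (n - i) • Finsupp.single j.rev 1 := by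
        rw [← add_smul, Nat.add_sub_cancel' hi.le]
        simp
      rw [hs, map_add]
      refine add_lt_add_of_le_of_lt le_rfl ?_
      rw [map_nsmul, map_nsmul]
      exact nsmul_lt_nsmul_right (by omega) hT
    · change (0 : MonomialOrder.lex.syn) < _
      rw [MonomialOrder.toSyn_lt_iff_ne_zero]
      simp [hn.ne']
  have hd := MonomialOrder.degree_add_eq_right_of_lt hlt
  rw [hlead _ hc] at hd
  refine ⟨fun h0 => ?_, hd⟩
  rw [h0, MonomialOrder.degree_zero] at hd
  have := DFunLike.congr_fun hd j.rev
  simp at this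
  omega

/-- Leading exponents add under products, so the leading exponent of `orthAffine α` is `α` in
reversed order, and distinct `α` have distinct leading exponents. -/
theorem linearIndependent_orthAffine (ℓ : ℕ) :
    LinearIndependent ℝ (orthAffine : (Fin ℓ → ℕ) → MvPolynomial (Fin ℓ) ℝ) := by
  have key : ∀ α : Fin ℓ → ℕ, orthAffine α ≠ 0 ∧ MonomialOrder.lex.degree (orthAffine α) =
      ∑ j : Fin ℓ, Finsupp.single j.rev (α j) := by
    intro α
    have h := fun j => lex_degree_aeval_factor j (α j)
      (fun i => (shiftedJacobi (α j) (orthParam α j) 1).coeff i) (coeff_shiftedJacobi_ne_zero _ _ _)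
    rw [orthAffine, orthPoly, map_prod]
    refine ⟨Finset.prod_ne_zero_iff.2 fun j _ => (h j).1, ?_⟩
    rw [MonomialOrder.degree_prod fun j _ => (h j).1]
    exact Finset.sum_congr rfl fun j _ => (h j).2
  refine linearIndependent_of_monomialOrder_degree_injective MonomialOrder.lex _
    (fun α => (key α).1) fun α β h => ?_
  simp only [(key _).2] at h
  funext j
  have := DFunLike.congr_fun h j.rev
  simpa [Finsupp.finsetSum_apply, Finsupp.single_apply, Fin.rev_inj] using this

/-- The multi-indices with `|α| ≤ n` also number the monomials of degree at most `n`, so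
independence and the degree bound give equality by dimension. -/
theorem span_orthAffine (ℓ n : ℕ) :
    Submodule.span ℝ (orthAffine '' {α : Fin ℓ → ℕ | ∑ j, α j ≤ n}) =
      restrictTotalDegree (Fin ℓ) ℝ n := by
  have hle : Submodule.span ℝ (orthAffine '' {α : Fin ℓ → ℕ | ∑ j, α j ≤ n}) ≤
      restrictTotalDegree (Fin ℓ) ℝ n := by
    rw [Submodule.span_le]
    rintro _ ⟨α, hα, rfl⟩
    exact (mem_restrictTotalDegree _ _ _).2 ((totalDegree_orthAffine_le α).trans hα)
  refine Submodule.eq_of_le_of_finrank_le hle ?_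
  let e : {α : Fin ℓ → ℕ | ∑ j, α j ≤ n} ≃ {s : Fin ℓ →₀ ℕ | (s.sum fun _ e => e) ≤ n} :=
    (Finsupp.equivFunOnFinite.subtypeEquiv fun s => by
      simp [Finsupp.sum_fintype]).symm
  have h1 : Module.finrank ℝ (restrictTotalDegree (Fin ℓ) ℝ n) =
      Nat.card {s : Fin ℓ →₀ ℕ | (s.sum fun _ e => e) ≤ n} :=
    Module.finrank_eq_nat_card_basis (basisRestrictSupport ℝ _)
  have : Module.Finite ℝ (restrictTotalDegree (Fin ℓ) ℝ n) := by
    infer_instance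
  have hfin : Finite {α : Fin ℓ → ℕ | ∑ j, α j ≤ n} :=
    ((Set.Finite.pi' fun _ => Set.finite_le_nat n).subset fun α hα j =>
      (Finset.single_le_sum (f := α) (fun _ _ => Nat.zero_le _) (Finset.mem_univ j)).trans
        hα).to_subtype
  have := Fintype.ofFinite {α : Fin ℓ → ℕ | ∑ j, α j ≤ n}
  have hLI : LinearIndependent ℝ (fun α : {α : Fin ℓ → ℕ | ∑ j, α j ≤ n} => orthAffine α.1) :=
    (linearIndependent_orthAffine ℓ).comp _ Subtype.val_injective
  have h2 := finrank_span_eq_card hLI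
  rw [h1, Set.image_eq_range, h2, ← Nat.card_eq_fintype_card, Nat.card_congr e]

theorem eq_zero_of_sum_orthBary_eq_zero {ℓ : ℕ} (c : (Fin ℓ → ℕ) →₀ ℝ)
    (h : ∀ y : Fin (ℓ + 1) → ℝ, (∀ i, 0 < y i) → ∑ i, y i = 1 →
      c.sum (fun α r => r * orthBary α y) = 0) : c = 0 := by
  refine linearIndependent_iff.1 (linearIndependent_orthAffine ℓ) c ?_
  -- A polynomial is determined by its values on a product of infinite sets. The cube with side `1 /
  -- (ℓ + 1)` fits into the open simplex, since `ℓ` such coordinates add up to less than `1` and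
  -- leave `y₀ > 0`.
  refine funext_set (fun _ => Set.Ioo (0 : ℝ) (1 / (ℓ + 1)))
    (fun _ => Set.Ioo_infinite (by positivity)) fun x hx => ?_
  set y : Fin (ℓ + 1) → ℝ := Fin.cons (1 - ∑ m, x m) (fun m => x m.rev) with hy
  have hxm : ∀ m, 0 < x m ∧ x m < 1 / (ℓ + 1) := fun m => hx m trivial
  have hrev : ∑ m : Fin ℓ, x m.rev = ∑ m, x m := Equiv.sum_comp Fin.revPerm x
  have hsum : ∑ i, y i = 1 := by
    rw [Fin.sum_univ_succ]
    simp [hy, hrev]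
  have hpos : ∀ i, 0 < y i := by
    intro i
    refine Fin.cases ?_ (fun m => ?_) i
    · have h1 : ∑ m, x m ≤ ∑ _m : Fin ℓ, (1 / (ℓ + 1) : ℝ) :=
        Finset.sum_le_sum fun m _ => (hxm m).2.le
      have h2 : ∑ _m : Fin ℓ, (1 / (ℓ + 1) : ℝ) < 1 := by
        simp only [Finset.sum_const, Finset.card_univ, Fintype.card_fin, nsmul_eq_mul]
        rw [mul_one_div, div_lt_one (by positivity)]
        linarith
      simp only [hy, Fin.cons_zero]
      linarith
    · simpa [hy] using (hxm m.rev).1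
  have hxy : x = fun m : Fin ℓ => y m.rev.succ := by
    funext m
    simp [hy]
  rw [map_zero, ← h y hpos hsum, Finsupp.linearCombination_apply, Finsupp.sum, map_sum]
  refine Finset.sum_congr rfl fun α _ => ?_
  rw [smul_eval, hxy, orthAffine, eval_aeval_affineVars y hsum,
    eval_orthPoly _ _ fun i => (hpos i).le]

theorem exists_eq_sum_orthBary {ℓ : ℕ} (n : ℕ) (R : MvPolynomial (Fin (ℓ + 1)) ℝ)
    (hR : R.totalDegree ≤ n) : ∃ c : (Fin ℓ → ℕ) →₀ ℝ, (∀ α ∈ c.support, ∑ j, α j ≤ n) ∧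
      ∀ y : Fin (ℓ + 1) → ℝ, (∀ i, 0 ≤ y i) → ∑ i, y i = 1 →
        eval y R = c.sum (fun α r => r * orthBary α y) := by
  have hmem : aeval (affineVars ℓ) R ∈
      Submodule.span ℝ (orthAffine '' {α : Fin ℓ → ℕ | ∑ j, α j ≤ n}) := by
    rw [span_orthAffine, mem_restrictTotalDegree]
    exact (totalDegree_aeval_le_of_le_one _ _ totalDegree_affineVars_le).trans hR
  obtain ⟨c, hc, hcR⟩ := (Finsupp.mem_span_image_iff_linearCombination ℝ).1 hmem
  refine ⟨c, fun α hα => hc hα, fun y hy hsum => ?_⟩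
  rw [← eval_aeval_affineVars y hsum, ← hcR, Finsupp.linearCombination_apply, Finsupp.sum,
    map_sum, Finsupp.sum]
  refine Finset.sum_congr rfl fun α _ => ?_
  rw [smul_eval, orthAffine, eval_aeval_affineVars y hsum, eval_orthPoly _ _ hy]

/-! ### Divisibility by the product of the variables -/

/-- The remainder modulo `X j` does not involve `X j`, so its values on the orthant are those of `P`
on the face `y j = 0`; a polynomial vanishing on the orthant is zero. -/
theorem X_dvd_of_eval_eq_zero {σ : Type*} (P : MvPolynomial σ ℝ) (j : σ)
    (h : ∀ y : σ → ℝ, (∀ i, 0 ≤ y i) → y j = 0 → eval y P = 0) : X j ∣ P := by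
  classical
  rw [X_dvd_iff_modMonomial_eq_zero]
  set Q := P.modMonomial (Finsupp.single j 1) with hQ
  have hvars : j ∉ Q.vars := by
    rw [mem_vars_iff_mem_support]
    rintro ⟨s, hs, hj⟩
    rw [mem_support_iff] at hs
    refine hs (coeff_modMonomial_of_le _ ?_)
    rw [Finsupp.single_le_iff]
    exact Nat.one_le_iff_ne_zero.2 (Finsupp.mem_support_iff.1 hj)
  refine funext_set (fun _ => Set.Ici (0 : ℝ)) (fun _ => Set.Ici_infinite 0) fun y hy => ?_
  have hy : ∀ i, 0 ≤ y i := fun i => hy i trivial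
  have h1 : eval y Q = eval (Function.update y j 0) Q := by
    refine eval₂Hom_congr' rfl (fun i hi _ => ?_) rfl
    have hij : i ≠ j := fun h => hvars (h ▸ hi)
    simp [hij]
  have h2 := h (Function.update y j 0) (fun i => by
    by_cases hij : i = j
    · subst hij; simp
    · simpa [hij] using hy i) (by simp)
  rw [← divMonomial_add_modMonomial_single P j] at h2
  simpa [h1] using h2

/-- A monomial divisible by each variable is divisible by their product, and this passes to `P`
coefficientwise. The case `P = 0` is kept apart because the degree identity may fail there. -/
theorem exists_eq_prod_X_mul {σ : Type*} [Fintype σ] {k : ℕ} (P : MvPolynomial σ ℝ)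
    (hP : P.IsHomogeneous k)
    (h : ∀ y : σ → ℝ, (∀ i, 0 ≤ y i) → (∃ j, y j = 0) → eval y P = 0) :
    P = 0 ∨ ∃ R : MvPolynomial σ ℝ, P = (∏ i, X i) * R ∧
      R.totalDegree + Fintype.card σ = k := by
  classical
  by_cases hP0 : P = 0
  · exact Or.inl hP0
  have hdvd : (∏ i, X i : MvPolynomial σ ℝ) ∣ P := by
    have hm : (∏ i, X i : MvPolynomial σ ℝ) =
        monomial (Finsupp.equivFunOnFinite.symm fun _ => 1) 1 := by
      rw [monomial_eq]
      simp [Finsupp.prod_fintype]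
    rw [hm, monomial_one_dvd_iff_modMonomial_eq_zero]
    ext s
    rw [coeff_zero]
    by_cases hs : Finsupp.equivFunOnFinite.symm (fun _ => 1) ≤ s
    · exact coeff_modMonomial_of_le _ hs
    · rw [coeff_modMonomial_of_not_le _ hs]
      obtain ⟨j, hj⟩ : ∃ j, ¬ 1 ≤ s j := by
        by_contra! hcon
        exact hs fun j => by simpa using hcon j
      have hX := X_dvd_of_eval_eq_zero P j fun y hy hyj => h y hy ⟨j, hyj⟩
      rw [X_dvd_iff_modMonomial_eq_zero] at hX
      rw [← coeff_modMonomial_of_not_le P (s := Finsupp.single j 1)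
        (by rwa [Finsupp.single_le_iff]), hX, coeff_zero]
  obtain ⟨R, hR⟩ := hdvd
  refine Or.inr ⟨R, hR, ?_⟩
  have hR0 : R ≠ 0 := by rintro rfl; simp at hR; exact hP0 hR
  have hW0 : (∏ i, X i : MvPolynomial σ ℝ) ≠ 0 := fun h => by simp [h] at hR; exact hP0 hR
  have hWd : (∏ i, X i : MvPolynomial σ ℝ).totalDegree = Fintype.card σ := by
    have : (∏ i, X i : MvPolynomial σ ℝ).IsHomogeneous (∑ _i : σ, 1) :=
      IsHomogeneous.prod _ _ _ fun i _ => isHomogeneous_X ℝ i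
    rw [this.totalDegree hW0]
    simp
  have := totalDegree_mul_of_isDomain hW0 hR0
  rw [← hR, hP.totalDegree hP0, hWd] at this
  omega

end CrouzeixRaviart

end

noncomputable section

namespace CrouzeixRaviart

open MvPolynomial

variable {d : ℕ} {Ω : Set (EuclideanSpace ℝ (Fin d))}

namespace Mesh

/-! ### Elements and barycentric coordinates -/

variable (M : Mesh d Ω)

instance : Finite M.Cell :=
  (M.finite_faces.subset fun (_ : Finset (EuclideanSpace ℝ (Fin d)))
    (h : _ ∈ M.faces ∧ _) => h.1).to_subtype

variable {M}

theorem exists_cell_superset {τ : Finset (EuclideanSpace ℝ (Fin d))} (hτ : τ ∈ M.faces) :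
    ∃ K : M.Cell, τ ⊆ K.1 := by
  obtain ⟨K, hK, hc, h⟩ := M.exists_cell τ hτ
  exact ⟨⟨K, hK, hc⟩, h⟩

theorem exists_mem_carrier {x : EuclideanSpace ℝ (Fin d)} (hx : x ∈ closure Ω) :
    ∃ K : M.Cell, x ∈ K.carrier := by
  rw [← M.space_eq, Geometry.SimplicialComplex.mem_space_iff] at hx
  obtain ⟨τ, hτ, hx⟩ := hx
  obtain ⟨K, hK⟩ := exists_cell_superset hτ
  exact ⟨K, convexHull_mono (Finset.coe_subset.2 hK) hx⟩

theorem mem_faces_of_subset_cell {K : M.Cell} {τ : Finset (EuclideanSpace ℝ (Fin d))}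
    (h : τ ⊆ K.1) (hne : τ.Nonempty) : τ ∈ M.faces :=
  M.down_closed K.2.1 h hne

theorem convexHull_face_subset {τ : Finset (EuclideanSpace ℝ (Fin d))} (hτ : τ ∈ M.faces) :
    convexHull ℝ (τ : Set (EuclideanSpace ℝ (Fin d))) ⊆ closure Ω := by
  rw [← M.space_eq]
  exact M.toSimplicialComplex.convexHull_subset_space hτ

theorem convexHull_subset_carrier {K : M.Cell} {τ : Finset (EuclideanSpace ℝ (Fin d))}
    (h : τ ⊆ K.1) : convexHull ℝ (τ : Set (EuclideanSpace ℝ (Fin d))) ⊆ K.carrier :=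
  convexHull_mono (Finset.coe_subset.2 h)

namespace Cell

theorem isCompact_carrier (K : M.Cell) : IsCompact K.carrier :=
  K.1.finite_toSet.isCompact_convexHull (𝕜 := ℝ)

theorem isClosed_carrier (K : M.Cell) : IsClosed K.carrier :=
  K.isCompact_carrier.isClosed

theorem convex_carrier (K : M.Cell) : Convex ℝ K.carrier :=
  convex_convexHull ℝ _

theorem bary_of_mem (K : M.Cell) {z : EuclideanSpace ℝ (Fin d)} (h : z ∈ K.1)
    (x : EuclideanSpace ℝ (Fin d)) : K.bary z x = K.basis.coord ⟨z, h⟩ x := by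
  rw [bary, dif_pos h]

theorem bary_of_notMem (K : M.Cell) {z : EuclideanSpace ℝ (Fin d)} (h : z ∉ K.1)
    (x : EuclideanSpace ℝ (Fin d)) : K.bary z x = 0 := by
  rw [bary, dif_neg h]

theorem continuous_bary (K : M.Cell) (z : EuclideanSpace ℝ (Fin d)) : Continuous (K.bary z) := by
  by_cases h : z ∈ K.1
  · have : K.bary z = K.basis.coord ⟨z, h⟩ := funext fun x => K.bary_of_mem h x
    rw [this]
    exact continuous_barycentric_coord _ _
  · have : K.bary z = fun _ => 0 := funext fun x => K.bary_of_notMem h x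
    rw [this]
    exact continuous_const

theorem sum_bary (K : M.Cell) (x : EuclideanSpace ℝ (Fin d)) : ∑ z ∈ K.1, K.bary z x = 1 := by
  rw [← Finset.sum_coe_sort, ← K.basis.sum_coord_apply_eq_one x]
  exact Finset.sum_congr rfl fun z _ => K.bary_of_mem z.2 x

theorem sum_bary_smul (K : M.Cell) (x : EuclideanSpace ℝ (Fin d)) :
    ∑ z ∈ K.1, K.bary z x • z = x := by
  rw [← Finset.sum_coe_sort]
  conv_rhs => rw [← K.basis.linear_combination_coord_eq_self x]
  exact Finset.sum_congr rfl fun z _ => by rw [K.bary_of_mem z.2 x]; rfl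

theorem bary_sum_smul (K : M.Cell) (w : EuclideanSpace ℝ (Fin d) → ℝ) (hw : ∑ z ∈ K.1, w z = 1)
    {z : EuclideanSpace ℝ (Fin d)} (hz : z ∈ K.1) : K.bary z (∑ y ∈ K.1, w y • y) = w z := by
  have hw' : ∑ y : K.1, w y = 1 := by rwa [Finset.sum_coe_sort]
  rw [K.bary_of_mem hz]
  have h := K.basis.coord_apply_combination_of_mem (s := Finset.univ)
    (w := fun y : K.1 => w y) (Finset.mem_univ ⟨z, hz⟩) hw'
  rw [Finset.univ.affineCombination_eq_linear_combination _ _ hw'] at h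
  rw [← Finset.sum_coe_sort]
  exact h

theorem bary_sum_smul_of_subset (K : M.Cell) {τ : Finset (EuclideanSpace ℝ (Fin d))}
    (hτ : τ ⊆ K.1) (w : EuclideanSpace ℝ (Fin d) → ℝ) (hw : ∑ z ∈ τ, w z = 1)
    (z : EuclideanSpace ℝ (Fin d)) [Decidable (z ∈ τ)] :
    K.bary z (∑ y ∈ τ, w y • y) = if z ∈ τ then w z else 0 := by
  classical
  by_cases hz : z ∈ K.1
  · have h1 : ∑ y ∈ K.1, (if y ∈ τ then w y else 0) = 1 := by
      rw [← Finset.sum_filter, Finset.filter_mem_eq_inter, Finset.inter_eq_right.2 hτ, hw]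
    have h2 : ∑ y ∈ K.1, (if y ∈ τ then w y else 0) • y = ∑ y ∈ τ, w y • y := by
      simp only [ite_smul, zero_smul]
      rw [← Finset.sum_filter, Finset.filter_mem_eq_inter, Finset.inter_eq_right.2 hτ]
    rw [← h2, K.bary_sum_smul _ h1 hz]
    congr
  · rw [K.bary_of_notMem hz, if_neg fun h => hz (hτ h)]

theorem mem_carrier_iff (K : M.Cell) (x : EuclideanSpace ℝ (Fin d)) :
    x ∈ K.carrier ↔ ∀ z ∈ K.1, 0 ≤ K.bary z x := by
  constructor
  · intro hx z hz
    obtain ⟨w, hw0, hw1, rfl⟩ := Finset.mem_convexHull'.1 hx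
    rw [K.bary_sum_smul w hw1 hz]
    exact hw0 z hz
  · intro h
    exact Finset.mem_convexHull'.2 ⟨fun z => K.bary z x, h, K.sum_bary x, K.sum_bary_smul x⟩

theorem bary_nonneg (K : M.Cell) {x : EuclideanSpace ℝ (Fin d)} (hx : x ∈ K.carrier)
    (z : EuclideanSpace ℝ (Fin d)) : 0 ≤ K.bary z x := by
  by_cases hz : z ∈ K.1
  · exact (K.mem_carrier_iff x).1 hx z hz
  · rw [K.bary_of_notMem hz]

theorem mem_convexHull_iff (K : M.Cell) {τ : Finset (EuclideanSpace ℝ (Fin d))} (hτ : τ ⊆ K.1)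
    (x : EuclideanSpace ℝ (Fin d)) :
    x ∈ convexHull ℝ (τ : Set (EuclideanSpace ℝ (Fin d))) ↔
      x ∈ K.carrier ∧ ∀ z, z ∉ τ → K.bary z x = 0 := by
  classical
  constructor
  · intro hx
    refine ⟨convexHull_subset_carrier hτ hx, fun z hz => ?_⟩
    obtain ⟨w, hw0, hw1, rfl⟩ := Finset.mem_convexHull'.1 hx
    rw [K.bary_sum_smul_of_subset hτ w hw1, if_neg hz]
  · rintro ⟨hx, h⟩
    refine Finset.mem_convexHull'.2 ⟨fun z => K.bary z x, fun z _ => K.bary_nonneg hx z, ?_, ?_⟩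
    · rw [← K.sum_bary x]
      exact Finset.sum_subset hτ fun z _ hz => h z hz
    · conv_rhs => rw [← K.sum_bary_smul x]
      exact Finset.sum_subset hτ fun z _ hz => by simp only [h z hz, zero_smul]

theorem bary_vertex (K : M.Cell) {y : EuclideanSpace ℝ (Fin d)} (hy : y ∈ K.1)
    (z : EuclideanSpace ℝ (Fin d)) [Decidable (z = y)] : K.bary z y = if z = y then 1 else 0 := by
  classical
  have h := K.bary_sum_smul_of_subset (Finset.singleton_subset_iff.2 hy) (fun _ => 1) (by simp) z
  simp only [Finset.sum_singleton, one_smul, Finset.mem_singleton] at h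
  rw [h]

/-- Conformity of the mesh enters here: a common point is a convex combination of common vertices,
and both elements read off its weights. This makes the hat functions well defined. -/
theorem bary_eq_of_mem {K L : M.Cell} {x : EuclideanSpace ℝ (Fin d)} (hK : x ∈ K.carrier)
    (hL : x ∈ L.carrier) (z : EuclideanSpace ℝ (Fin d)) : K.bary z x = L.bary z x := by
  classical
  have hx := M.inter_subset_convexHull K.2.1 L.2.1 ⟨hK, hL⟩
  rw [← Finset.coe_inter] at hx
  obtain ⟨w, hw0, hw1, rfl⟩ := Finset.mem_convexHull'.1 hx
  rw [K.bary_sum_smul_of_subset Finset.inter_subset_left w hw1,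
    L.bary_sum_smul_of_subset Finset.inter_subset_right w hw1]

theorem exists_vertex_mem_of_mem {K L : M.Cell} {x : EuclideanSpace ℝ (Fin d)}
    (hK : x ∈ K.carrier) (hL : x ∈ L.carrier) : ∃ z, z ∈ K.1 ∧ z ∈ L.1 := by
  have hx := M.inter_subset_convexHull K.2.1 L.2.1 ⟨hK, hL⟩
  obtain ⟨z, hz⟩ := convexHull_nonempty_iff.1 ⟨x, hx⟩
  exact ⟨z, hz.1, hz.2⟩

theorem exists_bary_eq_eval (K : M.Cell) (z : EuclideanSpace ℝ (Fin d)) :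
    ∃ p : MvPolynomial (Fin d) ℝ, p.totalDegree ≤ 1 ∧
      ∀ x, K.bary z x = eval (fun i => x i) p := by
  by_cases hz : z ∈ K.1
  · set φ := K.basis.coord ⟨z, hz⟩
    refine ⟨C (φ 0) + ∑ i, C (φ.linear (EuclideanSpace.single i 1)) * X i, ?_, fun x => ?_⟩
    · refine (totalDegree_add _ _).trans (max_le (by simp) ?_)
      refine totalDegree_finsetSum_le fun i _ => (totalDegree_mul _ _).trans ?_
      simp
    · rw [K.bary_of_mem hz]
      have h1 : φ x = φ.linear x + φ 0 := by
        simpa using φ.map_vadd 0 x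
      have h2 : x = ∑ i, x i • (EuclideanSpace.single i (1 : ℝ) : EuclideanSpace ℝ (Fin d)) := by
        have := (EuclideanSpace.basisFun (Fin d) ℝ).sum_repr x
        simpa using this.symm
      change φ x = _
      rw [h1]
      conv_lhs => rw [h2, map_sum]
      simp [mul_comm, add_comm]
  · exact ⟨0, by simp, fun x => by simp [K.bary_of_notMem hz]⟩

end Cell

/-- Boundedness of `Ω` need not be assumed separately: the closure is a finite union of compact
simplices. -/
theorem isCompact_closure (M : Mesh d Ω) : IsCompact (closure Ω) := by
  have : closure Ω = ⋃ K : M.Cell, K.carrier := by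
    ext x
    rw [Set.mem_iUnion]
    exact ⟨exists_mem_carrier, fun ⟨K, hK⟩ => K.carrier_subset hK⟩
  rw [this]
  exact isCompact_iUnion fun K => K.isCompact_carrier

/-! ### Hat functions -/

/-- The value of the hat function of the vertex `z` at `x`. -/
def hatValue (M : Mesh d Ω) (z : EuclideanSpace ℝ (Fin d)) (x : closure Ω) : ℝ :=
  (exists_mem_carrier (M := M) x.2).choose.bary z x

theorem hatValue_eq (z : EuclideanSpace ℝ (Fin d)) (x : closure Ω) {K : M.Cell}
    (hx : x.1 ∈ K.carrier) : M.hatValue z x = K.bary z x :=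
  Cell.bary_eq_of_mem (exists_mem_carrier (M := M) x.2).choose_spec hx z

theorem continuous_hatValue (z : EuclideanSpace ℝ (Fin d)) : Continuous (M.hatValue z) := by
  refine (locallyFinite_of_finite fun K : M.Cell =>
    (Subtype.val ⁻¹' K.carrier : Set (closure Ω))).continuous ?_ (fun K =>
      K.isClosed_carrier.preimage continuous_subtype_val) fun K => ?_
  · rw [Set.eq_univ_iff_forall]
    intro x
    exact Set.mem_iUnion.2 (exists_mem_carrier x.2)
  · exact ((K.continuous_bary z).comp continuous_subtype_val).continuousOn.congr
      fun x hx => hatValue_eq z x hx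

/-- The hat function of the vertex `z`. -/
def hat (M : Mesh d Ω) (z : EuclideanSpace ℝ (Fin d)) : C(closure Ω, ℝ) :=
  ⟨M.hatValue z, continuous_hatValue z⟩

theorem hat_apply (z : EuclideanSpace ℝ (Fin d)) (x : closure Ω) {K : M.Cell}
    (hx : x.1 ∈ K.carrier) : M.hat z x = K.bary z x :=
  hatValue_eq z x hx

theorem aeval_hat_apply (P : MvPolynomial (EuclideanSpace ℝ (Fin d)) ℝ) (x : closure Ω)
    {K : M.Cell} (hx : x.1 ∈ K.carrier) :
    aeval M.hat P x = eval (fun z => K.bary z x) P := by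
  have h : ((ContinuousMap.evalAlgHom ℝ ℝ x).comp (aeval M.hat) :
      MvPolynomial (EuclideanSpace ℝ (Fin d)) ℝ →ₐ[ℝ] ℝ) = aeval (fun z => K.bary z x) := by
    ext z
    simp [hat_apply z x hx]
  have := DFunLike.congr_fun h P
  simpa [aeval_eq_eval] using this

theorem aeval_hat_mem_S (P : MvPolynomial (EuclideanSpace ℝ (Fin d)) ℝ) {k : ℕ}
    (hP : P.totalDegree ≤ k) : aeval M.hat P ∈ M.S k := by
  intro K
  choose p hp1 hp using K.exists_bary_eq_eval
  refine ⟨aeval p P, (totalDegree_aeval_le_of_le_one P p hp1).trans hP, fun x => ?_⟩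
  rw [aeval_hat_apply P _ x.2]
  have h : ((aeval (fun i => x.1 i)).comp (aeval p) :
      MvPolynomial (EuclideanSpace ℝ (Fin d)) ℝ →ₐ[ℝ] ℝ) = aeval (fun z => K.bary z x) := by
    ext z
    simp [hp, aeval_eq_eval]
  have := DFunLike.congr_fun h P
  simpa [aeval_eq_eval] using this.symm

theorem restrict_injective : Function.Injective M.restrict := by
  intro f g h
  ext x
  obtain ⟨K, hK⟩ := exists_mem_carrier (M := M) x.2
  exact congrFun (congrFun h K) ⟨x.1, hK⟩

/-! ### Conforming basis functions as continuous functions -/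

theorem Numbering.image_vertex (A : M.Numbering) {τ : Finset (EuclideanSpace ℝ (Fin d))}
    (hτ : τ ∈ M.faces) [DecidableEq (EuclideanSpace ℝ (Fin d))] :
    Finset.univ.image (A.vertex τ) = τ := by
  rw [← Finset.coe_inj]
  simpa using A.range_eq τ hτ

theorem Numbering.vertex_mem (A : M.Numbering) {τ : Finset (EuclideanSpace ℝ (Fin d))}
    (hτ : τ ∈ M.faces) (j : Fin (dim τ + 1)) : A.vertex τ j ∈ τ := by
  have : A.vertex τ j ∈ Set.range (A.vertex τ) := ⟨j, rfl⟩
  rw [A.range_eq τ hτ] at this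
  exact this

theorem Numbering.prod_vertex (A : M.Numbering) {τ : Finset (EuclideanSpace ℝ (Fin d))}
    (hτ : τ ∈ M.faces) {R : Type*} [CommMonoid R] (g : EuclideanSpace ℝ (Fin d) → R) :
    ∏ j, g (A.vertex τ j) = ∏ z ∈ τ, g z := by
  classical
  conv_rhs => rw [← A.image_vertex hτ]
  rw [Finset.prod_image fun i _ j _ h => A.injective τ hτ h]

theorem Numbering.sum_vertex (A : M.Numbering) {τ : Finset (EuclideanSpace ℝ (Fin d))}
    (hτ : τ ∈ M.faces) {R : Type*} [AddCommMonoid R] (g : EuclideanSpace ℝ (Fin d) → R) :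
    ∑ j, g (A.vertex τ j) = ∑ z ∈ τ, g z := by
  classical
  conv_rhs => rw [← A.image_vertex hτ]
  rw [Finset.sum_image fun i _ j _ h => A.injective τ hτ h]

theorem dim_add_one {τ : Finset (EuclideanSpace ℝ (Fin d))} (hτ : τ ∈ M.faces) :
    dim τ + 1 = τ.card := by
  have := Finset.card_pos.2 (M.nonempty_of_mem_faces hτ)
  rw [dim]
  omega

/-- The polynomial in the hat functions which defines `confBasis`. -/
def confPoly (A : M.Numbering)
    (i : (τ : Finset (EuclideanSpace ℝ (Fin d))) × (Fin (dim τ) → ℕ)) :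
    MvPolynomial (EuclideanSpace ℝ (Fin d)) ℝ :=
  (∏ z ∈ i.1, X z) * rename (A.vertex i.1) (orthPoly i.2)

/-- The continuous function on `closure Ω` which underlies `confBasis`. -/
def confFun (A : M.Numbering)
    (i : (τ : Finset (EuclideanSpace ℝ (Fin d))) × (Fin (dim τ) → ℕ)) : C(closure Ω, ℝ) :=
  aeval M.hat (confPoly A i)

theorem confFun_apply (A : M.Numbering)
    (i : (τ : Finset (EuclideanSpace ℝ (Fin d))) × (Fin (dim τ) → ℕ)) (x : closure Ω)
    {K : M.Cell} (hx : x.1 ∈ K.carrier) :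
    confFun A i x = (∏ z ∈ i.1, K.bary z x) *
      orthBary i.2 (fun j => K.bary (A.vertex i.1 j) x) := by
  rw [confFun, aeval_hat_apply _ x hx, confPoly, map_mul, map_prod, eval_rename,
    ← eval_orthPoly _ _ fun j => K.bary_nonneg hx _]
  simp [Function.comp_def]

/-- The zero branch of `confBasis` is automatic: on an element that misses a vertex of `τ`, the
corresponding factor of the bubble is zero. -/
theorem restrict_confFun (A : M.Numbering)
    (i : (τ : Finset (EuclideanSpace ℝ (Fin d))) × (Fin (dim τ) → ℕ)) :
    M.restrict (confFun A i) = M.confBasis A i := by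
  funext K x
  change confFun A i ⟨x.1, _⟩ = _
  rw [confFun_apply A i _ x.2, confBasis, bubble]
  split_ifs with h
  · rfl
  · obtain ⟨z, hz, hzK⟩ := Finset.not_subset.1 h
    have h0 : ∏ z ∈ i.1, K.bary z x.1 = 0 := Finset.prod_eq_zero hz (K.bary_of_notMem hzK _)
    exact mul_eq_zero_of_left h0 _

theorem confFun_mem_S (A : M.Numbering)
    (i : (τ : Finset (EuclideanSpace ℝ (Fin d))) × (Fin (dim τ) → ℕ)) {k : ℕ}
    (hi : i.1.card + ∑ j, i.2 j ≤ k) : confFun A i ∈ M.S k := by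
  refine aeval_hat_mem_S _ (le_trans ((totalDegree_mul _ _).trans (add_le_add ?_ ?_)) hi)
  · refine (totalDegree_finsetProd _ _).trans ?_
    simp
  · exact (totalDegree_rename_le _ _).trans (orthPoly_isHomogeneous i.2).totalDegree_le

/-- Some vertex of the bubble is missing from `σ`, and its coordinate vanishes on `σ`. This
triangularity drives both independence and spanning. -/
theorem confFun_eq_zero (A : M.Numbering)
    (i : (τ : Finset (EuclideanSpace ℝ (Fin d))) × (Fin (dim τ) → ℕ))
    {σ : Finset (EuclideanSpace ℝ (Fin d))} (hσ : σ ∈ M.faces) (h : ¬ i.1 ⊆ σ) (x : closure Ω)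
    (hx : x.1 ∈ convexHull ℝ (σ : Set (EuclideanSpace ℝ (Fin d)))) : confFun A i x = 0 := by
  obtain ⟨K, hK⟩ := exists_cell_superset hσ
  obtain ⟨hxK, hx0⟩ := (K.mem_convexHull_iff hK x.1).1 hx
  obtain ⟨z, hz, hzσ⟩ := Finset.not_subset.1 h
  rw [confFun_apply A i x hxK, Finset.prod_eq_zero hz (hx0 z hzσ), zero_mul]

/-- The point `∑ y_i A_i` of the affine hull of `τ` has the barycentric coordinates `y`. -/
theorem bary_sum_smul_vertex (A : M.Numbering) {τ : Finset (EuclideanSpace ℝ (Fin d))}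
    (hτ : τ ∈ M.faces) {K : M.Cell} (hK : τ ⊆ K.1) (y : Fin (dim τ + 1) → ℝ)
    (hy : ∑ j, y j = 1) (j : Fin (dim τ + 1)) :
    K.bary (A.vertex τ j) (∑ i, y i • A.vertex τ i) = y j := by
  classical
  set w : EuclideanSpace ℝ (Fin d) → ℝ := Function.extend (A.vertex τ) y 0
  have hw : ∀ i, w (A.vertex τ i) = y i := fun i => (A.injective τ hτ).extend_apply _ _ _
  have h1 : ∑ z ∈ τ, w z = 1 := by rw [← A.sum_vertex hτ, ← hy]; simp [hw]
  have h2 : ∑ z ∈ τ, w z • z = ∑ i, y i • A.vertex τ i := by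
    rw [← A.sum_vertex hτ]; simp [hw]
  rw [← h2, K.bary_sum_smul_of_subset hK w h1, if_pos (A.vertex_mem hτ j), hw]

theorem sum_smul_vertex_mem (A : M.Numbering) {τ : Finset (EuclideanSpace ℝ (Fin d))}
    (hτ : τ ∈ M.faces) (y : Fin (dim τ + 1) → ℝ) (hy0 : ∀ j, 0 ≤ y j) (hy : ∑ j, y j = 1) :
    ∑ i, y i • A.vertex τ i ∈ convexHull ℝ (τ : Set (EuclideanSpace ℝ (Fin d))) :=
  (convex_convexHull ℝ _).sum_mem (fun j _ => hy0 j) hy fun j _ =>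
    subset_convexHull ℝ _ (A.vertex_mem hτ j)

theorem exists_eq_sum_smul_vertex (A : M.Numbering) {τ : Finset (EuclideanSpace ℝ (Fin d))}
    (hτ : τ ∈ M.faces) {x : EuclideanSpace ℝ (Fin d)}
    (hx : x ∈ convexHull ℝ (τ : Set (EuclideanSpace ℝ (Fin d)))) :
    ∃ y : Fin (dim τ + 1) → ℝ, (∀ j, 0 ≤ y j) ∧ ∑ j, y j = 1 ∧
      x = ∑ i, y i • A.vertex τ i := by
  obtain ⟨w, hw0, hw1, rfl⟩ := Finset.mem_convexHull'.1 hx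
  exact ⟨fun j => w (A.vertex τ j), fun j => hw0 _ (A.vertex_mem hτ j),
    by rw [A.sum_vertex hτ w, hw1], (A.sum_vertex hτ fun z => w z • z).symm⟩

theorem confFun_apply_sum_smul (A : M.Numbering) {τ : Finset (EuclideanSpace ℝ (Fin d))}
    (hτ : τ ∈ M.faces) (α : Fin (dim τ) → ℕ) (y : Fin (dim τ + 1) → ℝ) (hy0 : ∀ j, 0 ≤ y j)
    (hy : ∑ j, y j = 1) (x : closure Ω) (hx : x.1 = ∑ i, y i • A.vertex τ i) :
    confFun A ⟨τ, α⟩ x = (∏ j, y j) * orthBary α y := by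
  obtain ⟨K, hK⟩ := exists_cell_superset hτ
  have hxK : x.1 ∈ K.carrier :=
    hx ▸ convexHull_subset_carrier hK (sum_smul_vertex_mem A hτ y hy0 hy)
  rw [confFun_apply A _ x hxK, ← A.prod_vertex hτ fun z => K.bary z x.1]
  simp only [hx, bary_sum_smul_vertex A hτ hK y hy]

/-! ### Linear independence of the conforming basis functions -/

theorem linearIndepOn_confFun (A : M.Numbering) :
    LinearIndepOn ℝ (confFun A) {i | i.1 ∈ M.faces} := by
  classical
  rw [linearIndepOn_iff]
  intro c hc h0
  have hzero : ∀ x : closure Ω, c.sum (fun i r => r * confFun A i x) = 0 := by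
    intro x
    have := DFunLike.congr_fun h0 x
    rw [Finsupp.linearCombination_apply, Finsupp.sum] at this
    simpa [Finsupp.sum] using this
  -- The coefficients are grouped by face. At a relative interior point of `τ`, proper subfaces
  -- contribute nothing by induction and faces not contained in `τ` contribute nothing because their
  -- bubbles vanish there.
  suffices h : ∀ n, ∀ τ ∈ M.faces, τ.card = n → c.split τ = 0 by
    ext ⟨τ, α⟩
    by_cases hτ : τ ∈ M.faces
    · exact DFunLike.congr_fun (h _ τ hτ rfl) α
    · by_contra hne
      exact hτ (hc (Finsupp.mem_support_iff.2 hne))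
  intro n
  induction n using Nat.strong_induction_on with
  | _ n ih =>
    intro τ hτ hn
    refine eq_zero_of_sum_orthBary_eq_zero _ fun y hy0 hy => ?_
    have hmem := sum_smul_vertex_mem A hτ y (fun j => (hy0 j).le) hy
    set x : closure Ω := ⟨_, convexHull_face_subset hτ hmem⟩ with hx
    have h1 := hzero x
    rw [Finsupp.sigma_sum, Finset.sum_eq_single τ] at h1
    · have h2 : ∀ α, confFun A ⟨τ, α⟩ x = (∏ j, y j) * orthBary α y := fun α =>
        confFun_apply_sum_smul A hτ α y (fun j => (hy0 j).le) hy x rfl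
      simp only [h2, mul_left_comm _ (∏ j, y j), Finsupp.sum, ← Finset.mul_sum] at h1
      exact (mul_eq_zero.1 h1).resolve_left (Finset.prod_pos fun j _ => hy0 j).ne'
    · intro σ _ hστ
      refine Finset.sum_eq_zero fun α hα => ?_
      have hσ : σ ∈ M.faces := by
        have h3 := Finsupp.mem_support_iff.1 hα
        rw [Finsupp.split_apply] at h3
        exact hc (Finsupp.mem_support_iff.2 h3)
      by_cases hsub : σ ⊆ τ
      · have hlt : σ.card < n := hn ▸ Finset.card_lt_card (lt_of_le_of_ne hsub hστ)
        rw [ih _ hlt σ hσ rfl] at hα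
        simp at hα
      · exact mul_eq_zero_of_right _ (confFun_eq_zero A ⟨σ, α⟩ hτ hsub x hmem)
    · intro hns
      have : c.split τ = 0 := by
        by_contra hne
        exact hns ((Finsupp.mem_splitSupport_iff_nonzero _ _).2 hne)
      rw [this, Finsupp.sum_zero_index]

end Mesh

end CrouzeixRaviart

end

/-! ### Spanning by the conforming basis functions -/

noncomputable section

namespace CrouzeixRaviart

open MvPolynomial

variable {d : ℕ} {Ω : Set (EuclideanSpace ℝ (Fin d))}

/-- A polynomial of degree at most `k` is a homogeneous polynomial of degree `k` in the barycentric
coordinates. -/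
theorem exists_homogeneous_eq_eval {σ : Type*} [Fintype σ] {k : ℕ} (p : MvPolynomial (Fin d) ℝ)
    (hp : p.totalDegree ≤ k) (v : σ → EuclideanSpace ℝ (Fin d)) :
    ∃ P : MvPolynomial σ ℝ, P.IsHomogeneous k ∧ ∀ y : σ → ℝ, ∑ j, y j = 1 →
      eval (fun i => (∑ j, y j • v j) i) p = eval y P := by
  set g : Fin d → MvPolynomial σ ℝ := fun i => ∑ j, C (v j i) * X j with hg
  have hgh : ∀ i, (g i).IsHomogeneous 1 := fun i =>
    IsHomogeneous.sum _ _ _ fun j _ => isHomogeneous_C_mul_X _ _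
  have hsh : (∑ j : σ, X j : MvPolynomial σ ℝ).IsHomogeneous 1 :=
    IsHomogeneous.sum _ _ _ fun j _ => isHomogeneous_X ℝ j
  -- Each homogeneous component is raised to degree `k` by a power of `∑ X j`, which equals `1` at
  -- barycentric coordinates.
  refine ⟨∑ m ∈ Finset.range (k + 1), aeval g (homogeneousComponent m p) * (∑ j, X j) ^ (k - m),
    IsHomogeneous.sum _ _ _ fun m hm => ?_, fun y hy => ?_⟩
  · have h := ((homogeneousComponent_isHomogeneous m p).aeval g hgh).mul (hsh.pow (k - m))
    convert h using 1
    have := Finset.mem_range.1 hm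
    omega
  · have hpsum : ∑ m ∈ Finset.range (k + 1), homogeneousComponent m p = p := by
      conv_rhs => rw [← sum_homogeneousComponent p]
      symm
      refine Finset.sum_subset (Finset.range_mono (by omega)) fun m _ hm => ?_
      refine homogeneousComponent_eq_zero _ _ ?_
      simpa using hm
    have h1 : ∀ q : MvPolynomial (Fin d) ℝ,
        eval y (aeval g q) = eval (fun i => (∑ j, y j • v j) i) q := by
      intro q
      have h : ((aeval y).comp (aeval g) : MvPolynomial (Fin d) ℝ →ₐ[ℝ] ℝ) =
          aeval (fun i => (∑ j, y j • v j) i) := by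
        ext i
        simp [hg, mul_comm]
      have := DFunLike.congr_fun h q
      simpa [aeval_eq_eval] using this
    conv_lhs => rw [← hpsum]
    rw [map_sum, map_sum]
    refine Finset.sum_congr rfl fun m _ => ?_
    rw [map_mul, h1, map_pow, map_sum]
    simp only [eval_X, hy, one_pow, mul_one]

namespace Mesh

variable {M : Mesh d Ω}

/-- On `τ` the function is a homogeneous polynomial of degree `k` in the barycentric coordinates.
Vanishing on the proper faces lets the product of the coordinates be split off; the quotient has
degree `k - τ.card` and is expanded in the `P_α^bary`. -/
theorem exists_eqOn_face (A : M.Numbering) {k : ℕ} (hk : 1 ≤ k) {r : C(closure Ω, ℝ)}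
    (hr : r ∈ M.S k) {τ : Finset (EuclideanSpace ℝ (Fin d))} (hτ : τ ∈ M.faces)
    (h0 : ∀ σ ∈ M.faces, σ ⊂ τ → ∀ x : closure Ω,
      x.1 ∈ convexHull ℝ (σ : Set (EuclideanSpace ℝ (Fin d))) → r x = 0) :
    ∃ h ∈ Submodule.span ℝ (confFun A '' {i | i.1 = τ ∧ i.1.card ≤ k ∧
      ∑ j, i.2 j ≤ k - i.1.card}), ∀ x : closure Ω,
        x.1 ∈ convexHull ℝ (τ : Set (EuclideanSpace ℝ (Fin d))) → r x = h x := by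
  classical
  obtain ⟨K, hK⟩ := exists_cell_superset hτ
  obtain ⟨p, hp, hpr⟩ := hr K
  obtain ⟨P, hP, hPy⟩ := exists_homogeneous_eq_eval p hp (A.vertex τ)
  have hrP : ∀ y : Fin (dim τ + 1) → ℝ, (∀ j, 0 ≤ y j) → ∑ j, y j = 1 → ∀ x : closure Ω,
      x.1 = ∑ j, y j • A.vertex τ j → r x = eval y P := by
    intro y hy0 hy x hx
    have hxK : x.1 ∈ K.carrier :=
      hx ▸ convexHull_subset_carrier hK (sum_smul_vertex_mem A hτ y hy0 hy)
    have h1 := hpr ⟨x.1, hxK⟩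
    have h2 := hPy y hy
    simp only [hx] at h1
    rw [← h2, ← h1]
    exact congrArg r (Subtype.ext hx)
  -- Homogeneity carries the vanishing from the simplex to the whole orthant: divide `y` by its
  -- coordinate sum. At the origin `k ≥ 1` is needed.
  have hvan : ∀ y : Fin (dim τ + 1) → ℝ, (∀ i, 0 ≤ y i) → (∃ j, y j = 0) → eval y P = 0 := by
    rintro y hy0 ⟨j, hj⟩
    set s := ∑ i, y i with hs
    have hs0 : 0 ≤ s := Finset.sum_nonneg fun i _ => hy0 i
    have hhom : ∀ (t : ℝ) (u : Fin (dim τ + 1) → ℝ), eval (fun i => t * u i) P =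
        t ^ k * eval u P := by
      intro t u
      rw [eval_eq', eval_eq', Finset.mul_sum]
      refine Finset.sum_congr rfl fun b hb => ?_
      have hdeg : ∑ i, b i = k := by
        have := hP.degree_eq_sum_deg_support hb
        rw [this]
        exact (Finset.sum_subset (Finset.subset_univ _) fun i _ hi => by simpa using hi).symm
      simp only [mul_pow, Finset.prod_mul_distrib, Finset.prod_pow_eq_pow_sum, hdeg]
      ring
    rcases hs0.eq_or_lt with hs0 | hs0
    · have hy : y = fun i => 0 * y i := by
        funext i
        have := (Finset.sum_eq_zero_iff_of_nonneg fun i _ => hy0 i).1 (hs ▸ hs0.symm) i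
          (Finset.mem_univ i)
        simp [this]
      rw [hy, hhom, zero_pow (by omega), zero_mul]
    · set u : Fin (dim τ + 1) → ℝ := fun i => s⁻¹ * y i with hu
      have hu0 : ∀ i, 0 ≤ u i := fun i => mul_nonneg (inv_nonneg.2 hs0.le) (hy0 i)
      have husum : ∑ i, u i = 1 := by
        rw [hu, ← Finset.mul_sum, ← hs, inv_mul_cancel₀ hs0.ne']
      have hyu : y = fun i => s * u i := by
        funext i
        simp only [hu]
        rw [← mul_assoc, mul_inv_cancel₀ hs0.ne', one_mul]
      have hmem := sum_smul_vertex_mem A hτ u hu0 husum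
      have hmem' : ∑ i, u i • A.vertex τ i ∈
          convexHull ℝ ((τ.erase (A.vertex τ j) : Finset _) : Set (EuclideanSpace ℝ (Fin d))) := by
        rw [K.mem_convexHull_iff ((Finset.erase_subset _ _).trans hK)]
        obtain ⟨h1, h2⟩ := (K.mem_convexHull_iff hK _).1 hmem
        refine ⟨h1, fun z hz => ?_⟩
        by_cases hzj : z = A.vertex τ j
        · rw [hzj, bary_sum_smul_vertex A hτ hK u husum]
          simp [hu, hj]
        · exact h2 z fun hzτ => hz (Finset.mem_erase.2 ⟨hzj, hzτ⟩)
      -- This also disposes of the case of a single vertex: the erased set contains a point in its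
      -- hull, so it cannot be empty.
      have hne : (τ.erase (A.vertex τ j)).Nonempty :=
        Finset.coe_nonempty.1 (convexHull_nonempty_iff.1 ⟨_, hmem'⟩)
      have hface : τ.erase (A.vertex τ j) ∈ M.faces :=
        M.down_closed hτ (Finset.erase_subset _ _) hne
      have := h0 _ hface (Finset.erase_ssubset (A.vertex_mem hτ j))
        ⟨_, convexHull_face_subset hτ hmem⟩ hmem'
      rw [hrP u hu0 husum _ rfl] at this
      rw [hyu, hhom, this, mul_zero]
  rcases exists_eq_prod_X_mul P hP hvan with h | ⟨R, hPR, hR⟩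
  · refine ⟨0, zero_mem _, fun x hx => ?_⟩
    obtain ⟨y, hy0, hy, hxy⟩ := exists_eq_sum_smul_vertex A hτ hx
    rw [hrP y hy0 hy x hxy, h, map_zero, ContinuousMap.zero_apply]
  · have hcard := dim_add_one hτ
    rw [Fintype.card_fin] at hR
    obtain ⟨c, hc, hcR⟩ := exists_eq_sum_orthBary (k - τ.card) R (by omega)
    refine ⟨c.sum fun α t => t • confFun A ⟨τ, α⟩, ?_, fun x hx => ?_⟩
    · refine Submodule.sum_mem _ fun α hα => Submodule.smul_mem _ _ (Submodule.subset_span ?_)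
      exact ⟨⟨τ, α⟩, ⟨rfl, by simp only; omega, hc α hα⟩, rfl⟩
    · obtain ⟨y, hy0, hy, hxy⟩ := exists_eq_sum_smul_vertex A hτ hx
      rw [hrP y hy0 hy x hxy, hPR, map_mul, map_prod, hcR y hy0 hy, Finsupp.sum, Finsupp.sum,
        ContinuousMap.sum_apply, Finset.mul_sum]
      refine Finset.sum_congr rfl fun α _ => ?_
      rw [ContinuousMap.smul_apply, confFun_apply_sum_smul A hτ α y hy0 hy x hxy]
      simp
      ring

/-- A continuous piecewise polynomial which vanishes on all faces outside of an up-closed set `𝒰`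
of faces is a linear combination of the conforming basis functions of the faces in `𝒰`. -/
theorem mem_span_confFun (A : M.Numbering) {k : ℕ} (hk : 1 ≤ k)
    {𝒰 : Set (Finset (EuclideanSpace ℝ (Fin d)))}
    (hup : ∀ σ ∈ 𝒰, ∀ τ ∈ M.faces, σ ⊆ τ → τ ∈ 𝒰) {f : C(closure Ω, ℝ)} (hf : f ∈ M.S k)
    (h0 : ∀ τ ∈ M.faces, τ ∉ 𝒰 → ∀ x : closure Ω,
      x.1 ∈ convexHull ℝ (τ : Set (EuclideanSpace ℝ (Fin d))) → f x = 0) :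
    f ∈ Submodule.span ℝ (confFun A '' {i | i.1 ∈ 𝒰 ∧ i.1.card ≤ k ∧
      ∑ j, i.2 j ≤ k - i.1.card}) := by
  classical
  set V := Submodule.span ℝ (confFun A '' {i | i.1 ∈ 𝒰 ∧ i.1.card ≤ k ∧
      ∑ j, i.2 j ≤ k - i.1.card}) with hV
  have hVS : V ≤ M.S k := by
    rw [hV, Submodule.span_le]
    rintro _ ⟨i, ⟨_, hi, hi'⟩, rfl⟩
    exact confFun_mem_S A i (by omega)
  have hV0 : ∀ g ∈ V, ∀ τ ∈ M.faces, τ ∉ 𝒰 → ∀ x : closure Ω,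
      x.1 ∈ convexHull ℝ (τ : Set (EuclideanSpace ℝ (Fin d))) → g x = 0 := by
    intro g hg τ hτ hτU x hx
    induction hg using Submodule.span_induction with
    | mem g hg =>
      obtain ⟨i, hi, rfl⟩ := hg
      exact confFun_eq_zero A i hτ (fun hsub => hτU (hup _ hi.1 τ hτ hsub)) x hx
    | zero => rfl
    | add g h _ _ hg hh => rw [ContinuousMap.add_apply, hg, hh, add_zero]
    | smul c g _ hg => rw [ContinuousMap.smul_apply, hg, smul_zero]
  -- Induction over skeleta: `g` matches `f` on all faces with at most `m` vertices.
  suffices h : ∀ m, ∃ g ∈ V, ∀ τ ∈ M.faces, τ.card ≤ m → ∀ x : closure Ω,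
      x.1 ∈ convexHull ℝ (τ : Set (EuclideanSpace ℝ (Fin d))) → f x = g x by
    obtain ⟨g, hg, hfg⟩ := h (d + 1)
    have : f = g := by
      ext x
      obtain ⟨K, hK⟩ := exists_mem_carrier (M := M) x.2
      exact hfg K.1 K.2.1 K.2.2.le x hK
    rwa [this]
  intro m
  induction m with
  | zero =>
    refine ⟨0, zero_mem _, fun τ hτ hc => ?_⟩
    have := Finset.card_pos.2 (M.nonempty_of_mem_faces hτ)
    omega
  | succ m ih =>
    obtain ⟨g, hg, hfg⟩ := ih
    -- The correction for `τ` vanishes on all faces not containing `τ`. It therefore disturbs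
    -- neither the lower skeleton nor the other faces with `m + 1` vertices, and the corrections can
    -- simply be added.
    have hface : ∀ τ : Finset (EuclideanSpace ℝ (Fin d)), ∃ h ∈ V, τ ∈ M.faces → τ.card = m + 1 →
        (∀ x : closure Ω, x.1 ∈ convexHull ℝ (τ : Set (EuclideanSpace ℝ (Fin d))) →
          f x - g x = h x) ∧
        ∀ σ ∈ M.faces, ¬ τ ⊆ σ → ∀ x : closure Ω,
          x.1 ∈ convexHull ℝ (σ : Set (EuclideanSpace ℝ (Fin d))) → h x = 0 := by
      intro τ
      by_cases hτ : τ ∈ M.faces ∧ τ.card = m + 1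
      swap
      · exact ⟨0, zero_mem _, fun h1 h2 => absurd ⟨h1, h2⟩ hτ⟩
      by_cases hτU : τ ∈ 𝒰
      · obtain ⟨h, hh, hx⟩ := exists_eqOn_face A hk (sub_mem hf (hVS hg)) hτ.1
          fun σ hσ hlt x hx => by
            have := Finset.card_lt_card hlt
            rw [ContinuousMap.sub_apply, hfg σ hσ (by omega) x hx, sub_self]
        refine ⟨h, Submodule.span_mono (Set.image_mono ?_) hh, fun _ _ => ⟨hx, ?_⟩⟩
        · rintro i ⟨h1, h2, h3⟩
          exact ⟨h1 ▸ hτU, h2, h3⟩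
        · intro σ hσ hsub x hxσ
          clear hx
          induction hh using Submodule.span_induction with
          | mem g hg =>
            obtain ⟨i, hi, rfl⟩ := hg
            exact confFun_eq_zero A i hσ (hi.1 ▸ hsub) x hxσ
          | zero => rfl
          | add g h _ _ hg hh => rw [ContinuousMap.add_apply, hg, hh, add_zero]
          | smul c g _ hg => rw [ContinuousMap.smul_apply, hg, smul_zero]
      · refine ⟨0, zero_mem _, fun _ _ => ⟨fun x hx => ?_, fun _ _ _ _ _ => rfl⟩⟩
        rw [h0 τ hτ.1 hτU x hx, hV0 g hg τ hτ.1 hτU x hx]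
        simp
    choose h hhV hh using hface
    set T := M.finite_faces.toFinset.filter fun τ => τ.card = m + 1 with hT
    refine ⟨g + ∑ τ ∈ T, h τ, add_mem hg (sum_mem fun τ _ => hhV τ), fun σ hσ hc x hx => ?_⟩
    rw [ContinuousMap.add_apply, ContinuousMap.sum_apply]
    by_cases hσm : σ.card = m + 1
    · have hσT : σ ∈ T := by simp [hT, hσ, hσm]
      rw [Finset.sum_eq_single σ]
      · rw [← (hh σ hσ hσm).1 x hx]
        ring
      · intro τ hτ hne
        simp only [hT, Finset.mem_filter, Set.Finite.mem_toFinset] at hτ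
        refine (hh τ hτ.1 hτ.2).2 σ hσ (fun hsub => hne ?_) x hx
        exact Finset.eq_of_subset_of_card_le hsub (by omega)
      · exact fun h => absurd hσT h
    · rw [hfg σ hσ (by omega) x hx, Finset.sum_eq_zero, add_zero]
      intro τ hτ
      simp only [hT, Finset.mem_filter, Set.Finite.mem_toFinset] at hτ
      refine (hh τ hτ.1 hτ.2).2 σ hσ (fun hsub => ?_) x hx
      have := Finset.card_le_card hsub
      omega

end Mesh

end CrouzeixRaviart

end

noncomputable section

namespace CrouzeixRaviart

variable {d : ℕ} {Ω : Set (EuclideanSpace ℝ (Fin d))}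

namespace Mesh

variable {M : Mesh d Ω}

/-! ### Inner faces and the boundary -/

theorem Cell.bary_add_sub (K : M.Cell) (v a b c : EuclideanSpace ℝ (Fin d)) :
    K.bary v (a + (b - c)) = K.bary v a + (K.bary v b - K.bary v c) := by
  by_cases hv : v ∈ K.1
  · simp only [K.bary_of_mem hv]
    set φ := K.basis.coord ⟨v, hv⟩
    have h1 : φ (a + (b - c)) = φ.linear (b - c) + φ a := by
      have := φ.map_vadd a (b - c)
      rwa [vadd_eq_add, vadd_eq_add, add_comm] at this
    have h2 : φ.linear (b - c) = φ b - φ c := by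
      have := φ.linearMap_vsub b c
      rwa [vsub_eq_sub, vsub_eq_sub] at this
    rw [h1, h2, add_comm]
  · simp [K.bary_of_notMem hv]

theorem Cell.bary_lineMap (K : M.Cell) (v a b : EuclideanSpace ℝ (Fin d)) (t : ℝ) :
    K.bary v (AffineMap.lineMap a b t) = (1 - t) * K.bary v a + t * K.bary v b := by
  by_cases hv : v ∈ K.1
  · simp only [K.bary_of_mem hv]
    rw [AffineMap.apply_lineMap, AffineMap.lineMap_apply_ring]
  · simp [K.bary_of_notMem hv]

/-- Every point lies in the relative interior of a face. -/
theorem Cell.exists_face_bary_pos (K : M.Cell) {x : EuclideanSpace ℝ (Fin d)}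
    (hx : x ∈ K.carrier) : ∃ σ ∈ M.faces, σ ⊆ K.1 ∧
      x ∈ convexHull ℝ (σ : Set (EuclideanSpace ℝ (Fin d))) ∧ ∀ z, z ∈ σ ↔ 0 < K.bary z x := by
  classical
  set σ := K.1.filter fun z => 0 < K.bary z x with hσ
  have hmem : ∀ z, z ∈ σ ↔ 0 < K.bary z x := by
    intro z
    rw [hσ, Finset.mem_filter, and_iff_right_iff_imp]
    intro h
    by_contra hz
    rw [K.bary_of_notMem hz] at h
    exact lt_irrefl _ h
  have hx' : x ∈ convexHull ℝ (σ : Set (EuclideanSpace ℝ (Fin d))) := by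
    rw [K.mem_convexHull_iff (Finset.filter_subset _ _)]
    refine ⟨hx, fun z hz => ?_⟩
    rw [hmem, not_lt] at hz
    exact le_antisymm hz (K.bary_nonneg hx z)
  refine ⟨σ, mem_faces_of_subset_cell (Finset.filter_subset _ _) ?_, Finset.filter_subset _ _, hx',
    hmem⟩
  exact Finset.coe_nonempty.1 (convexHull_nonempty_iff.1 ⟨x, hx'⟩)

/-- Along a face the mesh looks the same at all relative interior points. For `z` near `x`, the
translate `y + (z - x)` lies in an element `K` containing `y`, hence containing `τ`. At `z` the
coordinates of `K` belonging to `τ` are positive by closeness to `x`; the others agree with those of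
the translate. So a neighbourhood of `x` lies in the closure of `Ω`. -/
theorem mem_of_bary_pos (hreg : interior (closure Ω) = Ω)
    {τ : Finset (EuclideanSpace ℝ (Fin d))} {L : M.Cell} (hL : τ ⊆ L.1)
    {x y : EuclideanSpace ℝ (Fin d)} (hx : x ∈ convexHull ℝ (τ : Set (EuclideanSpace ℝ (Fin d))))
    (hxpos : ∀ z ∈ τ, 0 < L.bary z x)
    (hy : y ∈ convexHull ℝ (τ : Set (EuclideanSpace ℝ (Fin d))))
    (hypos : ∀ z ∈ τ, 0 < L.bary z y) (hyΩ : y ∈ Ω) : x ∈ Ω := by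
  have hopen : IsOpen Ω := hreg ▸ isOpen_interior
  have hyL := convexHull_subset_carrier hL hy
  have h1 : ∀ᶠ z in 𝓝 x, ∀ K : M.Cell, τ ⊆ K.1 → ∀ v ∈ τ, 0 < K.bary v z := by
    rw [Filter.eventually_all]
    intro K
    by_cases hK : τ ⊆ K.1
    · have : ∀ᶠ z in 𝓝 x, ∀ v ∈ τ, 0 < K.bary v z := by
        rw [Filter.eventually_all_finset]
        intro v hv
        refine (K.continuous_bary v).continuousAt.eventually (lt_mem_nhds ?_)
        rw [Cell.bary_eq_of_mem (convexHull_subset_carrier hK hx)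
          (convexHull_subset_carrier hL hx)]
        exact hxpos v hv
      exact this.mono fun z hz _ => hz
    · exact Filter.Eventually.of_forall fun z h => absurd h hK
  have h2 : ∀ᶠ z in 𝓝 y, z ∈ Ω ∧ ∀ K : M.Cell, z ∈ K.carrier → y ∈ K.carrier := by
    refine Filter.Eventually.and (hopen.mem_nhds hyΩ) ?_
    rw [Filter.eventually_all]
    intro K
    by_cases hK : y ∈ K.carrier
    · exact Filter.Eventually.of_forall fun z _ => hK
    · filter_upwards [K.isClosed_carrier.isOpen_compl.mem_nhds hK] with z hz h
      exact absurd h hz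
  have ht : Filter.Tendsto (fun z => y + (z - x)) (𝓝 x) (𝓝 y) := by
    have : Continuous fun z : EuclideanSpace ℝ (Fin d) => y + (z - x) := by fun_prop
    simpa using this.tendsto x
  rw [← hreg, mem_interior_iff_mem_nhds]
  filter_upwards [h1, ht.eventually h2] with z hz1 hz2
  obtain ⟨K, hK⟩ := exists_mem_carrier (M := M) (subset_closure hz2.1)
  have hyK := hz2.2 K hK
  have hτK : τ ⊆ K.1 := by
    intro v hv
    by_contra hvK
    have := hypos v hv
    rw [Cell.bary_eq_of_mem hyL hyK, K.bary_of_notMem hvK] at this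
    exact lt_irrefl _ this
  refine K.carrier_subset ((K.mem_carrier_iff z).2 fun v hv => ?_)
  by_cases hvτ : v ∈ τ
  · exact (hz1 K hτK v hvτ).le
  · have h3 := K.bary_nonneg hK v
    rwa [K.bary_add_sub, ((K.mem_convexHull_iff hτK y).1 hy).2 v hvτ,
      ((K.mem_convexHull_iff hτK x).1 hx).2 v hvτ, zero_add, sub_zero] at h3

/-- If a face meets `Ω`, then its relative interior is contained in `Ω`. -/
theorem mem_of_mem_of_bary_pos (hreg : interior (closure Ω) = Ω)
    {τ : Finset (EuclideanSpace ℝ (Fin d))} {L : M.Cell} (hL : τ ⊆ L.1)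
    {x y : EuclideanSpace ℝ (Fin d)} (hx : x ∈ convexHull ℝ (τ : Set (EuclideanSpace ℝ (Fin d))))
    (hxpos : ∀ z ∈ τ, 0 < L.bary z x)
    (hy : y ∈ convexHull ℝ (τ : Set (EuclideanSpace ℝ (Fin d)))) (hyΩ : y ∈ Ω) : x ∈ Ω := by
  have hopen : IsOpen Ω := hreg ▸ isOpen_interior
  have ht : Filter.Tendsto (fun t : ℝ => AffineMap.lineMap y x t) (𝓝 0) (𝓝 y) := by
    have : Continuous fun t : ℝ => (AffineMap.lineMap y x t : EuclideanSpace ℝ (Fin d)) :=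
      AffineMap.lineMap_continuous
    simpa using this.tendsto 0
  -- The point `y` may lie on the relative boundary of `τ`; a small move towards `x` keeps it in `Ω`
  -- and makes all its coordinates on `τ` positive.
  obtain ⟨t, ht, ht0, ht1⟩ : ∃ t : ℝ, AffineMap.lineMap y x t ∈ Ω ∧ 0 < t ∧ t < 1 := by
    have h1 := (ht.eventually (hopen.mem_nhds hyΩ)).filter_mono (nhdsWithin_le_nhds (s := Set.Ioi 0))
    exact (h1.and (Ioo_mem_nhdsGT one_pos)).exists
  refine mem_of_bary_pos hreg hL hx hxpos
    ((convex_convexHull ℝ _).lineMap_mem hy hx ⟨ht0.le, ht1.le⟩) (fun z hz => ?_) ht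
  rw [L.bary_lineMap]
  have h1 := L.bary_nonneg (convexHull_subset_carrier hL hy) z
  have h2 := hxpos z hz
  have h3 : 0 ≤ 1 - t := by linarith
  positivity

/-- Otherwise the face carrying `x` in its relative interior contains `τ`, hence meets `Ω`, and `x`
would lie in `Ω`. -/
theorem exists_bary_eq_zero_of_mem_frontier (hreg : interior (closure Ω) = Ω)
    {τ : Finset (EuclideanSpace ℝ (Fin d))} (hτ : τ ∈ M.innerFaces) {K : M.Cell}
    {x : EuclideanSpace ℝ (Fin d)} (hxK : x ∈ K.carrier) (hx : x ∈ frontier Ω) :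
    ∃ z ∈ τ, K.bary z x = 0 := by
  by_contra! hne
  obtain ⟨σ, hσ, hσK, hxσ, hpos⟩ := K.exists_face_bary_pos hxK
  have hsub : τ ⊆ σ := fun z hz => (hpos z).2 ((K.bary_nonneg hxK z).lt_of_ne' (hne z hz))
  obtain ⟨y, hy, hyF⟩ := Set.not_subset.1 hτ.2
  have hopen : IsOpen Ω := hreg ▸ isOpen_interior
  rw [hopen.frontier_eq] at hx hyF
  have hyΩ : y ∈ Ω := by
    by_contra h
    exact hyF ⟨convexHull_face_subset hτ.1 hy, h⟩
  exact hx.2 (mem_of_mem_of_bary_pos hreg hσK hxσ (fun z hz => (hpos z).1 hz)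
    (convexHull_mono (Finset.coe_subset.2 hsub) hy) hyΩ)

theorem mem_innerFaces_of_subset {σ τ : Finset (EuclideanSpace ℝ (Fin d))}
    (hσ : σ ∈ M.innerFaces) (hτ : τ ∈ M.faces) (h : σ ⊆ τ) : τ ∈ M.innerFaces :=
  ⟨hτ, fun hsub => hσ.2 ((convexHull_mono (Finset.coe_subset.2 h)).trans hsub)⟩

theorem confFun_eq_zero_of_mem_frontier (hreg : interior (closure Ω) = Ω) (A : M.Numbering)
    (i : (τ : Finset (EuclideanSpace ℝ (Fin d))) × (Fin (dim τ) → ℕ)) (hi : i.1 ∈ M.innerFaces)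
    (x : closure Ω) (hx : x.1 ∈ frontier Ω) : confFun A i x = 0 := by
  obtain ⟨K, hK⟩ := exists_mem_carrier (M := M) x.2
  obtain ⟨z, hz, hz0⟩ := exists_bary_eq_zero_of_mem_frontier hreg hi hK hx
  rw [confFun_apply A i x hK, Finset.prod_eq_zero hz hz0, zero_mul]

end Mesh

end CrouzeixRaviart

end

noncomputable section

namespace CrouzeixRaviart

/-! ### Lipschitz functions in `H¹₀` -/

open MeasureTheory ContinuousLinearMap
open scoped Convolution

theorem tendsto_eLpNorm_of_bounded {X : Type*} [MeasurableSpace X] {μ : Measure X}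
    [IsFiniteMeasure μ] {f : ℕ → X → ℝ} {g : X → ℝ} (C : ℝ)
    (hf : ∀ n, AEStronglyMeasurable (f n) μ) (hg : AEStronglyMeasurable g μ)
    (hb : ∀ n, ∀ᵐ x ∂μ, |f n x - g x| ≤ C)
    (hlim : ∀ᵐ x ∂μ, Filter.Tendsto (fun n => f n x) Filter.atTop (𝓝 (g x))) :
    Filter.Tendsto (fun n => eLpNorm (fun x => f n x - g x) 2 μ) Filter.atTop (𝓝 0) := by
  have h1 : ∀ n, eLpNorm (fun x => f n x - g x) 2 μ =
      (∫⁻ x, ‖f n x - g x‖ₑ ^ (2 : ℝ) ∂μ) ^ (1 / (2 : ℝ)) := by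
    intro n
    rw [eLpNorm_eq_lintegral_rpow_enorm_toReal (by norm_num) (by norm_num)]
    simp
  have h2 : Filter.Tendsto (fun n => ∫⁻ x, ‖f n x - g x‖ₑ ^ (2 : ℝ) ∂μ) Filter.atTop
      (𝓝 (∫⁻ _, 0 ∂μ)) := by
    refine tendsto_lintegral_of_dominated_convergence' (fun _ => ENNReal.ofReal C ^ (2 : ℝ))
      (fun n => ((hf n).sub hg).enorm.pow_const _) (fun n => ?_) ?_ ?_
    · filter_upwards [hb n] with x hx
      refine ENNReal.rpow_le_rpow ?_ (by norm_num)
      rw [← ofReal_norm, Real.norm_eq_abs]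
      exact ENNReal.ofReal_le_ofReal hx
    · rw [lintegral_const]
      exact ENNReal.mul_ne_top (ENNReal.rpow_ne_top_of_nonneg (by norm_num) ENNReal.ofReal_ne_top)
        (measure_ne_top μ _)
    · filter_upwards [hlim] with x hx
      have h3 : Filter.Tendsto (fun n => f n x - g x) Filter.atTop (𝓝 0) := by
        simpa using hx.sub_const (g x)
      have h4 : Filter.Tendsto (fun n => ‖f n x - g x‖ₑ) Filter.atTop (𝓝 0) := by
        simpa using h3.enorm
      have h5 := (ENNReal.continuous_rpow_const (y := (2 : ℝ))).tendsto 0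
      rw [ENNReal.zero_rpow_of_pos (by norm_num)] at h5
      exact h5.comp h4
  rw [lintegral_zero] at h2
  simp only [h1]
  have h5 := (ENNReal.continuous_rpow_const (y := 1 / (2 : ℝ))).tendsto 0
  rw [ENNReal.zero_rpow_of_pos (by norm_num)] at h5
  exact h5.comp h2

/-! ### Mollification and its derivative -/

section Mollify

variable {E : Type*} [NormedAddCommGroup E] [InnerProductSpace ℝ E] [FiniteDimensional ℝ E]
  [MeasurableSpace E] [BorelSpace E]

/-- Mollification by a normalized bump function. -/
def mollify (φ : ContDiffBump (0 : E)) (v : E → ℝ) : E → ℝ :=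
  (φ.normed (volume : Measure E) ⋆[lsmul ℝ ℝ, (volume : Measure E)] v : E → ℝ)

/-- Mollification commutes with translation, so an increment of the mollified function is an average
of increments of `v`. It is used with `c = 0` for Lipschitz bounds and with `c = ℓ (a - x)` for
derivatives. -/
theorem mollify_sub_sub_le (φ : ContDiffBump (0 : E)) {v : E → ℝ} (hv : Continuous v) (a x : E)
    (c ε : ℝ) (hε : 0 ≤ ε)
    (h : ∀ z ∈ Metric.ball x φ.rOut, |v (z + (a - x)) - v z - c| ≤ ε) :
    |mollify φ v a - mollify φ v x - c| ≤ ε := by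
  have hint : ∀ y, Integrable (fun t => φ.normed volume t • v (y - t)) volume := fun y =>
    (φ.continuous_normed.smul (hv.comp (by fun_prop))).integrable_of_hasCompactSupport
      φ.hasCompactSupport_normed.smul_right
  have h1 : mollify φ v a - mollify φ v x =
      (φ.normed (volume : Measure E) ⋆[lsmul ℝ ℝ, (volume : Measure E)]
        (fun z => v (z + (a - x)) - v z) : E → ℝ) x := by
    rw [mollify, convolution_lsmul, convolution_lsmul, convolution_lsmul,
      ← integral_sub (hint a) (hint x)]
    refine integral_congr_ae (Filter.Eventually.of_forall fun t => ?_)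
    simp only [smul_eq_mul]
    rw [show x - t + (a - x) = a - t by abel]
    ring
  have h2 := dist_convolution_le (μ := (volume : Measure E)) (f := φ.normed volume)
    (g := fun z => v (z + (a - x)) - v z) (x₀ := x) (R := φ.rOut) (z₀ := c) hε
    φ.support_normed_eq.subset φ.nonneg_normed φ.integral_normed
    (by fun_prop) (fun z hz => by rw [Real.dist_eq]; exact h z hz)
  rwa [← h1, Real.dist_eq] at h2

theorem abs_mollify_sub_le (φ : ContDiffBump (0 : E)) {v : E → ℝ} (hv : Continuous v) (x : E)
    (ε : ℝ) (h : ∀ z ∈ Metric.ball x φ.rOut, |v z - v x| ≤ ε) :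
    |mollify φ v x - v x| ≤ ε := by
  have := φ.dist_normed_convolution_le (μ := (volume : Measure E)) (g := v) (x₀ := x) (ε := ε)
    hv.aestronglyMeasurable fun z hz => by rw [Real.dist_eq]; exact h z hz
  rwa [Real.dist_eq] at this

theorem contDiff_mollify (φ : ContDiffBump (0 : E)) {v : E → ℝ} (hv : Continuous v) :
    ContDiff ℝ ∞ (mollify φ v) :=
  φ.hasCompactSupport_normed.contDiff_convolution_left _ φ.contDiff_normed
    hv.locallyIntegrable

/-- Averaging preserves an approximation of increments by `ℓ`, and the derivative inherits the
bound. The radius `2 * r` covers both ends of an increment: a point of the mollifier's ball and its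
shift by less than `r`. -/
theorem norm_fderiv_mollify_sub_le (φ : ContDiffBump (0 : E)) {v : E → ℝ} (hv : Continuous v)
    (x : E) (ℓ : E →L[ℝ] ℝ) {r ε : ℝ} (hr : 0 < r) (hφ : φ.rOut ≤ r) (hε : 0 ≤ ε)
    (h : ∀ y ∈ Metric.ball x (2 * r), ∀ z ∈ Metric.ball x (2 * r),
      |v y - v z - ℓ (y - z)| ≤ ε * ‖y - z‖) :
    ‖fderiv ℝ (mollify φ v) x - ℓ‖ ≤ ε := by
  have hd : HasFDerivAt (mollify φ v) (fderiv ℝ (mollify φ v) x) x :=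
    ((contDiff_mollify φ hv).differentiable (by simp) x).hasFDerivAt
  refine (hd.sub ℓ.hasFDerivAt).le_of_lip' hε ?_
  filter_upwards [Metric.ball_mem_nhds x hr] with a ha
  have h1 := mollify_sub_sub_le φ hv a x (ℓ (a - x)) (ε * ‖a - x‖) (by positivity) fun z hz => by
    rw [Metric.mem_ball] at ha hz
    have h2 := h (z + (a - x)) (by
      rw [Metric.mem_ball, dist_eq_norm]
      rw [dist_eq_norm] at ha hz
      calc ‖z + (a - x) - x‖ = ‖(z - x) + (a - x)‖ := by congr 1; abel
        _ ≤ ‖z - x‖ + ‖a - x‖ := norm_add_le _ _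
        _ < 2 * r := by linarith) z (by
      rw [Metric.mem_ball]; linarith)
    simpa using h2
  rw [Real.norm_eq_abs]
  convert h1 using 2
  simp only [Pi.sub_apply, map_sub]
  ring

end Mollify

/-! ### Truncation near the boundary -/

section Truncation

variable {E : Type*} [PseudoMetricSpace E]

/-- The truncation of `u` to `[-m, m]`, where `m` is `2L` times the distance to the complement of
`Ω`, reduced by `ε`. -/
def boundaryTrunc (Ω : Set E) (L : ℝ) (ε : ℝ) (u : E → ℝ) (x : E) : ℝ :=
  max (-(2 * L * max 0 (Metric.infDist x Ωᶜ - ε)))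
    (min (u x) (2 * L * max 0 (Metric.infDist x Ωᶜ - ε)))

theorem lipschitzWith_boundaryTrunc (Ω : Set E) {L : NNReal} {u : E → ℝ} (hu : LipschitzWith L u)
    (ε : ℝ) : LipschitzWith (2 * L) (boundaryTrunc Ω L ε u) := by
  have h1 : LipschitzWith 1 fun x => max 0 (Metric.infDist x Ωᶜ - ε) := by
    have : LipschitzWith 1 fun x => Metric.infDist x Ωᶜ - ε := by
      simpa using (Metric.lipschitz_infDist_pt Ωᶜ).sub (LipschitzWith.const ε)
    exact this.const_max 0
  have h2 : LipschitzWith (2 * L) fun x => 2 * (L : ℝ) * max 0 (Metric.infDist x Ωᶜ - ε) := by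
    refine LipschitzWith.of_dist_le_mul fun x y => ?_
    have h := h1.dist_le_mul x y
    rw [Real.dist_eq] at h ⊢
    rw [← mul_sub, abs_mul, abs_of_nonneg (by positivity)]
    push_cast at h ⊢
    rw [one_mul] at h
    exact mul_le_mul_of_nonneg_left h (by positivity)
  have h3 : LipschitzWith (2 * L) u := hu.weaken (by rw [two_mul]; exact le_self_add)
  have h4 := h2.neg.max (h3.min h2)
  rwa [max_self, max_self] at h4

theorem abs_le_mul_infDist [ProperSpace E] {Ω : Set E} (hopen : IsOpen Ω) (hne : Ωᶜ.Nonempty) {L : NNReal}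
    {u : E → ℝ} (hu : LipschitzWith L u) (h0 : ∀ x, x ∉ Ω → u x = 0) (x : E) :
    |u x| ≤ L * Metric.infDist x Ωᶜ := by
  obtain ⟨y, hy, hxy⟩ := hopen.isClosed_compl.exists_infDist_eq_dist hne x
  have := hu.dist_le_mul x y
  rwa [h0 y hy, Real.dist_eq, sub_zero, ← hxy] at this

theorem boundaryTrunc_eq_zero {Ω : Set E} {L ε : ℝ} {u : E → ℝ} {x : E}
    (hx : Metric.infDist x Ωᶜ ≤ ε) : boundaryTrunc Ω L ε u x = 0 := by
  rw [boundaryTrunc, max_eq_left (by linarith : Metric.infDist x Ωᶜ - ε ≤ 0)]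
  simp

/-- The factor `2L` in the truncation level serves this: at distance at least `2 * ε` one has `dist
≤ 2 (dist - ε)`, so the level exceeds the bound `L * dist` for `|u|`. -/
theorem boundaryTrunc_eq_self [ProperSpace E] {Ω : Set E} (hopen : IsOpen Ω) (hne : Ωᶜ.Nonempty) {L : NNReal}
    {u : E → ℝ} (hu : LipschitzWith L u) (h0 : ∀ x, x ∉ Ω → u x = 0) {ε : ℝ} {x : E}
    (hx : 2 * ε ≤ Metric.infDist x Ωᶜ) : boundaryTrunc Ω L ε u x = u x := by
  have h1 := abs_le.1 (abs_le_mul_infDist hopen hne hu h0 x)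
  have h2 : (L : ℝ) * Metric.infDist x Ωᶜ ≤ 2 * L * max 0 (Metric.infDist x Ωᶜ - ε) := by
    have : Metric.infDist x Ωᶜ ≤ 2 * max 0 (Metric.infDist x Ωᶜ - ε) := by
      have := le_max_right 0 (Metric.infDist x Ωᶜ - ε)
      linarith
    have := mul_le_mul_of_nonneg_left this L.2
    change (L : ℝ) * _ ≤ (L : ℝ) * _ at this
    linarith
  rw [boundaryTrunc, min_eq_left (by linarith), max_eq_right (by linarith)]

theorem abs_boundaryTrunc_le {Ω : Set E} {L : NNReal} {ε : ℝ} {u : E → ℝ} {x : E} :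
    |boundaryTrunc Ω L ε u x| ≤ |u x| := by
  have hm : 0 ≤ 2 * (L : ℝ) * max 0 (Metric.infDist x Ωᶜ - ε) := by positivity
  rw [boundaryTrunc, abs_le]
  constructor
  · rcases le_total (u x) (2 * L * max 0 (Metric.infDist x Ωᶜ - ε)) with h | h
    · rw [min_eq_left h]
      exact (neg_abs_le _).trans (le_max_right _ _)
    · rw [min_eq_right h]
      exact le_trans (by linarith [abs_nonneg (u x)]) (le_max_right _ _)
  · refine max_le (by linarith [abs_nonneg (u x)]) ((min_le_left _ _).trans (le_abs_self _))

end Truncation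

/-- Truncating to zero within distance `ε` of the complement and mollifying with radius `ε / 2`
gives smooth functions supported in `Ω`. They and their gradients are uniformly bounded and converge
almost everywhere, so bounded convergence on the finite measure space applies. -/
theorem memH10_of_lipschitzWith {d : ℕ} {Ω : Set (EuclideanSpace ℝ (Fin d))} (hopen : IsOpen Ω)
    (hbdd : Bornology.IsBounded Ω) (hne : Ωᶜ.Nonempty) {L : NNReal}
    {u : EuclideanSpace ℝ (Fin d) → ℝ} (hu : LipschitzWith L u) (h0 : ∀ x, x ∉ Ω → u x = 0)
    (hdiff : ∀ᵐ x ∂(volume.restrict Ω), HasStrictFDerivAt u (fderiv ℝ u x) x) : MemH10 Ω u := by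
  have hfin : IsFiniteMeasure (volume.restrict Ω) :=
    ⟨by rw [Measure.restrict_apply_univ]; exact hbdd.measure_lt_top⟩
  obtain ⟨C, hC⟩ : ∃ C, ∀ x, |u x| ≤ C := by
    obtain ⟨C, hC⟩ := hbdd.isCompact_closure.exists_bound_of_continuousOn hu.continuous.continuousOn
    refine ⟨max C 0, fun x => ?_⟩
    by_cases hx : x ∈ Ω
    · exact (hC x (subset_closure hx)).trans (le_max_left _ _)
    · rw [h0 x hx, abs_zero]
      exact le_max_right _ _
  set ε : ℕ → ℝ := fun n => 1 / ((n : ℝ) + 1) with hεdef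
  have hε : ∀ n, 0 < ε n := fun n => by positivity
  have hε1 : ∀ n, ε n ≤ 1 := fun n => by
    rw [hεdef]
    simp only
    rw [div_le_one (by positivity)]
    linarith [(Nat.cast_nonneg n : (0 : ℝ) ≤ n)]
  have hεlim : Filter.Tendsto ε Filter.atTop (𝓝 0) := tendsto_one_div_add_atTop_nhds_zero_nat
  set v : ℕ → EuclideanSpace ℝ (Fin d) → ℝ := fun n => boundaryTrunc Ω L (ε n) u with hv
  have hvL : ∀ n, LipschitzWith (2 * L) (v n) := fun n => lipschitzWith_boundaryTrunc Ω hu _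
  let b : ℕ → ContDiffBump (0 : EuclideanSpace ℝ (Fin d)) := fun n =>
    ⟨ε n / 4, ε n / 2, by linarith [hε n], by linarith [hε n]⟩
  have hb : ∀ n, (b n).rOut = ε n / 2 := fun n => rfl
  set φ : ℕ → EuclideanSpace ℝ (Fin d) → ℝ := fun n => mollify (b n) (v n) with hφ
  have hsmooth : ∀ n, ContDiff ℝ ∞ (φ n) := fun n => contDiff_mollify _ (hvL n).continuous
  have hsupp : ∀ n, tsupport (φ n) ⊆ {x | ε n / 2 ≤ Metric.infDist x Ωᶜ} := by
    intro n
    refine closure_minimal (fun x hx => ?_)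
      (isClosed_le continuous_const (Metric.continuous_infDist_pt _))
    by_contra hlt
    simp only [Set.mem_ofPred_eq, not_le] at hlt
    have hz : ∀ z ∈ Metric.ball x (b n).rOut, v n z = 0 := by
      intro z hz
      rw [hb, Metric.mem_ball] at hz
      refine boundaryTrunc_eq_zero ?_
      have := Metric.infDist_le_infDist_add_dist (s := Ωᶜ) (x := z) (y := x)
      linarith
    have hx0 := hz x (Metric.mem_ball_self (b n).rOut_pos)
    have := abs_mollify_sub_le (b n) (hvL n).continuous x 0 fun z hz' => by
      rw [hz z hz', hx0, sub_zero, abs_zero]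
    rw [hx0, sub_zero] at this
    exact hx (abs_nonpos_iff.1 this)
  have hsuppΩ : ∀ n, tsupport (φ n) ⊆ Ω := by
    intro n x hx
    by_contra hxΩ
    have := hsupp n hx
    simp only [Set.mem_ofPred_eq, Metric.infDist_zero_of_mem (s := Ωᶜ) hxΩ] at this
    linarith [hε n]
  have hLip : ∀ n, LipschitzWith (2 * L) (φ n) := by
    intro n
    refine LipschitzWith.of_dist_le_mul fun a x => ?_
    have := mollify_sub_sub_le (b n) (hvL n).continuous a x 0 (↑(2 * L) * dist a x)
      (by positivity) fun z _ => by
        have h := (hvL n).dist_le_mul (z + (a - x)) z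
        rw [Real.dist_eq, dist_eq_norm, add_sub_cancel_left, ← dist_eq_norm] at h
        simpa using h
    rw [Real.dist_eq]
    simpa using this
  have hclose : ∀ n x, |φ n x - v n x| ≤ L * ε n := by
    intro n x
    refine abs_mollify_sub_le (b n) (hvL n).continuous x _ fun z hz => ?_
    have h := (hvL n).dist_le_mul z x
    rw [Metric.mem_ball, hb] at hz
    rw [Real.dist_eq] at h
    push_cast at h
    have := mul_le_mul_of_nonneg_left hz.le (show (0 : ℝ) ≤ 2 * L by positivity)
    linarith
  have hpos : ∀ x ∈ Ω, 0 < Metric.infDist x Ωᶜ := fun x hx =>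
    (hopen.isClosed_compl.notMem_iff_infDist_pos hne).1 fun h => h hx
  have hlocal : ∀ x ∈ Ω, ∀ᶠ n in Filter.atTop,
      ∀ z ∈ Metric.ball x (Metric.infDist x Ωᶜ / 2), v n z = u z := by
    intro x hx
    have h1 : ∀ᶠ n in Filter.atTop, ε n < Metric.infDist x Ωᶜ / 4 :=
      hεlim.eventually (gt_mem_nhds (by linarith [hpos x hx]))
    filter_upwards [h1] with n hn z hz
    refine boundaryTrunc_eq_self hopen hne hu h0 ?_
    rw [Metric.mem_ball, dist_comm] at hz
    have := Metric.infDist_le_infDist_add_dist (s := Ωᶜ) (x := x) (y := z)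
    linarith
  have hbound : ∀ (w : EuclideanSpace ℝ (Fin d) → ℝ) (K : NNReal), LipschitzWith K w →
      ∀ i x, |partialDeriv i w x| ≤ K := by
    intro w K hw i x
    have h1 : ‖fderiv ℝ w x‖ ≤ K := norm_fderiv_le_of_lipschitz ℝ hw
    have h2 := (fderiv ℝ w x).le_opNorm (EuclideanSpace.single i 1)
    rw [PiLp.norm_single, norm_one, mul_one] at h2
    exact h2.trans h1
  have hmeas : ∀ (w : EuclideanSpace ℝ (Fin d) → ℝ) i,
      AEStronglyMeasurable (partialDeriv i w) (volume.restrict Ω) := fun w i =>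
    (measurable_fderiv_apply_const ℝ w (EuclideanSpace.single i 1)).aestronglyMeasurable
  refine ⟨MemLp.of_bound hu.continuous.aestronglyMeasurable C (Filter.Eventually.of_forall hC),
    fun i => partialDeriv i u, fun i => MemLp.of_bound (hmeas u i) L
      (Filter.Eventually.of_forall (hbound u L hu i)), φ, fun n => ⟨hsmooth n, ?_, hsuppΩ n⟩, ?_,
    fun i => ?_⟩
  · exact Metric.isCompact_of_isClosed_isBounded (isClosed_tsupport _) (hbdd.subset (hsuppΩ n))
  · refine tendsto_eLpNorm_of_bounded (L + 2 * C)
      (fun n => (hsmooth n).continuous.aestronglyMeasurable) hu.continuous.aestronglyMeasurable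
      (fun n => Filter.Eventually.of_forall fun x => ?_) ?_
    · have h1 := abs_le.1 (hclose n x)
      have h2 := abs_le.1 ((abs_boundaryTrunc_le (Ω := Ω) (L := L) (ε := ε n)).trans (hC x))
      have h3 := abs_le.1 (hC x)
      have h4 : (L : ℝ) * ε n ≤ L := mul_le_of_le_one_right L.2 (hε1 n)
      rw [abs_le]
      constructor <;> linarith [h1.1, h1.2, h2.1, h2.2, h3.1, h3.2]
    · filter_upwards [ae_restrict_mem hopen.measurableSet] with x hx
      rw [tendsto_iff_dist_tendsto_zero]
      refine squeeze_zero' (Filter.Eventually.of_forall fun n => dist_nonneg) ?_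
        (by simpa using hεlim.const_mul (L : ℝ))
      filter_upwards [hlocal x hx] with n hn
      have h := hclose n x
      rw [hn x (Metric.mem_ball_self (by linarith [hpos x hx]))] at h
      rwa [Real.dist_eq]
  · refine tendsto_eLpNorm_of_bounded (↑(2 * L) + L)
      (fun n => hmeas _ i) (hmeas u i)
      (fun n => Filter.Eventually.of_forall fun x => ?_) ?_
    · exact (abs_sub _ _).trans (add_le_add (hbound _ _ (hLip n) i x) (hbound _ _ hu i x))
    -- Near an interior point the truncation is eventually inactive, so strict differentiability of
    -- `u` controls the increments of `v n` on a fixed ball and hence the derivative of its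
    -- mollification.
    · filter_upwards [ae_restrict_mem hopen.measurableSet, hdiff] with x hx hxd
      rw [Metric.tendsto_atTop']
      intro η hη
      have hη2 : 0 < η / 2 := by linarith
      have happ := hxd.isLittleO.def hη2
      rw [Metric.eventually_nhds_iff_ball] at happ
      obtain ⟨r, hr, hball⟩ := happ
      set ρ := min r (Metric.infDist x Ωᶜ / 2) with hρ
      have hρpos : 0 < ρ := lt_min hr (by linarith [hpos x hx])
      have h1 : ∀ᶠ n in Filter.atTop, ε n < ρ / 2 := hεlim.eventually (gt_mem_nhds (by linarith))
      obtain ⟨N, hN⟩ := Filter.eventually_atTop.1 (h1.and (hlocal x hx))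
      refine ⟨N, fun n hn => ?_⟩
      obtain ⟨hn1, hn2⟩ := hN n hn.le
      have h2 := norm_fderiv_mollify_sub_le (b n) (hvL n).continuous x (fderiv ℝ u x)
        (r := ρ / 2) (ε := η / 2) (by linarith) (by rw [hb]; linarith [hε n]) hη2.le
        fun y hy z hz => by
          rw [mul_div_cancel₀ _ (two_ne_zero)] at hy hz
          rw [hn2 y (Metric.ball_subset_ball (min_le_right _ _) hy),
            hn2 z (Metric.ball_subset_ball (min_le_right _ _) hz)]
          have h3 := hball (y, z) (by
            rw [← ball_prod_same]
            exact ⟨Metric.ball_subset_ball (min_le_left _ _) hy,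
              Metric.ball_subset_ball (min_le_left _ _) hz⟩)
          simpa [Real.norm_eq_abs] using h3
      have h4 := (fderiv ℝ (φ n) x - fderiv ℝ u x).le_opNorm (EuclideanSpace.single i 1)
      rw [PiLp.norm_single, norm_one, mul_one] at h4
      rw [dist_eq_norm]
      change ‖fderiv ℝ (φ n) x _ - fderiv ℝ u x _‖ < η
      exact lt_of_le_of_lt (h4.trans h2) (by linarith)

end CrouzeixRaviart

end

noncomputable section

namespace CrouzeixRaviart

/-! ### Functions in `H¹₀` vanish on the boundary -/

open MeasureTheory

theorem eLpNorm_two_sq {X : Type*} [MeasurableSpace X] {μ : Measure X} (f : X → ℝ) :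
    eLpNorm f 2 μ ^ 2 = ∫⁻ x, ‖f x‖ₑ ^ 2 ∂μ := by
  rw [eLpNorm_eq_lintegral_rpow_enorm_toReal (by norm_num) (by norm_num), ← ENNReal.rpow_two,
    ← ENNReal.rpow_mul]
  simp

/-- Monotonicity of `Lᵖ` norms on the probability space `(0, 1]`. -/
theorem enorm_integral_sq_le (f : ℝ → ℝ) (hf : Continuous f) :
    ‖∫ t in (0 : ℝ)..1, f t‖ₑ ^ 2 ≤ ∫⁻ t in Set.Ioc (0 : ℝ) 1, ‖f t‖ₑ ^ 2 := by
  have hp : IsProbabilityMeasure (volume.restrict (Set.Ioc (0 : ℝ) 1)) := ⟨by simp⟩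
  rw [intervalIntegral.integral_of_le zero_le_one, ← eLpNorm_two_sq]
  gcongr
  refine (enorm_integral_le_lintegral_enorm _).trans ?_
  rw [← eLpNorm_one_eq_lintegral_enorm]
  exact eLpNorm_le_eLpNorm_of_exponent_le (by norm_num) hf.aestronglyMeasurable

/-! ### Translation estimates and jumps -/

section Translation

variable {E : Type*} [NormedAddCommGroup E] [NormedSpace ℝ E]
  [MeasurableSpace E] [BorelSpace E]
  {μ : Measure E} [μ.IsAddRightInvariant]

/-- Write the increment as an integral of the derivative along the segment, use Jensen, exchange the
integrals, and use translation invariance. -/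
theorem eLpNorm_translate_sub_le [SecondCountableTopology E] [SFinite μ] {φ : E → ℝ} (hφ : ContDiff ℝ 1 φ) (h : E) :
    eLpNorm (fun x => φ (x + h) - φ x) 2 μ ≤ eLpNorm (fun x => fderiv ℝ φ x h) 2 μ := by
  have hc : Continuous fun x => fderiv ℝ φ x h :=
    (hφ.continuous_fderiv (by simp)).clm_apply continuous_const
  have hpt : ∀ x, ‖φ (x + h) - φ x‖ₑ ^ 2 ≤
      ∫⁻ t in Set.Ioc (0 : ℝ) 1, ‖fderiv ℝ φ (x + t • h) h‖ₑ ^ 2 := by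
    intro x
    have hcont : Continuous fun t : ℝ => fderiv ℝ φ (x + t • h) h := hc.comp (by fun_prop)
    have hFTC : ∫ t in (0 : ℝ)..1, fderiv ℝ φ (x + t • h) h = φ (x + h) - φ x := by
      have hd : ∀ t ∈ Set.uIcc (0 : ℝ) 1,
          HasDerivAt (fun t : ℝ => φ (x + t • h)) (fderiv ℝ φ (x + t • h) h) t := by
        intro t _
        have h1 : HasDerivAt (fun t : ℝ => x + t • h) h t := by
          simpa using ((hasDerivAt_id t).smul_const h).const_add x
        exact ((hφ.differentiable (by simp) _).hasFDerivAt).comp_hasDerivAt t h1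
      rw [intervalIntegral.integral_eq_sub_of_hasDerivAt hd (hcont.intervalIntegrable _ _)]
      simp
    rw [← hFTC]
    exact enorm_integral_sq_le _ hcont
  have hm : Measurable fun q : E × ℝ => ‖fderiv ℝ φ (q.1 + q.2 • h) h‖ₑ ^ 2 :=
    (hc.comp (by fun_prop : Continuous fun q : E × ℝ => q.1 + q.2 • h)).enorm.measurable.pow_const 2
  have hsq : eLpNorm (fun x => φ (x + h) - φ x) 2 μ ^ 2 ≤
      eLpNorm (fun x => fderiv ℝ φ x h) 2 μ ^ 2 := by
    rw [eLpNorm_two_sq, eLpNorm_two_sq]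
    calc ∫⁻ x, ‖φ (x + h) - φ x‖ₑ ^ 2 ∂μ
        ≤ ∫⁻ x, (∫⁻ t in Set.Ioc (0 : ℝ) 1, ‖fderiv ℝ φ (x + t • h) h‖ₑ ^ 2) ∂μ :=
          lintegral_mono hpt
      _ = ∫⁻ t in Set.Ioc (0 : ℝ) 1, ∫⁻ x, ‖fderiv ℝ φ (x + t • h) h‖ₑ ^ 2 ∂μ :=
          lintegral_lintegral_swap hm.aemeasurable
      _ = ∫⁻ _t in Set.Ioc (0 : ℝ) 1, ∫⁻ x, ‖fderiv ℝ φ x h‖ₑ ^ 2 ∂μ := by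
          refine lintegral_congr fun t => ?_
          exact lintegral_add_right_eq_self (fun x => ‖fderiv ℝ φ x h‖ₑ ^ 2) (t • h)
      _ = ∫⁻ x, ‖fderiv ℝ φ x h‖ₑ ^ 2 ∂μ := by simp
  exact (ENNReal.pow_le_pow_left_iff two_ne_zero).1 hsq

/-- A function with `‖w(· + h) - w‖ ≤ C ‖h‖` in `L²` has no jumps. -/
theorem false_of_jump [μ.IsOpenPosMeasure] {Ω : Set E} {w : E → ℝ} (hw : AEStronglyMeasurable w μ)
    (hw0 : ∀ x, x ∉ Ω → w x = 0) {C : ℝ≥0∞} (hC : C ≠ ⊤)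
    (htr : ∀ h, eLpNorm (fun x => w (x + h) - w x) 2 μ ≤ C * ‖h‖ₑ) {U : Set E} (hU : IsOpen U)
    (hne : U.Nonempty) {c : ℝ} (hc : 0 < c) (D : E) (hU0 : ∀ x ∈ U, x ∉ Ω)
    (hU1 : ∀ x ∈ U, x + D ∈ Ω)
    (hUt : ∀ x ∈ U, ∀ t : ℝ, 0 ≤ t → t ≤ 1 → x + t • D ∈ Ω → c ≤ |w (x + t • D)|) : False := by
  set a := ENNReal.ofReal c ^ 2 * μ U with ha
  have ha0 : a ≠ 0 := mul_ne_zero (pow_ne_zero _ (by simpa using hc)) (hU.measure_pos μ hne).ne'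
  have hK : (C * ‖D‖ₑ) ^ 2 ≠ ⊤ := ENNReal.pow_ne_top (ENNReal.mul_ne_top hC enorm_ne_top)
  -- The segment `D` is cut into `N` steps. The jump forces `a ≤ N (C ‖D‖ / N)²`, which fails for
  -- this `N`.
  obtain ⟨N, hN⟩ := ENNReal.exists_nat_mul_gt ha0 hK
  have hNpos : 0 < N := by
    rcases Nat.eq_zero_or_pos N with rfl | h
    · simp at hN
    · exact h
  have hN0 : (N : ℝ) ≠ 0 := by positivity
  set h : E := (N : ℝ)⁻¹ • D with hh
  have hNh : ∀ j : ℕ, (j : ℝ) • h = ((j : ℝ) / N) • D := fun j => by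
    rw [hh, smul_smul, div_eq_mul_inv]
  have hjump : ∀ x ∈ U, ENNReal.ofReal c ^ 2 ≤
      ∑ j ∈ Finset.range N, ‖w (x + (j : ℝ) • h + h) - w (x + (j : ℝ) • h)‖ₑ ^ 2 := by
    intro x hx
    -- The walk starts outside `Ω` and ends inside, so some step enters `Ω`; there `w` goes from `0`
    -- to modulus at least `c`.
    obtain ⟨j, hj, hj0, hj1⟩ : ∃ j < N, x + (j : ℝ) • h ∉ Ω ∧ x + ((j + 1 : ℕ) : ℝ) • h ∈ Ω := by
      by_contra! hcon
      have : ∀ j ≤ N, x + (j : ℝ) • h ∉ Ω := by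
        intro j
        induction j with
        | zero => intro _; simpa using hU0 x hx
        | succ j ih => intro hj; exact hcon j hj (ih (by omega))
      refine this N le_rfl ?_
      rw [hNh, div_self hN0, one_smul]
      exact hU1 x hx
    refine le_trans ?_ (Finset.single_le_sum (f := fun j : ℕ =>
      ‖w (x + (j : ℝ) • h + h) - w (x + (j : ℝ) • h)‖ₑ ^ 2) (fun _ _ => zero_le)
      (Finset.mem_range.2 hj))
    have heq : x + (j : ℝ) • h + h = x + ((j + 1 : ℕ) : ℝ) • h := by
      push_cast
      rw [add_smul, one_smul, add_assoc]
    rw [hw0 _ hj0, sub_zero, heq]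
    gcongr
    rw [← ofReal_norm, Real.norm_eq_abs]
    refine ENNReal.ofReal_le_ofReal ?_
    rw [hNh] at hj1 ⊢
    refine hUt x hx _ (by positivity) ?_ hj1
    rw [div_le_one (by positivity)]
    exact_mod_cast hj
  have hwt : ∀ v, AEStronglyMeasurable (fun x => w (x + v)) μ := fun v =>
    hw.comp_measurePreserving (measurePreserving_add_right μ v)
  have h1 : a ≤ N * (C * ‖h‖ₑ) ^ 2 := by
    calc a = ∫⁻ _x in U, ENNReal.ofReal c ^ 2 ∂μ := by rw [setLIntegral_const]
      _ ≤ ∫⁻ x in U, ∑ j ∈ Finset.range N,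
          ‖w (x + (j : ℝ) • h + h) - w (x + (j : ℝ) • h)‖ₑ ^ 2 ∂μ :=
        setLIntegral_mono' hU.measurableSet hjump
      _ ≤ ∫⁻ x, ∑ j ∈ Finset.range N,
          ‖w (x + (j : ℝ) • h + h) - w (x + (j : ℝ) • h)‖ₑ ^ 2 ∂μ := setLIntegral_le_lintegral _ _
      _ = ∑ j ∈ Finset.range N, ∫⁻ x,
          ‖w (x + (j : ℝ) • h + h) - w (x + (j : ℝ) • h)‖ₑ ^ 2 ∂μ := by
        refine lintegral_finsetSum' _ fun j _ => ?_
        refine AEMeasurable.pow_const (AEStronglyMeasurable.enorm ?_) 2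
        refine AEStronglyMeasurable.sub ?_ (hwt _)
        simpa only [add_assoc] using hwt ((j : ℝ) • h + h)
      _ = ∑ j ∈ Finset.range N, ∫⁻ x, ‖w (x + h) - w x‖ₑ ^ 2 ∂μ := by
        refine Finset.sum_congr rfl fun j _ => ?_
        exact lintegral_add_right_eq_self (fun x => ‖w (x + h) - w x‖ₑ ^ 2) ((j : ℝ) • h)
      _ = N * eLpNorm (fun x => w (x + h) - w x) 2 μ ^ 2 := by
        rw [eLpNorm_two_sq, Finset.sum_const, Finset.card_range, nsmul_eq_mul]
      _ ≤ N * (C * ‖h‖ₑ) ^ 2 := by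
        gcongr
        exact htr h
  refine absurd hN (not_lt.2 ?_)
  have hNe : (N : ℝ≥0∞) * ‖h‖ₑ = ‖D‖ₑ := by
    have : D = (N : ℝ) • h := by rw [hh, smul_smul, mul_inv_cancel₀ hN0, one_smul]
    conv_rhs => rw [this, enorm_smul]
    simp
  calc (N : ℝ≥0∞) * a ≤ N * (N * (C * ‖h‖ₑ) ^ 2) := by gcongr
    _ = (C * (N * ‖h‖ₑ)) ^ 2 := by ring
    _ = (C * ‖D‖ₑ) ^ 2 := by rw [hNe]

end Translation

theorem fderiv_apply_eq_sum {d : ℕ} (φ : EuclideanSpace ℝ (Fin d) → ℝ)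
    (x h : EuclideanSpace ℝ (Fin d)) : fderiv ℝ φ x h = ∑ i, h i * partialDeriv i φ x := by
  have h2 : h = ∑ i, h i • (EuclideanSpace.single i (1 : ℝ) : EuclideanSpace ℝ (Fin d)) := by
    have := (EuclideanSpace.basisFun (Fin d) ℝ).sum_repr h
    simpa using this.symm
  conv_lhs => rw [h2, map_sum]
  simp [partialDeriv]

theorem eLpNorm_sub_le_of_middle {X : Type*} [MeasurableSpace X] {μ : Measure X} {a b a' b' : X → ℝ}
    (ha : AEStronglyMeasurable a μ) (hb : AEStronglyMeasurable b μ)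
    (ha' : AEStronglyMeasurable a' μ) (hb' : AEStronglyMeasurable b' μ) :
    eLpNorm (fun x => a x - b x) 2 μ ≤ eLpNorm (fun x => a' x - a x) 2 μ +
      eLpNorm (fun x => a' x - b' x) 2 μ + eLpNorm (fun x => b' x - b x) 2 μ := by
  have e : (fun x => a x - b x) = (-(a' - a) + (a' - b')) + (b' - b) := by
    funext x
    simp
  rw [e]
  refine (eLpNorm_add_le ((ha'.sub ha).neg.add (ha'.sub hb')) (hb'.sub hb) (by norm_num)).trans ?_
  refine add_le_add ?_ le_rfl
  refine (eLpNorm_add_le (ha'.sub ha).neg (ha'.sub hb') (by norm_num)).trans ?_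
  rw [eLpNorm_neg]
  rfl

/-- The estimate holds for the smooth approximations, whose support in `Ω` makes norms over `Ω` and
over the whole space equal, and passes to the limit. The constant is the sum of the norms of the
weak derivatives. -/
theorem MemH10.exists_eLpNorm_translate_le {d : ℕ} {Ω : Set (EuclideanSpace ℝ (Fin d))}
    (hopen : IsOpen Ω) {u : EuclideanSpace ℝ (Fin d) → ℝ} (hu : MemH10 Ω u) :
    AEStronglyMeasurable (Ω.indicator u) volume ∧ ∃ C : ℝ≥0∞, C ≠ ⊤ ∧ ∀ h,
      eLpNorm (fun x => Ω.indicator u (x + h) - Ω.indicator u x) 2 volume ≤ C * ‖h‖ₑ := by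
  obtain ⟨hu2, g, hg, φ, hφ, h1, h2⟩ := hu
  set w := Ω.indicator u with hw
  have hwm : AEStronglyMeasurable w volume :=
    (aestronglyMeasurable_indicator_iff hopen.measurableSet).2 hu2.1
  refine ⟨hwm, ∑ i, eLpNorm (g i) 2 (volume.restrict Ω),
    ENNReal.sum_ne_top.2 fun i _ => (hg i).2.ne, fun h => ?_⟩
  have hφm : ∀ n, AEStronglyMeasurable (φ n) volume := fun n =>
    (hφ n).1.continuous.aestronglyMeasurable
  have hsub : ∀ n, eLpNorm (fun x => φ n x - w x) 2 volume =
      eLpNorm (fun x => φ n x - u x) 2 (volume.restrict Ω) := by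
    intro n
    rw [← eLpNorm_indicator_eq_eLpNorm_restrict hopen.measurableSet]
    congr 1
    funext x
    by_cases hx : x ∈ Ω
    · simp [hw, hx]
    · simp [hw, hx, image_eq_zero_of_notMem_tsupport fun h => hx ((hφ n).2.2 h)]
  have hpd : ∀ n i, eLpNorm (partialDeriv i (φ n)) 2 volume =
      eLpNorm (partialDeriv i (φ n)) 2 (volume.restrict Ω) := by
    intro n i
    rw [← eLpNorm_indicator_eq_eLpNorm_restrict hopen.measurableSet]
    congr 1
    funext x
    by_cases hx : x ∈ Ω
    · simp [hx]
    · have hx' : x ∉ tsupport (φ n) := fun h => hx ((hφ n).2.2 h)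
      simp only [hx, not_false_eq_true, Set.indicator_of_notMem, partialDeriv]
      rw [image_eq_zero_of_notMem_tsupport fun h => hx' (tsupport_fderiv_subset ℝ h)]
      rfl
  have hder : ∀ n, eLpNorm (fun x => fderiv ℝ (φ n) x h) 2 volume ≤
      (∑ i, (eLpNorm (fun x => partialDeriv i (φ n) x - g i x) 2 (volume.restrict Ω) +
        eLpNorm (g i) 2 (volume.restrict Ω))) * ‖h‖ₑ := by
    intro n
    have he : (fun x => fderiv ℝ (φ n) x h) = ∑ i, h i • partialDeriv i (φ n) := by
      funext x
      rw [fderiv_apply_eq_sum, Finset.sum_apply]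
      rfl
    rw [he, Finset.sum_mul]
    refine (eLpNorm_sum_le (fun i _ => (continuous_partialDeriv i
      (hφ n).1).aestronglyMeasurable.const_smul _) (by norm_num)).trans ?_
    refine Finset.sum_le_sum fun i _ => ?_
    rw [eLpNorm_const_smul, hpd, mul_comm]
    gcongr
    · have := eLpNorm_add_le (p := 2) (μ := volume.restrict Ω)
        (((continuous_partialDeriv i (hφ n).1).aestronglyMeasurable).sub (hg i).1) (hg i).1
        (by norm_num)
      refine le_trans (le_of_eq ?_) this
      congr 1
      funext x
      simp
    · rw [← ofReal_norm, ← ofReal_norm]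
      exact ENNReal.ofReal_le_ofReal (PiLp.norm_apply_le h i)
  have hn : ∀ n, eLpNorm (fun x => w (x + h) - w x) 2 volume ≤
      eLpNorm (fun x => φ n x - u x) 2 (volume.restrict Ω) +
      (∑ i, (eLpNorm (fun x => partialDeriv i (φ n) x - g i x) 2 (volume.restrict Ω) +
        eLpNorm (g i) 2 (volume.restrict Ω))) * ‖h‖ₑ +
      eLpNorm (fun x => φ n x - u x) 2 (volume.restrict Ω) := by
    intro n
    have hmp := measurePreserving_add_right (volume : Measure (EuclideanSpace ℝ (Fin d))) h
    have e1 : eLpNorm (fun x => φ n (x + h) - w (x + h)) 2 volume =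
        eLpNorm (fun x => φ n x - w x) 2 volume :=
      eLpNorm_comp_measurePreserving (g := fun x => φ n x - w x) (f := fun x => x + h)
        ((hφm n).sub hwm) hmp
    have hw' : AEStronglyMeasurable (fun x => w (x + h)) volume := hwm.comp_measurePreserving hmp
    have hφ' : AEStronglyMeasurable (fun x => φ n (x + h)) volume :=
      (hφm n).comp_measurePreserving hmp
    have e2 : eLpNorm (fun x => φ n (x + h) - φ n x) 2 volume ≤ _ :=
      (eLpNorm_translate_sub_le ((hφ n).1.of_le (by norm_cast)) h).trans (hder n)
    rw [← hsub n]
    exact (eLpNorm_sub_le_of_middle hw' hwm hφ' (hφm n)).trans (by rw [e1]; gcongr)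
  have hlim : Filter.Tendsto (fun n => eLpNorm (fun x => φ n x - u x) 2 (volume.restrict Ω) +
      (∑ i, (eLpNorm (fun x => partialDeriv i (φ n) x - g i x) 2 (volume.restrict Ω) +
        eLpNorm (g i) 2 (volume.restrict Ω))) * ‖h‖ₑ +
      eLpNorm (fun x => φ n x - u x) 2 (volume.restrict Ω)) Filter.atTop
      (𝓝 (0 + (∑ i, (0 + eLpNorm (g i) 2 (volume.restrict Ω))) * ‖h‖ₑ + 0)) :=
    (h1.add (ENNReal.Tendsto.mul_const (tendsto_finsetSum _ fun i _ =>
      (h2 i).add tendsto_const_nhds) (Or.inr enorm_ne_top))).add h1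
  simp only [zero_add, add_zero] at hlim
  exact ge_of_tendsto' hlim hn

namespace Mesh

/-- If `f x₀ ≠ 0`, then `|f|` is bounded below near `x₀`. As `Ω = int closure Ω`, every ball around
`x₀` contains exterior points as well as points of `Ω`; translating an open set of the former into
`Ω` within the ball exhibits a jump of the zero extension. -/
theorem eq_zero_of_memH10 {d : ℕ} {Ω : Set (EuclideanSpace ℝ (Fin d))}
    (hreg : interior (closure Ω) = Ω) (f : C(closure Ω, ℝ)) (hf : MemH10 Ω (extendZero f))
    (x₀ : closure Ω) (hx₀ : x₀.1 ∈ frontier Ω) : f x₀ = 0 := by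
  have hopen : IsOpen Ω := hreg ▸ isOpen_interior
  by_contra hne
  set c := |f x₀| / 2 with hc
  have hcpos : 0 < c := by positivity
  obtain ⟨r, hr, hball⟩ : ∃ r > 0, ∀ x : closure Ω, x.1 ∈ Metric.ball x₀.1 r → c ≤ |f x| := by
    have h1 : ∀ᶠ x in 𝓝 x₀, c < |f x| :=
      (f.continuous.abs.tendsto x₀).eventually (lt_mem_nhds (by
        rw [hc]; linarith [abs_pos.2 hne]))
    obtain ⟨r, hr, h⟩ := Metric.eventually_nhds_iff_ball.1 h1
    exact ⟨r, hr, fun x hx => (h x hx).le⟩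
  rw [hopen.frontier_eq] at hx₀
  obtain ⟨p, hpr, hp⟩ : ∃ p ∈ Metric.ball x₀.1 r, p ∉ closure Ω := by
    by_contra! hcon
    refine hx₀.2 ?_
    exact hreg.le (mem_interior.2 ⟨_, hcon, Metric.isOpen_ball, Metric.mem_ball_self hr⟩)
  obtain ⟨q, hq, hqr⟩ : ∃ q ∈ Ω, q ∈ Metric.ball x₀.1 r := by
    obtain ⟨q, hq, hd⟩ := Metric.mem_closure_iff.1 hx₀.1 r hr
    exact ⟨q, hq, by rwa [Metric.mem_ball, dist_comm]⟩
  obtain ⟨hm, C, hC, htr⟩ := hf.exists_eLpNorm_translate_le hopen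
  set D := q - p with hD
  have hcont : Continuous fun x : EuclideanSpace ℝ (Fin d) => x + D := by fun_prop
  set U := (Metric.ball x₀.1 r ∩ (closure Ω)ᶜ) ∩
    (fun x => x + D) ⁻¹' (Metric.ball x₀.1 r ∩ Ω) with hU
  have hUo : IsOpen U := (Metric.isOpen_ball.inter isClosed_closure.isOpen_compl).inter
    ((Metric.isOpen_ball.inter hopen).preimage hcont)
  refine false_of_jump hm (fun x hx => by simp [hx]) hC htr hUo
    ⟨p, ⟨hpr, hp⟩, by simpa [hD] using ⟨hqr, hq⟩⟩ hcpos D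
    (fun x hx h => hx.1.2 (subset_closure h)) (fun x hx => hx.2.2) fun x hx t ht0 ht1 hxt => ?_
  have hmem : x + t • D ∈ Metric.ball x₀.1 r := by
    have := (convex_ball x₀.1 r).add_smul_mem hx.1.1 hx.2.1 ⟨ht0, ht1⟩
    simpa using this
  rw [Set.indicator_of_mem hxt, extendZero, dif_pos (subset_closure hxt)]
  exact hball ⟨_, subset_closure hxt⟩ hmem

end Mesh

end CrouzeixRaviart

end

noncomputable section

namespace CrouzeixRaviart

/-! ### Continuous piecewise polynomials in `H¹₀` -/

open MeasureTheory

/-- Argue on the segment from `x` to `y`. To the right of any parameter, either some piece is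
visited arbitrarily close by and, being closed, contains the current point, or `u` is zero. The
lower right slope is thus bounded by the Lipschitz constant, and a mean value inequality of Dini
type concludes. -/
theorem lipschitzWith_of_lipschitzOnWith_cover {ι E : Type*} [Finite ι] [NormedAddCommGroup E]
    [NormedSpace ℝ E] {s : ι → Set E} (hs : ∀ i, IsClosed (s i)) {u : E → ℝ} (hu : Continuous u)
    (hu0 : ∀ x, (∀ i, x ∉ s i) → u x = 0) {L : NNReal} (hL : ∀ i, LipschitzOnWith L u (s i)) :
    LipschitzWith L u := by
  refine LipschitzWith.of_dist_le_mul fun y x => ?_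
  set p : ℝ → E := fun t => x + t • (y - x) with hp
  have hpc : Continuous p := by fun_prop
  set C : ℝ := L * ‖y - x‖ with hC
  have hpd : ∀ a b, ‖p a - p b‖ = |a - b| * ‖y - x‖ := by
    intro a b
    rw [hp, ← Real.norm_eq_abs, ← norm_smul, sub_smul]
    congr 1
    exact add_sub_add_left_eq_sub _ _ _
  have hslope : ∀ t : ℝ, ∃ᶠ z in 𝓝[>] t, |u (p z) - u (p t)| ≤ C * (z - t) := by
    intro t
    have hpt : Filter.Tendsto p (𝓝[>] t) (𝓝 (p t)) := hpc.continuousAt.mono_left nhdsWithin_le_nhds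
    have hgt : ∀ᶠ z in 𝓝[>] t, t < z := self_mem_nhdsWithin
    by_cases h : ∃ i, ∃ᶠ z in 𝓝[>] t, p z ∈ s i
    · obtain ⟨i, hi⟩ := h
      have hti : p t ∈ s i := (hs i).mem_of_frequently_of_tendsto hi hpt
      refine (hi.and_eventually hgt).mono fun z hz => ?_
      have := (hL i).dist_le_mul _ hz.1 _ hti
      rw [Real.dist_eq, dist_eq_norm, hpd, abs_of_pos (sub_pos.2 hz.2)] at this
      rw [hC]
      linarith
    · simp only [not_exists, Filter.not_frequently] at h
      have h0 : ∀ᶠ z in 𝓝[>] t, u (p z) = 0 :=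
        (Filter.eventually_all.2 h).mono fun z hz => hu0 _ hz
      have ht0 : u (p t) = 0 := by
        refine tendsto_nhds_unique ((hu.tendsto _).comp hpt) ?_
        exact tendsto_const_nhds.congr' (h0.mono fun z hz => hz.symm)
      refine (h0.and hgt).frequently.mono fun z hz => ?_
      rw [hz.1, ht0, sub_zero, abs_zero]
      exact mul_nonneg (by positivity) (sub_nonneg.2 hz.2.le)
  -- The comparison theorem needs a strict inequality of slopes, hence the slack `C' > C`, removed
  -- at the end.
  have key : ∀ C', C < C' → |u (p 1) - u (p 0)| ≤ C' := by
    intro C' hC'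
    have := image_norm_le_of_liminf_right_slope_norm_lt_deriv_boundary (a := 0) (b := 1)
      (f := fun t => u (p t) - u (p 0)) (f' := fun _ => C) (B := fun t => C' * t)
      (B' := fun _ => C') (by fun_prop) (fun t _ r hr => ?_) (by simp) (by fun_prop)
      (fun t _ => ?_) (fun _ _ _ => hC') (x := 1) (by simp)
    · simpa using this
    · refine ((hslope t).and_eventually self_mem_nhdsWithin).mono fun z hz => ?_
      have hz2 : 0 < z - t := sub_pos.2 hz.2
      rw [slope_def_field]
      refine lt_of_le_of_lt ?_ hr
      rw [div_le_iff₀ hz2]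
      refine le_trans ?_ hz.1
      have := abs_sub_abs_le_abs_sub (u (p z) - u (p 0)) (u (p t) - u (p 0))
      simpa using this
    · simpa using ((hasDerivAt_id t).const_mul C').hasDerivWithinAt
  have h1 : p 1 = y := by simp [hp]
  have h0 : p 0 = x := by simp [hp]
  rw [h1, h0] at key
  rw [Real.dist_eq, dist_eq_norm]
  exact le_of_forall_gt_imp_ge_of_dense key

variable {d : ℕ} {Ω : Set (EuclideanSpace ℝ (Fin d))}

theorem contDiff_eval_mvPolynomial (p : MvPolynomial (Fin d) ℝ) :
    ContDiff ℝ ∞ fun x : EuclideanSpace ℝ (Fin d) => MvPolynomial.eval (fun i => x i) p := by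
  induction p using MvPolynomial.induction_on with
  | C a => simpa using contDiff_const
  | add p q hp hq => simpa using hp.add hq
  | mul_X p i hp =>
    have h : ContDiff ℝ ∞ fun x : EuclideanSpace ℝ (Fin d) => x i := by fun_prop
    simpa using hp.mul h

namespace Mesh

variable {M : Mesh d Ω}

theorem extendZero_of_mem (f : C(closure Ω, ℝ)) {x : EuclideanSpace ℝ (Fin d)}
    (hx : x ∈ closure Ω) : extendZero f x = f ⟨x, hx⟩ := by
  rw [extendZero, dif_pos hx]

theorem extendZero_of_notMem (hreg : interior (closure Ω) = Ω) {f : C(closure Ω, ℝ)}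
    (h0 : ∀ x : closure Ω, x.1 ∈ frontier Ω → f x = 0) {x : EuclideanSpace ℝ (Fin d)}
    (hx : x ∉ Ω) : extendZero f x = 0 := by
  have hopen : IsOpen Ω := hreg ▸ isOpen_interior
  by_cases h : x ∈ closure Ω
  · rw [extendZero_of_mem f h]
    refine h0 _ ?_
    rw [hopen.frontier_eq]
    exact ⟨h, hx⟩
  · rw [extendZero, dif_neg h]

theorem continuous_extendZero (hreg : interior (closure Ω) = Ω) {f : C(closure Ω, ℝ)}
    (h0 : ∀ x : closure Ω, x.1 ∈ frontier Ω → f x = 0) : Continuous (extendZero f) := by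
  have hopen : IsOpen Ω := hreg ▸ isOpen_interior
  have h1 : ContinuousOn (extendZero f) (closure Ω) := by
    rw [continuousOn_iff_continuous_domRestrict]
    have : (closure Ω).domRestrict (extendZero f) = f := by
      funext x
      exact extendZero_of_mem f x.2
    rw [this]
    exact f.continuous
  have h2 : ContinuousOn (extendZero f) Ωᶜ :=
    continuousOn_const.congr fun x hx => extendZero_of_notMem hreg h0 hx
  have := h1.union_of_isClosed h2 isClosed_closure hopen.isClosed_compl
  have hcov : closure Ω ∪ Ωᶜ = Set.univ :=
    Set.eq_univ_of_forall fun x => (em (x ∈ Ω)).imp (fun h => subset_closure h) id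
  rw [hcov] at this
  exact continuousOn_univ.1 this

theorem compl_nonempty_of_mesh (M : Mesh d Ω) (hd : 1 ≤ d) : Ωᶜ.Nonempty := by
  have hb : Bornology.IsBounded Ω := M.isCompact_closure.isBounded.subset subset_closure
  have : Nontrivial (EuclideanSpace ℝ (Fin d)) := by
    have : Nonempty (Fin d) := ⟨⟨0, hd⟩⟩
    infer_instance
  by_contra h
  rw [Set.not_nonempty_iff_eq_empty, Set.compl_empty_iff] at h
  rw [h] at hb
  exact NormedSpace.unbounded_univ ℝ (EuclideanSpace ℝ (Fin d)) hb

theorem memH10_of_mem_S (hd : 1 ≤ d) (hreg : interior (closure Ω) = Ω) {k : ℕ}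
    {f : C(closure Ω, ℝ)} (hf : f ∈ M.S k)
    (h0 : ∀ x : closure Ω, x.1 ∈ frontier Ω → f x = 0) : MemH10 Ω (extendZero f) := by
  have hopen : IsOpen Ω := hreg ▸ isOpen_interior
  choose p _ hp using hf
  have heq : ∀ K : M.Cell, Set.EqOn (extendZero f) (fun x => MvPolynomial.eval (fun i => x i) (p K))
      K.carrier := fun K x hx => by
    rw [extendZero_of_mem f (K.carrier_subset hx)]
    exact hp K ⟨x, hx⟩
  have hLip : ∃ L : NNReal, LipschitzWith L (extendZero f) := by
    have h1 : ∀ K : M.Cell, ∃ L : NNReal, LipschitzOnWith L (extendZero f) K.carrier := by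
      intro K
      obtain ⟨L, hL⟩ := ((contDiff_eval_mvPolynomial (p K)).of_le
        (by norm_cast)).locallyLipschitz.locallyLipschitzOn.exists_lipschitzOnWith_of_compact
          K.isCompact_carrier
      refine ⟨L, fun x hx y hy => ?_⟩
      rw [heq K hx, heq K hy]
      exact hL hx hy
    choose L hL using h1
    have := Fintype.ofFinite M.Cell
    refine ⟨Finset.univ.sup L, lipschitzWith_of_lipschitzOnWith_cover
      (fun K : M.Cell => K.isClosed_carrier) (continuous_extendZero hreg h0) (fun x hx => ?_)
      fun K => (hL K).weaken (Finset.le_sup (Finset.mem_univ K))⟩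
    refine extendZero_of_notMem hreg h0 fun hxΩ => ?_
    obtain ⟨K, hK⟩ := exists_mem_carrier (M := M) (subset_closure hxΩ)
    exact hx K hK
  obtain ⟨L, hL⟩ := hLip
  refine memH10_of_lipschitzWith hopen (M.isCompact_closure.isBounded.subset subset_closure)
    (M.compl_nonempty_of_mesh hd) hL (fun x hx => extendZero_of_notMem hreg h0 hx) ?_
  -- Frontiers of convex sets are null, and off them `f` coincides locally with one polynomial,
  -- which gives strict differentiability almost everywhere.
  have hnull : volume (⋃ K : M.Cell, frontier K.carrier) = 0 :=
    measure_iUnion_null fun K => K.convex_carrier.addHaar_frontier volume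
  filter_upwards [ae_restrict_mem hopen.measurableSet,
    ae_restrict_of_ae (measure_eq_zero_iff_ae_notMem.1 hnull)] with x hx hxn
  obtain ⟨K, hK⟩ := exists_mem_carrier (M := M) (subset_closure hx)
  have hint : x ∈ interior K.carrier := by
    by_contra h
    exact hxn (Set.mem_iUnion.2 ⟨K, subset_closure hK, h⟩)
  have hev : (fun x => MvPolynomial.eval (fun i => x i) (p K)) =ᶠ[𝓝 x] extendZero f := by
    filter_upwards [mem_interior_iff_mem_nhds.1 hint] with y hy using (heq K hy).symm
  have hst := ((contDiff_eval_mvPolynomial (p K)).contDiffAt (x := x)).hasStrictFDerivAt (by simp)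
  have := hst.congr_of_eventuallyEq hev
  rwa [← this.hasFDerivAt.fderiv] at this

theorem mem_S0_iff (hd : 1 ≤ d) (hreg : interior (closure Ω) = Ω) {k : ℕ} {f : C(closure Ω, ℝ)} :
    f ∈ M.S0 k ↔ f ∈ M.S k ∧ ∀ x : closure Ω, x.1 ∈ frontier Ω → f x = 0 :=
  ⟨fun h => ⟨h.1, eq_zero_of_memH10 hreg f h.2⟩, fun h => ⟨h.1, memH10_of_mem_S hd hreg h.1 h.2⟩⟩

end Mesh

end CrouzeixRaviart

end

/-! ### Nonconforming functions: profile, vertex values and relations -/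

noncomputable section

namespace CrouzeixRaviart

/-- The single hypothesis covers both independence of `v'` (the combination `0` lies in any span)
and disjointness of the two spans. -/
theorem linearIndependent_sumElim {ι ι' V : Type*} [AddCommGroup V] [Module ℝ V] {v : ι → V}
    {v' : ι' → V} (hv : LinearIndependent ℝ v)
    (h : ∀ c : ι' →₀ ℝ, Finsupp.linearCombination ℝ v' c ∈ Submodule.span ℝ (Set.range v) →
      c = 0) : LinearIndependent ℝ (Sum.elim v v') := by
  refine hv.sum_type (linearIndependent_iff.2 fun c hc => h c (hc ▸ zero_mem _)) ?_
  rw [Submodule.disjoint_def]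
  intro x hx hx'
  obtain ⟨c, rfl⟩ := (Finsupp.mem_span_range_iff_exists_finsupp).1 hx'
  rw [h c (by rwa [Finsupp.linearCombination_apply])]
  simp

/-- The polynomial `P_k^{(0,d-2)}(1 - 2t)`. -/
def crProfile (d k : ℕ) : Polynomial ℝ :=
  (jacobi k 0 (d - 2)).comp (1 - Polynomial.C 2 * Polynomial.X)

theorem eval_crProfile (d k : ℕ) (t : ℝ) :
    (crProfile d k).eval t = (jacobi k 0 (d - 2)).eval (1 - 2 * t) := by
  simp [crProfile, Polynomial.eval_comp]

theorem natDegree_crProfile_le (d k : ℕ) : (crProfile d k).natDegree ≤ k := by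
  refine Polynomial.natDegree_comp_le.trans ?_
  have h : (1 - Polynomial.C 2 * Polynomial.X : Polynomial ℝ).natDegree ≤ 1 := by
    compute_degree
  exact (Nat.mul_le_mul (natDegree_jacobi_le _ _ _) h).trans (by simp)

theorem eval_crProfile_zero (d k : ℕ) : (crProfile d k).eval 0 = 1 := by
  rw [eval_crProfile, mul_zero, sub_zero, jacobi_eval_one]
  simp

theorem eval_crProfile_one (d k : ℕ) :
    (crProfile d k).eval 1 = (-1) ^ k * (k + (d - 2)).choose k := by
  rw [eval_crProfile, ← jacobi_eval_neg_one k 0 (d - 2)]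
  norm_num

/-- This separates the value at `1` from the value `1` at `0`. For even `k` and `d = 2` the two
values coincide, which is why the parities need different families. -/
theorem eval_crProfile_one_neg {d k : ℕ} (hk : Odd k) : (crProfile d k).eval 1 < 0 := by
  have : (0 : ℝ) < (k + (d - 2)).choose k := by exact_mod_cast Nat.choose_pos (by omega)
  rw [eval_crProfile_one, hk.neg_one_pow]
  linarith

theorem eval_crProfile_one_pos {d k : ℕ} (hk : Even k) : 0 < (crProfile d k).eval 1 := by
  have : (0 : ℝ) < (k + (d - 2)).choose k := by exact_mod_cast Nat.choose_pos (by omega)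
  rw [eval_crProfile_one, hk.neg_one_pow]
  linarith

variable {d : ℕ} {Ω : Set (EuclideanSpace ℝ (Fin d))}

namespace Mesh

variable {M : Mesh d Ω}

/-! ### The profile of a hat function -/

/-- `P_k^{(0,d-2)}(1 - 2 φ_z)` with the hat function `φ_z`. -/
def profileHat (M : Mesh d Ω) (k : ℕ) (z : EuclideanSpace ℝ (Fin d)) : C(closure Ω, ℝ) :=
  Polynomial.aeval (M.hat z) (crProfile d k)

theorem profileHat_apply (k : ℕ) (z : EuclideanSpace ℝ (Fin d)) (x : closure Ω) {K : M.Cell}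
    (hx : x.1 ∈ K.carrier) : M.profileHat k z x = (crProfile d k).eval (K.bary z x) := by
  have := Polynomial.aeval_algHom_apply (ContinuousMap.evalAlgHom ℝ ℝ x) (M.hat z) (crProfile d k)
  rw [Polynomial.coe_aeval_eq_eval] at this
  change _ = Polynomial.aeval (M.hat z) (crProfile d k) x at this
  rw [profileHat, ← this]
  congr 1
  exact hat_apply z x hx

theorem profileHat_mem_S (k : ℕ) (z : EuclideanSpace ℝ (Fin d)) : M.profileHat k z ∈ M.S k := by
  have h : M.profileHat k z = MvPolynomial.aeval M.hat
      (Polynomial.aeval (MvPolynomial.X z : MvPolynomial _ ℝ) (crProfile d k)) := by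
    rw [← Polynomial.aeval_algHom_apply, MvPolynomial.aeval_X, profileHat]
  rw [h]
  refine aeval_hat_mem_S _ ?_
  rw [Polynomial.aeval_eq_sum_range]
  refine MvPolynomial.totalDegree_finsetSum_le fun i hi => ?_
  refine (MvPolynomial.totalDegree_smul_le _ _).trans ?_
  rw [MvPolynomial.totalDegree_X_pow]
  have := Finset.mem_range.1 hi
  have := natDegree_crProfile_le d k
  omega

theorem one_mem_S (k : ℕ) : (1 : C(closure Ω, ℝ)) ∈ M.S k := by
  have := aeval_hat_mem_S (M := M) (k := k) (1 : MvPolynomial _ ℝ) (by simp)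
  rwa [map_one] at this

theorem Cell.crValue_eq (K : M.Cell) (k : ℕ) (x : EuclideanSpace ℝ (Fin d)) :
    K.crValue k x = 1 / (d : ℝ) * (-1 + ∑ z ∈ K.1, (crProfile d k).eval (K.bary z x)) := by
  simp only [crValue, eval_crProfile]

theorem Cell.sum_eval_crProfile_vertex (K : M.Cell) (k : ℕ) {y : EuclideanSpace ℝ (Fin d)}
    (hy : y ∈ K.1) (c : EuclideanSpace ℝ (Fin d) → ℝ) :
    ∑ z ∈ K.1, c z * (crProfile d k).eval (K.bary z y) =
      ∑ z ∈ K.1, c z + c y * ((crProfile d k).eval 1 - 1) := by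
  classical
  have h : ∀ z, c z * (crProfile d k).eval (K.bary z y) =
      c z + if z = y then c y * ((crProfile d k).eval 1 - 1) else 0 := by
    intro z
    rw [K.bary_vertex hy]
    split_ifs with h
    · rw [h]; ring
    · rw [eval_crProfile_zero]; ring
  simp only [h, Finset.sum_add_distrib, Finset.sum_ite_eq', hy, if_true]

theorem Cell.crValue_vertex (K : M.Cell) (hd : 1 ≤ d) (k : ℕ) {y : EuclideanSpace ℝ (Fin d)}
    (hy : y ∈ K.1) : K.crValue k y = ((crProfile d k).eval 1 + d - 1) / d := by
  have h := K.sum_eval_crProfile_vertex k hy fun _ => 1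
  simp only [one_mul, Finset.sum_const, nsmul_eq_mul, mul_one] at h
  rw [K.2.2] at h
  rw [K.crValue_eq, h]
  have : (d : ℝ) ≠ 0 := by positivity
  field_simp
  push_cast
  ring

theorem vertex_mem_carrier {K : M.Cell} {y : EuclideanSpace ℝ (Fin d)} (hy : y ∈ K.1) :
    y ∈ K.carrier :=
  subset_convexHull ℝ _ hy

/-- The mesh vertices. -/
def vertexFinset (M : Mesh d Ω) : Finset (EuclideanSpace ℝ (Fin d)) := by
  classical
  exact M.finite_faces.toFinset.biUnion id

theorem mem_vertexFinset_of_mem_cell {K : M.Cell} {z : EuclideanSpace ℝ (Fin d)} (hz : z ∈ K.1) :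
    z ∈ M.vertexFinset := by
  classical
  simp only [vertexFinset, Finset.mem_biUnion, Set.Finite.mem_toFinset, id]
  exact ⟨K.1, K.2.1, hz⟩

/-- On each element only its own simplex function is active, and vertices of other elements can be
added to its vertex sum because the profile equals `1` at `0`. This is the relation that makes one
simplex function redundant. -/
theorem sum_crCell [Fintype M.Cell] (hd : 1 ≤ d) (k : ℕ) :
    ∑ K, M.crCell k K = M.restrict (1 + (1 / (d : ℝ)) • ∑ z ∈ M.vertexFinset,
      (M.profileHat k z - 1)) := by
  classical
  funext L x
  have h1 : (∑ K, M.crCell k K) L x = L.crValue k x := by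
    rw [Finset.sum_apply, Finset.sum_apply, Finset.sum_eq_single L]
    · simp [crCell]
    · intro K _ hK
      simp [crCell, hK.symm]
    · simp
  have h2 : ∑ z ∈ M.vertexFinset, ((crProfile d k).eval (L.bary z x) - 1) =
      ∑ z ∈ L.1, ((crProfile d k).eval (L.bary z x) - 1) := by
    symm
    refine Finset.sum_subset (fun z hz => mem_vertexFinset_of_mem_cell hz) fun z _ hz => ?_
    rw [L.bary_of_notMem hz, eval_crProfile_zero, sub_self]
  have h3 : ∀ z, M.profileHat k z ⟨x.1, L.carrier_subset x.2⟩ =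
      (crProfile d k).eval (L.bary z x) := fun z => profileHat_apply k z _ x.2
  rw [h1]
  change _ = (1 + (1 / (d : ℝ)) • ∑ z ∈ M.vertexFinset, (M.profileHat k z - 1) :
    C(closure Ω, ℝ)) ⟨x.1, L.carrier_subset x.2⟩
  simp only [ContinuousMap.add_apply, ContinuousMap.smul_apply, ContinuousMap.sum_apply,
    ContinuousMap.sub_apply, ContinuousMap.one_apply, h3, h2, smul_eq_mul]
  rw [L.crValue_eq, Finset.sum_sub_distrib, Finset.sum_const, L.2.2, nsmul_eq_mul]
  have : (d : ℝ) ≠ 0 := by positivity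
  field_simp
  push_cast
  ring

theorem crFacet_erase [DecidableEq (EuclideanSpace ℝ (Fin d))] (k : ℕ) (K : M.Cell)
    {y : EuclideanSpace ℝ (Fin d)} (hy : y ∈ K.1) (x : K.carrier) :
    M.crFacet k (K.1.erase y) K x = (crProfile d k).eval (K.bary y x) - K.crValue k x := by
  rw [crFacet, if_pos (Finset.erase_subset _ _), eval_crProfile]
  congr 4
  rw [← Finset.sum_singleton (fun z => K.bary z x.1) y]
  refine Finset.sum_congr ?_ fun _ _ => rfl
  ext z
  simp only [Finset.mem_sdiff, Finset.mem_erase, Finset.mem_singleton]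
  constructor
  · rintro ⟨h1, h2⟩
    by_contra h
    exact h2 ⟨h, h1⟩
  · rintro rfl
    exact ⟨hy, fun h => h.1 rfl⟩

/-- On `K` only the facets of `K` count, and these are indexed by the opposite vertices `y` through
`K.1.erase y`. -/
theorem sum_crFacet [DecidableEq (EuclideanSpace ℝ (Fin d))] (k : ℕ)
    (T : Finset (Finset (EuclideanSpace ℝ (Fin d)))) (hT : ∀ F ∈ T, F.card = d)
    (c : Finset (EuclideanSpace ℝ (Fin d)) → ℝ) (K : M.Cell) (x : K.carrier) :
    ∑ F ∈ T, c F * M.crFacet k F K x = ∑ y ∈ K.1, (if K.1.erase y ∈ T then c (K.1.erase y) else 0) *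
      ((crProfile d k).eval (K.bary y x) - K.crValue k x) := by
  have h1 : ∑ y ∈ K.1, (if K.1.erase y ∈ T then c (K.1.erase y) else 0) *
      ((crProfile d k).eval (K.bary y x) - K.crValue k x) =
      ∑ F ∈ K.1.image K.1.erase, (if F ∈ T then c F else 0) * M.crFacet k F K x := by
    rw [Finset.sum_image K.1.erase_injOn]
    exact Finset.sum_congr rfl fun y hy => by rw [crFacet_erase k K hy]
  rw [h1]
  have h2 : ∑ F ∈ T, c F * M.crFacet k F K x =
      ∑ F ∈ T ∪ K.1.image K.1.erase, (if F ∈ T then c F else 0) * M.crFacet k F K x := by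
    rw [← Finset.sum_subset Finset.subset_union_left]
    · exact Finset.sum_congr rfl fun F hF => by rw [if_pos hF]
    · intro F _ hF
      rw [if_neg hF, zero_mul]
  rw [h2]
  symm
  refine Finset.sum_subset Finset.subset_union_right fun F hF hF' => ?_
  have hFT : F ∈ T := (Finset.mem_union.1 hF).resolve_right hF'
  have hFK : ¬ F ⊆ K.1 := by
    intro hsub
    refine hF' ?_
    have hlt : F.card < K.1.card := by rw [hT F hFT, K.2.2]; omega
    obtain ⟨y, hy, hyF⟩ := Finset.exists_mem_notMem_of_card_lt_card hlt
    refine Finset.mem_image.2 ⟨y, hy, ?_⟩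
    refine (Finset.eq_of_subset_of_card_le (fun z hz => Finset.mem_erase.2
      ⟨fun (h : z = y) => hyF (h ▸ hz), hsub hz⟩) ?_).symm
    rw [Finset.card_erase_of_mem hy, K.2.2, hT F hFT]
    omega
  rw [crFacet, if_neg hFK, mul_zero]

/-- On an element containing `z` there are `d` such facets, one opposite to each other vertex. The
`d` copies of the simplex function cancel all profiles except that of `z` and leave the constant
`1`. -/
theorem sum_crFacet_vertex (hd : 2 ≤ d) (k : ℕ) {z : EuclideanSpace ℝ (Fin d)}
    (T : Finset (Finset (EuclideanSpace ℝ (Fin d))))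
    (hT : ∀ F, F ∈ T ↔ F ∈ M.faces ∧ F.card = d ∧ z ∈ F) :
    ∑ F ∈ T, M.crFacet k F = M.restrict (1 - M.profileHat k z) := by
  classical
  funext K x
  have h := sum_crFacet k T (fun F hF => ((hT F).1 hF).2.1) (fun _ => 1) K x
  simp only [one_mul] at h
  rw [Finset.sum_apply, Finset.sum_apply, h]
  change _ = (1 - M.profileHat k z : C(closure Ω, ℝ)) ⟨x.1, K.carrier_subset x.2⟩
  rw [ContinuousMap.sub_apply, ContinuousMap.one_apply, profileHat_apply k z _ x.2]
  have hmem : ∀ y ∈ K.1, K.1.erase y ∈ T ↔ z ∈ K.1 ∧ y ≠ z := by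
    intro y hy
    rw [hT, Finset.mem_erase, Finset.card_erase_of_mem hy, K.2.2]
    constructor
    · rintro ⟨_, _, h1, h2⟩
      exact ⟨h2, h1.symm⟩
    · rintro ⟨h1, h2⟩
      exact ⟨mem_faces_of_subset_cell (Finset.erase_subset _ _)
        ⟨z, Finset.mem_erase.2 ⟨h2.symm, h1⟩⟩, by omega, h2.symm, h1⟩
  by_cases hz : z ∈ K.1
  · have h1 : ∑ y ∈ K.1, (if K.1.erase y ∈ T then (1 : ℝ) else 0) *
        ((crProfile d k).eval (K.bary y x) - K.crValue k x) =
        ∑ y ∈ K.1.erase z, ((crProfile d k).eval (K.bary y x) - K.crValue k x) := by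
      rw [← Finset.add_sum_erase _ _ hz, if_neg (by rw [hmem z hz]; simp), zero_mul, zero_add]
      refine Finset.sum_congr rfl fun y hy => ?_
      obtain ⟨h1, h2⟩ := Finset.mem_erase.1 hy
      rw [if_pos ((hmem y h2).2 ⟨hz, h1⟩), one_mul]
    rw [h1, Finset.sum_sub_distrib, Finset.sum_const, Finset.card_erase_of_mem hz, K.2.2,
      Finset.sum_erase_eq_sub hz, K.crValue_eq, nsmul_eq_mul, Nat.add_sub_cancel]
    have : (d : ℝ) ≠ 0 := by positivity
    field_simp
    ring
  · rw [K.bary_of_notMem hz, eval_crProfile_zero, sub_self]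
    refine Finset.sum_eq_zero fun y hy => ?_
    rw [if_neg (by rw [hmem y hy]; exact fun h => hz h.1), zero_mul]

/-! ### Linear independence -/

/-- The nonconforming part of the family vanishes if it is conforming and zero at all vertices. -/
theorem eq_zero_of_sum_crFacet_vertex_eq_zero (hd : 2 ≤ d) {k : ℕ} (hk : Odd k)
    (c : Finset (EuclideanSpace ℝ (Fin d)) →₀ ℝ) (hc : ∀ F ∈ c.support, F ∈ M.faces ∧ F.card = d)
    (h0 : ∀ (K : M.Cell) (z : EuclideanSpace ℝ (Fin d)) (hz : z ∈ K.1),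
      c.sum (fun F r => r * M.crFacet k F K ⟨z, vertex_mem_carrier hz⟩) = 0) : c = 0 := by
  classical
  ext F
  by_contra hF
  obtain ⟨hFf, hFc⟩ := hc F (Finsupp.mem_support_iff.2 hF)
  obtain ⟨K, hFK⟩ := exists_cell_superset hFf
  set a := (crProfile d k).eval 1 with ha
  have ha1 : a - 1 ≠ 0 := by
    have := eval_crProfile_one_neg (d := d) hk
    intro h
    linarith
  have hd0 : (d : ℝ) ≠ 0 := by positivity
  set s := ∑ y ∈ K.1, c (K.1.erase y) with hs
  -- Evaluation at `z` gives `(c_z - s / d) (a - 1) = 0`, where `c_z` belongs to the facet opposite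
  -- to `z`. Summing over the `d + 1` vertices then yields `s = (d + 1) s / d`, so `s = 0`.
  have hz : ∀ z ∈ K.1, c (K.1.erase z) = s / d := by
    intro z hz
    have h1 := h0 K z hz
    rw [Finsupp.sum, sum_crFacet k c.support (fun F hF => (hc F hF).2)] at h1
    have h2 : ∀ y, (if K.1.erase y ∈ c.support then c (K.1.erase y) else 0) = c (K.1.erase y) := by
      intro y
      split_ifs with h
      · rfl
      · exact (Finsupp.notMem_support_iff.1 h).symm
    simp only [h2, mul_sub, Finset.sum_sub_distrib, ← Finset.sum_mul] at h1
    rw [K.sum_eval_crProfile_vertex k hz fun y => c (K.1.erase y), K.crValue_vertex (by omega) k hz,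
      ← hs, ← ha] at h1
    have h3 : (c (K.1.erase z) - s / d) * (a - 1) = 0 := by
      rw [← h1]
      field_simp
      ring
    exact sub_eq_zero.1 ((mul_eq_zero.1 h3).resolve_right ha1)
  have hs0 : s = 0 := by
    have h1 : s = (d + 1) * (s / d) := by
      conv_lhs => rw [hs, Finset.sum_congr rfl hz]
      rw [Finset.sum_const, K.2.2, nsmul_eq_mul]
      push_cast
      ring
    field_simp at h1
    linarith
  have hlt : F.card < K.1.card := by rw [hFc, K.2.2]; omega
  obtain ⟨y, hy, hyF⟩ := Finset.exists_mem_notMem_of_card_lt_card hlt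
  have hFe : F = K.1.erase y := by
    refine Finset.eq_of_subset_of_card_le (fun z hz => Finset.mem_erase.2
      ⟨fun h => hyF (h ▸ hz), hFK hz⟩) ?_
    rw [Finset.card_erase_of_mem hy, K.2.2, hFc]
    omega
  refine hF ?_
  rw [hFe, hz y hy, hs0, zero_div]
  rfl

theorem sum_smul_crCell_apply (k : ℕ) (c : M.Cell →₀ ℝ) (L : M.Cell) (x : L.carrier) :
    (Finsupp.linearCombination ℝ (M.crCell k) c) L x = c L * L.crValue k x := by
  classical
  rw [Finsupp.linearCombination_apply, Finsupp.sum, Finset.sum_apply, Finset.sum_apply,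
    Finset.sum_eq_single L]
  · simp [crCell]
  · intro K _ hK
    simp [crCell, hK.symm]
  · intro h
    simp [Finsupp.notMem_support_iff.1 h]

theorem Cell.crValue_vertex_pos (K : M.Cell) (hd : 1 ≤ d) {k : ℕ} (hk : Even k)
    {y : EuclideanSpace ℝ (Fin d)} (hy : y ∈ K.1) : 0 < K.crValue k y := by
  rw [K.crValue_vertex hd k hy]
  have h1 := eval_crProfile_one_pos (d := d) hk
  have h2 : (1 : ℝ) ≤ d := by exact_mod_cast hd
  exact div_pos (by linarith) (by linarith)

/-- If a combination of the simplex functions is conforming, then all coefficients agree. -/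
theorem eq_of_linearCombination_crCell_eq_restrict (hd : 1 ≤ d) (hconn : IsConnected Ω) {k : ℕ}
    (hk : Even k) (c : M.Cell →₀ ℝ) (f : C(closure Ω, ℝ))
    (hf : Finsupp.linearCombination ℝ (M.crCell k) c = M.restrict f) (K L : M.Cell) :
    c K = c L := by
  have hval : ∀ (K : M.Cell) (z : EuclideanSpace ℝ (Fin d)) (hz : z ∈ K.1),
      c K * K.crValue k z = f ⟨z, K.carrier_subset (vertex_mem_carrier hz)⟩ := by
    intro K z hz
    have := congrFun (congrFun hf K) ⟨z, vertex_mem_carrier hz⟩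
    rwa [sum_smul_crCell_apply] at this
  have hshare : ∀ (K L : M.Cell) (x : EuclideanSpace ℝ (Fin d)), x ∈ K.carrier → x ∈ L.carrier →
      c K = c L := by
    intro K L x hK hL
    obtain ⟨z, hzK, hzL⟩ := Cell.exists_vertex_mem_of_mem hK hL
    have h1 := hval K z hzK
    rw [← hval L z hzL, K.crValue_vertex hd k hzK, ← L.crValue_vertex hd k hzL] at h1
    exact mul_right_cancel₀ (L.crValue_vertex_pos hd hk hzL).ne' h1
  by_contra hne
  -- The elements with coefficient `c K` and the remaining ones form two closed sets covering the
  -- connected set `closure Ω`; they must meet, but touching elements have equal coefficients.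
  have hpre := isPreconnected_closed_iff.1 hconn.closure.isPreconnected
    (⋃ J : {J : M.Cell // c J = c K}, J.1.carrier) (⋃ J : {J : M.Cell // c J ≠ c K}, J.1.carrier)
    (isClosed_iUnion_of_finite fun J => J.1.isClosed_carrier)
    (isClosed_iUnion_of_finite fun J => J.1.isClosed_carrier) (fun x hx => ?_) ?_ ?_
  · obtain ⟨x, _, hx1, hx2⟩ := hpre
    obtain ⟨J, hJ⟩ := Set.mem_iUnion.1 hx1
    obtain ⟨J', hJ'⟩ := Set.mem_iUnion.1 hx2
    exact J'.2 ((hshare _ _ x hJ' hJ).trans J.2)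
  · obtain ⟨J, hJ⟩ := exists_mem_carrier (M := M) hx
    by_cases h : c J = c K
    · exact Or.inl (Set.mem_iUnion.2 ⟨⟨J, h⟩, hJ⟩)
    · exact Or.inr (Set.mem_iUnion.2 ⟨⟨J, h⟩, hJ⟩)
  · obtain ⟨z, hz⟩ := M.nonempty_of_mem_faces K.2.1
    exact ⟨z, K.carrier_subset (vertex_mem_carrier hz),
      Set.mem_iUnion.2 ⟨⟨K, rfl⟩, vertex_mem_carrier hz⟩⟩
  · obtain ⟨z, hz⟩ := M.nonempty_of_mem_faces L.2.1
    exact ⟨z, L.carrier_subset (vertex_mem_carrier hz),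
      Set.mem_iUnion.2 ⟨⟨L, fun h => hne h.symm⟩, vertex_mem_carrier hz⟩⟩

/-- The face carrying a frontier point in its relative interior lies in the frontier: were it inner,
one of its coordinates would vanish at that point. -/
theorem exists_vertex_mem_frontier (hd : 1 ≤ d) (hconn : IsConnected Ω)
    (hreg : interior (closure Ω) = Ω) : ∃ (K : M.Cell) (z : EuclideanSpace ℝ (Fin d)),
      z ∈ K.1 ∧ z ∈ frontier Ω := by
  obtain ⟨x, hx⟩ : (frontier Ω).Nonempty := by
    rw [nonempty_frontier_iff]
    refine ⟨hconn.nonempty, fun h => ?_⟩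
    obtain ⟨y, hy⟩ := M.compl_nonempty_of_mesh hd
    exact hy (h ▸ Set.mem_univ y)
  obtain ⟨K, hK⟩ := exists_mem_carrier (M := M) (frontier_subset_closure hx)
  obtain ⟨σ, hσ, hσK, _, hpos⟩ := K.exists_face_bary_pos hK
  have hsub : convexHull ℝ (σ : Set (EuclideanSpace ℝ (Fin d))) ⊆ frontier Ω := by
    by_contra h
    obtain ⟨z, hz, hz0⟩ := exists_bary_eq_zero_of_mem_frontier hreg ⟨hσ, h⟩ hK hx
    exact ((hpos z).1 hz).ne' hz0
  obtain ⟨z, hz⟩ := M.nonempty_of_mem_faces hσ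
  exact ⟨K, z, hσK hz, hsub (subset_convexHull ℝ _ hz)⟩

/-! ### The bases -/

theorem card_face_le {τ : Finset (EuclideanSpace ℝ (Fin d))} (hτ : τ ∈ M.faces) :
    τ.card ≤ d + 1 := by
  obtain ⟨K, hK⟩ := exists_cell_superset hτ
  exact (Finset.card_le_card hK).trans K.2.2.le

/-- Vertex counts replace dimensions, and the bound by `d` is automatic for faces of the mesh. -/
theorem confIndex_eq {k : ℕ} (hk : 1 ≤ k) {𝒮 : Set (Finset (EuclideanSpace ℝ (Fin d)))}
    (h𝒮 : 𝒮 ⊆ M.faces) : M.confIndex k 𝒮 = {i | i.1 ∈ {τ ∈ 𝒮 | Odd k → 2 ≤ τ.card} ∧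
      i.1.card ≤ k ∧ ∑ j, i.2 j ≤ k - i.1.card} := by
  ext ⟨τ, α⟩
  simp only [confIndex, Set.mem_ofPred_eq, and_assoc]
  refine and_congr_right fun hτ => ?_
  have h1 := dim_add_one (h𝒮 hτ)
  have h2 := card_face_le (h𝒮 hτ)
  rw [h1]
  refine and_congr (imp_congr_right fun _ => by omega) (and_congr_left fun _ => ?_)
  rw [le_min_iff]
  omega

/-- A set of faces and the corresponding space of conforming functions: either all faces and
`S_k(𝒯)`, or the inner faces and `S_{k,0}(𝒯)`. -/
structure IsConformingPair (M : Mesh d Ω) (k : ℕ)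
    (𝒮 : Set (Finset (EuclideanSpace ℝ (Fin d)))) (W : Submodule ℝ C(closure Ω, ℝ)) : Prop where
  subset : 𝒮 ⊆ M.faces
  up : ∀ σ ∈ 𝒮, ∀ τ ∈ M.faces, σ ⊆ τ → τ ∈ 𝒮
  le : W ≤ M.S k
  zero : ∀ f ∈ W, ∀ τ ∈ M.faces, τ ∉ 𝒮 → ∀ x : closure Ω,
    x.1 ∈ convexHull ℝ (τ : Set (EuclideanSpace ℝ (Fin d))) → f x = 0
  mem : ∀ (A : M.Numbering), ∀ i ∈ M.confIndex k 𝒮, confFun A i ∈ W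

theorem confFun_mem_S_of_mem_confIndex (A : M.Numbering) {k : ℕ} (hk : 1 ≤ k)
    {𝒮 : Set (Finset (EuclideanSpace ℝ (Fin d)))} (h𝒮 : 𝒮 ⊆ M.faces) {i}
    (hi : i ∈ M.confIndex k 𝒮) : confFun A i ∈ M.S k := by
  rw [confIndex_eq hk h𝒮] at hi
  obtain ⟨_, h1, h2⟩ := hi
  exact confFun_mem_S A i (by omega)

theorem isConformingPair_allFaces (M : Mesh d Ω) {k : ℕ} (hk : 1 ≤ k) :
    M.IsConformingPair k M.allFaces (M.S k) where
  subset := subset_rfl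
  up _ _ _ hτ _ := hτ
  le := le_rfl
  zero _ _ _ hτ hτ' := absurd hτ hτ'
  mem A _ hi := confFun_mem_S_of_mem_confIndex A hk subset_rfl hi

theorem isConformingPair_innerFaces (M : Mesh d Ω) (hd : 1 ≤ d) (hreg : interior (closure Ω) = Ω)
    {k : ℕ} (hk : 1 ≤ k) : M.IsConformingPair k M.innerFaces (M.S0 k) where
  subset := fun _ h => h.1
  up _ hσ _ hτ h := mem_innerFaces_of_subset hσ hτ h
  le := fun _ hf => hf.1
  zero f hf τ hτ hτ' x hx := by
    refine ((mem_S0_iff hd hreg).1 hf).2 x ?_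
    by_contra h
    exact hτ' ⟨hτ, fun hsub => h (hsub hx)⟩
  mem A i hi := (mem_S0_iff hd hreg).2 ⟨confFun_mem_S_of_mem_confIndex A hk (fun _ h => h.1) hi,
    fun x hx => confFun_eq_zero_of_mem_frontier hreg A i hi.1 x hx⟩

theorem linearIndependent_confBasis (A : M.Numbering) (k : ℕ)
    {𝒮 : Set (Finset (EuclideanSpace ℝ (Fin d)))} (h𝒮 : 𝒮 ⊆ M.faces) :
    LinearIndependent ℝ fun i : M.confIndex k 𝒮 => M.confBasis A i.1 := by
  have h1 : LinearIndependent ℝ fun i : M.confIndex k 𝒮 => confFun A i.1 :=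
    (linearIndepOn_confFun A).mono fun i hi => h𝒮 hi.1
  have h2 := h1.map' M.restrict (LinearMap.ker_eq_bot.2 restrict_injective)
  simpa only [Function.comp_def, restrict_confFun] using h2

theorem span_confBasis (A : M.Numbering) (k : ℕ)
    (𝒮 : Set (Finset (EuclideanSpace ℝ (Fin d)))) :
    Submodule.span ℝ (Set.range fun i : M.confIndex k 𝒮 => M.confBasis A i.1) =
      (Submodule.span ℝ (confFun A '' M.confIndex k 𝒮)).map M.restrict := by
  rw [Submodule.map_span, ← Set.image_comp, Set.image_eq_range]
  simp only [Function.comp_def, restrict_confFun]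

theorem profileHat_eq_one_of_notMem {τ : Finset (EuclideanSpace ℝ (Fin d))} (hτ : τ ∈ M.faces)
    {z : EuclideanSpace ℝ (Fin d)} (hz : z ∉ τ) (k : ℕ) (x : closure Ω)
    (hx : x.1 ∈ convexHull ℝ (τ : Set (EuclideanSpace ℝ (Fin d)))) : M.profileHat k z x = 1 := by
  obtain ⟨K, hK⟩ := exists_cell_superset hτ
  obtain ⟨h1, h2⟩ := (K.mem_convexHull_iff hK x.1).1 hx
  rw [profileHat_apply k z x h1, h2 z hz, eval_crProfile_zero]

/-- For odd `k`, conforming functions are combinations of the bubbles of the faces of positive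
dimension and of the functions `1 - P_k^{(0,d-2)}(1 - 2 φ_z)`. -/
theorem mem_span_confFun_sup_span_profileHat (A : M.Numbering) {k : ℕ} (hk : Odd k)
    {𝒮 : Set (Finset (EuclideanSpace ℝ (Fin d)))} {W : Submodule ℝ C(closure Ω, ℝ)}
    (h : M.IsConformingPair k 𝒮 W) {f : C(closure Ω, ℝ)} (hf : f ∈ W) :
    f ∈ Submodule.span ℝ (confFun A '' M.confIndex k 𝒮) ⊔
      Submodule.span ℝ ((fun z => 1 - M.profileHat k z) '' {z | {z} ∈ 𝒮}) := by
  classical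
  have hk1 : 1 ≤ k := hk.pos
  set a := (crProfile d k).eval 1 with ha
  have ha1 : 1 - a ≠ 0 := by
    have := eval_crProfile_one_neg (d := d) hk
    intro h
    linarith
  -- The coefficients make `g` interpolate `f` at the vertices in `𝒮`, where `1 - profileHat` has
  -- the value `1 - a`.
  set c : EuclideanSpace ℝ (Fin d) → ℝ := fun z =>
    if hz : z ∈ closure Ω then f ⟨z, hz⟩ / (1 - a) else 0 with hc
  set Z := M.vertexFinset.filter fun z => {z} ∈ 𝒮 with hZ
  set g : C(closure Ω, ℝ) := ∑ z ∈ Z, c z • (1 - M.profileHat k z) with hg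
  have hgmem : g ∈ Submodule.span ℝ ((fun z => 1 - M.profileHat k z) '' {z | {z} ∈ 𝒮}) :=
    sum_mem fun z hz => Submodule.smul_mem _ _ (Submodule.subset_span
      ⟨z, (Finset.mem_filter.1 hz).2, rfl⟩)
  have hgS : g ∈ M.S k :=
    sum_mem fun z _ => Submodule.smul_mem _ _ (sub_mem (one_mem_S k) (profileHat_mem_S k z))
  have hgx : ∀ x, g x = ∑ z ∈ Z, c z * (1 - M.profileHat k z x) := by
    intro x
    simp [hg, ContinuousMap.sum_apply]
  have hfg : f - g ∈ Submodule.span ℝ (confFun A '' M.confIndex k 𝒮) := by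
    rw [confIndex_eq hk1 h.subset]
    refine mem_span_confFun A hk1 (𝒰 := {τ | τ ∈ 𝒮 ∧ (Odd k → 2 ≤ τ.card)})
      (fun σ hσ τ hτ hsub => ⟨h.up σ hσ.1 τ hτ hsub, fun hk =>
      (hσ.2 hk).trans (Finset.card_le_card hsub)⟩) (sub_mem (h.le hf) hgS) fun τ hτ hτU x hx => ?_
    rw [ContinuousMap.sub_apply, hgx]
    by_cases hτS : τ ∈ 𝒮
    · have hcard : τ.card = 1 := by
        have h1 : ¬ 2 ≤ τ.card := fun h2 => hτU ⟨hτS, fun _ => h2⟩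
        have := Finset.card_pos.2 (M.nonempty_of_mem_faces hτ)
        omega
      obtain ⟨y, rfl⟩ := Finset.card_eq_one.1 hcard
      obtain ⟨K, hK⟩ := exists_cell_superset hτ
      rw [Finset.singleton_subset_iff] at hK
      have hxy : x.1 = y := by simpa using hx
      have hyZ : y ∈ Z := Finset.mem_filter.2 ⟨mem_vertexFinset_of_mem_cell hK, hτS⟩
      have hya : M.profileHat k y x = a := by
        rw [profileHat_apply k y x (hxy ▸ vertex_mem_carrier hK), hxy, K.bary_vertex hK, if_pos rfl]
      rw [Finset.sum_eq_single y, hya]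
      · have : c y = f x / (1 - a) := by
          have hyΩ : y ∈ closure Ω := hxy ▸ x.2
          rw [hc]
          simp only [dif_pos hyΩ]
          congr 2
          exact Subtype.ext hxy.symm
        rw [this, div_mul_cancel₀ _ ha1, sub_self]
      · intro z _ hzy
        rw [profileHat_eq_one_of_notMem hτ (by simpa using hzy) k x hx, sub_self, mul_zero]
      · exact fun h => absurd hyZ h
    · rw [h.zero f hf τ hτ hτS x hx, zero_sub, neg_eq_zero]
      refine Finset.sum_eq_zero fun z hz => ?_
      rw [profileHat_eq_one_of_notMem hτ (fun hzτ => hτS ?_) k x hx, sub_self, mul_zero]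
      exact h.up _ (Finset.mem_filter.1 hz).2 τ hτ (Finset.singleton_subset_iff.2 hzτ)
  rw [← sub_add_cancel f g]
  exact add_mem (Submodule.mem_sup_left hfg) (Submodule.mem_sup_right hgmem)

/-- Bubbles of faces of positive dimension vanish at vertices, so a facet combination in their span
vanishes at all vertices and is trivial. For spanning, the functions `1 - p(φ_z)` are sums of facet
functions. -/
theorem isBasisOf_familyFacet (hd : 2 ≤ d) (A : M.Numbering) {k : ℕ} (hk : Odd k)
    {𝒮 : Set (Finset (EuclideanSpace ℝ (Fin d)))} {W : Submodule ℝ C(closure Ω, ℝ)}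
    (h : M.IsConformingPair k 𝒮 W) :
    IsBasisOf (M.familyFacet k A 𝒮)
      (W.map M.restrict ⊔ Submodule.span ℝ (M.crFacet k '' M.facetsIn 𝒮)) := by
  classical
  have hk1 : 1 ≤ k := hk.pos
  constructor
  · refine linearIndependent_sumElim (linearIndependent_confBasis A k h.subset) fun c hc => ?_
    rw [span_confBasis] at hc
    obtain ⟨g, hg, hgc⟩ := hc
    have hg0 : ∀ (z : EuclideanSpace ℝ (Fin d)), {z} ∈ M.faces → ∀ x : closure Ω, x.1 = z →
        g x = 0 := by
      intro z hz x hx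
      clear hgc
      induction hg using Submodule.span_induction with
      | mem g hg =>
        obtain ⟨i, hi, rfl⟩ := hg
        rw [confIndex_eq hk1 h.subset] at hi
        refine confFun_eq_zero A i hz (fun hsub => ?_) x (by simp [hx])
        have h1 := Finset.card_le_card hsub
        have h2 := hi.1.2 hk
        rw [Finset.card_singleton] at h1
        omega
      | zero => rfl
      | add g h _ _ hg hh => rw [ContinuousMap.add_apply, hg, hh, add_zero]
      | smul c g _ hg => rw [ContinuousMap.smul_apply, hg, smul_zero]
    -- Coefficients on facets in `𝒮` are extended by zero to all finite vertex sets.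
    have hmap : c.mapDomain Subtype.val = 0 := by
      refine eq_zero_of_sum_crFacet_vertex_eq_zero (M := M) hd hk _ (fun F hF => ?_)
        fun K z hz => ?_
      · obtain ⟨F', _, rfl⟩ := Finset.mem_image.1 (Finsupp.mapDomain_support hF)
        exact ⟨h.subset F'.2.1, F'.2.2⟩
      · rw [Finsupp.sum_mapDomain_index (by simp) (by intros; ring)]
        have h1 := congrFun (congrFun hgc K) ⟨z, vertex_mem_carrier hz⟩
        have h2 : M.restrict g K ⟨z, vertex_mem_carrier hz⟩ = 0 :=
          hg0 z (mem_faces_of_subset_cell (Finset.singleton_subset_iff.2 hz) (by simp)) _ rfl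
        rw [h2, Finsupp.linearCombination_apply, Finsupp.sum, Finset.sum_apply,
          Finset.sum_apply] at h1
        exact h1.symm
    exact Finsupp.mapDomain_injective Subtype.val_injective (hmap.trans Finsupp.mapDomain_zero.symm)
  · have hrange : Set.range (M.familyFacet k A 𝒮) =
        (Set.range fun i : M.confIndex k 𝒮 => M.confBasis A i.1) ∪ M.crFacet k '' M.facetsIn 𝒮 := by
      rw [familyFacet, Set.Sum.elim_range, Set.image_eq_range]
    rw [hrange, Submodule.span_union, span_confBasis]
    refine le_antisymm (sup_le_sup_right (Submodule.map_mono (Submodule.span_le.2 ?_)) _)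
      (sup_le ?_ le_sup_right)
    · rintro _ ⟨i, hi, rfl⟩
      exact h.mem A i hi
    · rintro _ ⟨f, hf, rfl⟩
      have hmem := Submodule.mem_map_of_mem (f := M.restrict)
        (mem_span_confFun_sup_span_profileHat A hk h hf)
      rw [Submodule.map_sup] at hmem
      refine SetLike.le_def.1 (sup_le_sup le_rfl ?_) hmem
      rw [Submodule.map_span, Submodule.span_le]
      rintro _ ⟨_, ⟨z, hz, rfl⟩, rfl⟩
      -- All facets through `z` are in `𝒮` because `𝒮` is closed under passing to larger faces.
      set T := M.finite_faces.toFinset.filter fun F => F.card = d ∧ z ∈ F with hT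
      have := sum_crFacet_vertex (M := M) hd k (z := z) T fun F => by simp [hT]
      simp only
      rw [← this]
      refine sum_mem fun F hF => Submodule.subset_span ⟨F, ?_, rfl⟩
      simp only [hT, Finset.mem_filter, Set.Finite.mem_toFinset] at hF
      exact ⟨h.up _ hz F hF.1 (Finset.singleton_subset_iff.2 hF.2.2), hF.2.1⟩

theorem span_confFun_eq (A : M.Numbering) {k : ℕ} (hk1 : 1 ≤ k) (hk : Even k)
    {𝒮 : Set (Finset (EuclideanSpace ℝ (Fin d)))} {W : Submodule ℝ C(closure Ω, ℝ)}
    (h : M.IsConformingPair k 𝒮 W) :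
    Submodule.span ℝ (confFun A '' M.confIndex k 𝒮) = W := by
  refine le_antisymm (Submodule.span_le.2 ?_) fun f hf => ?_
  · rintro _ ⟨i, hi, rfl⟩
    exact h.mem A i hi
  · have hodd : ¬ Odd k := Nat.not_odd_iff_even.2 hk
    rw [confIndex_eq hk1 h.subset]
    exact mem_span_confFun A hk1 (𝒰 := {τ | τ ∈ 𝒮 ∧ (Odd k → 2 ≤ τ.card)})
      (fun σ hσ τ hτ hsub => ⟨h.up σ hσ.1 τ hτ hsub,
      fun hk => absurd hk hodd⟩) (h.le hf) fun τ hτ hτU x hx =>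
        h.zero f hf τ hτ (fun hτS => hτU ⟨hτS, fun hk => absurd hk hodd⟩) x hx

/-- Since the bubbles alone form a basis of `W`, only the interplay of the simplex functions with
`W` remains; the two hypotheses isolate it. -/
theorem isBasisOf_familyCell (A : M.Numbering) {k : ℕ} (hk1 : 1 ≤ k) (hk : Even k)
    {𝒮 : Set (Finset (EuclideanSpace ℝ (Fin d)))} {W : Submodule ℝ C(closure Ω, ℝ)}
    (h : M.IsConformingPair k 𝒮 W) (𝒯' : Set M.Cell)
    (hLI : ∀ (c : M.Cell →₀ ℝ) (f : C(closure Ω, ℝ)), f ∈ W → (∀ K ∉ 𝒯', c K = 0) →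
      Finsupp.linearCombination ℝ (M.crCell k) c = M.restrict f → c = 0)
    (hspan : ∀ K, M.crCell k K ∈ W.map M.restrict ⊔ Submodule.span ℝ (M.crCell k '' 𝒯')) :
    IsBasisOf (M.familyCell k A 𝒮 𝒯')
      (W.map M.restrict ⊔ Submodule.span ℝ (Set.range (M.crCell k))) := by
  classical
  constructor
  · refine linearIndependent_sumElim (linearIndependent_confBasis A k h.subset) fun c hc => ?_
    rw [span_confBasis, span_confFun_eq A hk1 hk h] at hc
    obtain ⟨f, hf, hfc⟩ := hc
    have hmap : c.mapDomain Subtype.val = 0 := by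
      refine hLI _ f hf (fun K hK => ?_) ?_
      · exact Finsupp.mapDomain_of_notMem_range _ _ (by simpa using hK)
      · rw [Finsupp.linearCombination_mapDomain, hfc]
        rfl
    exact Finsupp.mapDomain_injective Subtype.val_injective (hmap.trans Finsupp.mapDomain_zero.symm)
  · have hrange : Set.range (M.familyCell k A 𝒮 𝒯') =
        (Set.range fun i : M.confIndex k 𝒮 => M.confBasis A i.1) ∪ M.crCell k '' 𝒯' := by
      rw [familyCell, Set.Sum.elim_range, Set.image_eq_range]
    rw [hrange, Submodule.span_union, span_confBasis, span_confFun_eq A hk1 hk h]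
    refine le_antisymm (sup_le_sup_left (Submodule.span_mono (Set.image_subset_range _ _)) _)
      (sup_le le_sup_left (Submodule.span_le.2 ?_))
    rintro _ ⟨K, rfl⟩
    exact hspan K

theorem isBasisOf_familyCell_allFaces (hd : 1 ≤ d) (hconn : IsConnected Ω) (A : M.Numbering)
    {k : ℕ} (hk1 : 1 ≤ k) (hk : Even k) (K₀ : M.Cell) :
    IsBasisOf (M.familyCell k A M.allFaces {K₀}ᶜ)
      ((M.S k).map M.restrict ⊔ Submodule.span ℝ (Set.range (M.crCell k))) := by
  classical
  refine isBasisOf_familyCell A hk1 hk (M.isConformingPair_allFaces hk1) _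
    (fun c f _ hc hcf => ?_) fun K => ?_
  · ext K
    rw [eq_of_linearCombination_crCell_eq_restrict hd hconn hk c f hcf K K₀, hc K₀ (by simp)]
    rfl
  -- The omitted function is the conforming sum of all simplex functions minus the others.
  · by_cases hK : K = K₀
    · have := Fintype.ofFinite M.Cell
      have hsum := sum_crCell (M := M) hd k
      rw [← Finset.add_sum_erase _ _ (Finset.mem_univ K), ← eq_sub_iff_add_eq] at hsum
      rw [hsum]
      refine sub_mem (Submodule.mem_sup_left (Submodule.mem_map_of_mem ?_))
        (Submodule.mem_sup_right (sum_mem fun L hL => Submodule.subset_span ⟨L, ?_, rfl⟩))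
      · exact add_mem (one_mem_S k) (Submodule.smul_mem _ _ (sum_mem fun z _ =>
          sub_mem (profileHat_mem_S k z) (one_mem_S k)))
      · rw [← hK]
        exact (Finset.mem_erase.1 hL).1
    · exact Submodule.mem_sup_right (Submodule.subset_span ⟨K, hK, rfl⟩)

theorem isBasisOf_familyCell_innerFaces (hd : 1 ≤ d) (hconn : IsConnected Ω)
    (hreg : interior (closure Ω) = Ω) (A : M.Numbering) {k : ℕ} (hk1 : 1 ≤ k) (hk : Even k) :
    IsBasisOf (M.familyCell k A M.innerFaces Set.univ)
      ((M.S0 k).map M.restrict ⊔ Submodule.span ℝ (Set.range (M.crCell k))) := by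
  refine isBasisOf_familyCell A hk1 hk (M.isConformingPair_innerFaces hd hreg hk1) _
    (fun c f hf _ hcf => ?_) fun K =>
      Submodule.mem_sup_right (Submodule.subset_span ⟨K, trivial, rfl⟩)
  obtain ⟨L, z, hz, hzF⟩ := exists_vertex_mem_frontier (M := M) hd hconn hreg
  have hL : c L = 0 := by
    have h1 := congrFun (congrFun hcf L) ⟨z, vertex_mem_carrier hz⟩
    rw [sum_smul_crCell_apply] at h1
    have h2 : M.restrict f L ⟨z, vertex_mem_carrier hz⟩ = 0 :=
      ((mem_S0_iff hd hreg).1 hf).2 ⟨z, _⟩ hzF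
    rw [h2] at h1
    exact (mul_eq_zero.1 h1).resolve_right (L.crValue_vertex_pos hd hk hz).ne'
  ext K
  rw [eq_of_linearCombination_crCell_eq_restrict hd hconn hk c f hcf K L, hL]
  rfl

end Mesh

end CrouzeixRaviart

end

theorem mainTheorem2 (d : ℕ) (hd : 2 ≤ d) (Ω : Set (EuclideanSpace ℝ (Fin d)))
    (hconn : IsConnected Ω) (hreg : interior (closure Ω) = Ω)
    (M : CrouzeixRaviart.Mesh d Ω) (A : M.Numbering) (k : ℕ) (hk : 1 ≤ k) :
    (Odd k →
      CrouzeixRaviart.IsBasisOf (M.familyFacet k A M.allFaces) (M.CR k) ∧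
      CrouzeixRaviart.IsBasisOf (M.familyFacet k A M.innerFaces) (M.CR0 k)) ∧
    (Even k →
      (∀ K₀ : M.Cell,
        CrouzeixRaviart.IsBasisOf (M.familyCell k A M.allFaces {K₀}ᶜ) (M.CR k)) ∧
      CrouzeixRaviart.IsBasisOf (M.familyCell k A M.innerFaces Set.univ) (M.CR0 k)) := by
  have hd1 : 1 ≤ d := by omega
  refine ⟨fun hodd => ?_, fun heven => ?_⟩
  · have hne : ¬ Even k := Nat.not_even_iff_odd.2 hodd
    rw [CrouzeixRaviart.Mesh.CR, CrouzeixRaviart.Mesh.CR0, if_neg hne, if_neg hne]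
    exact ⟨CrouzeixRaviart.Mesh.isBasisOf_familyFacet hd A hodd (M.isConformingPair_allFaces hk),
      CrouzeixRaviart.Mesh.isBasisOf_familyFacet hd A hodd
        (M.isConformingPair_innerFaces hd1 hreg hk)⟩
  · rw [CrouzeixRaviart.Mesh.CR, CrouzeixRaviart.Mesh.CR0, if_pos heven, if_pos heven]
    exact ⟨CrouzeixRaviart.Mesh.isBasisOf_familyCell_allFaces hd1 hconn A hk heven,
      CrouzeixRaviart.Mesh.isBasisOf_familyCell_innerFaces hd1 hconn hreg A hk heven⟩
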